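/- **Notation.** Let $q\in\mathbb C$, $0<|q|<1$, fix a logarithm $\log q$ and put $q^z=e^{z\log q}$. Put $(x)_\infty=\prod_{k\ge0}(1-xq^k)$, $(x_1,\dots,x_n)_\infty=(x_1)_\infty\cdots(x_n)_\infty$, $\theta(x)=(x,q/x)_\infty$, and for $n\in\mathbb Z$ let $(x)_n=(x)_\infty/(xq^n)_\infty$, i.e. $(x)_n=\prod_{k=0}^{n-1}(1-xq^k)$ and $(x)_{-n}=\prod_{k=1}^{n}(1-xq^{-k})^{-1}$ for $n\ge0$. A fraction written $abc/def$ means $(abc)/(def)$. Let $a_j=q^{\alpha_j}$, $c_j=q^{\gamma_j}$ $(1\le j\le N)$, $b_i=q^{\beta_i}$ $(1\le i\le M)$ with complex $\alpha_j,\gamma_j,\beta_i$, and write $\mathbf a=a_1\cdots a_N$, $\mathbf c=c_1\cdots c_N$, $b_{\ge i}=b_i b_{i+1}\cdots b_M$ (so $b_{\ge M+1}=1$). For $m\in\mathbb Z_{\ge0}^M$ put $m(l)=\sum_{i\le l}m_i-\sum_{i>l}m_i$. All functions below are functions of $(\log t_1,\dots,\log t_M)\in\mathbb C^M$, with $t_i^z=e^{z\log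 t_i}$ and $(t_r/t_{r+1})^z=e^{z(\log t_r-\log t_{r+1})}$; the $q$-shift $T_s$ replaces $\log t_s$ by $\log t_s+\log q$. **Series.** For $0\le L\le M$, $1\le k\le N$, and $L<l\le M$ (for $\mathcal F^{L;k,l}$) resp. $1\le l\le L$ (for $\mathcal G^{L;k,l}$), sums being over $m\in\mathbb Z_{\ge0}^M$, let $$\mathcal F^L=\sum_m\prod_{j=1}^N\frac{(a_j/b_{\ge L+1})_{m(L)}}{(c_j/b_{\ge L+1})_{m(L)}}\prod_{i=1}^M\frac{(b_i)_{m_i}}{(q)_{m_i}}\prod_{i\le L}t_i^{m_i}\prod_{i>L}\Big(\frac{q}{b_it_i}\Big)^{m_i},$$ $$\mathcal F^{L;k,l}=\sum_m\prod_{j=1}^N\frac{(qa_k/c_j)_{m_l}}{(qa_k/a_j)_{m_l}}\prod_{i\ne l}\frac{(b_i)_{m_i}}{(q)_{m_i}}\cdot\frac{(a_k/b_{\ge l+1})_{m(l)}}{(qa_k/b_{\ge l})_{m(l)}}\prod_{i<l}\Big(\frac{qt_i}{b_lt_l}\Big)^{m_i}\prod_{i>l}\Big(\frac{b_lt_l}{b_it_i}\Big)^{m_i}\Big(\frac{\mathbf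 c}{\mathbf a}\frac{q}{b_lt_l}\Big)^{m_l},$$ $$\mathcal G^{L;k,l}=\sum_m\prod_{j=1}^N\frac{(qa_j/c_k)_{m_l}}{(qc_j/c_k)_{m_l}}\prod_{i\ne l}\frac{(b_i)_{m_i}}{(q)_{m_i}}\cdot\frac{(c_k/qb_{\ge l+1})_{m(l-1)}}{(c_k/b_{\ge l})_{m(l-1)}}\prod_{i<l}\Big(\frac{qt_i}{b_lt_l}\Big)^{m_i}\prod_{i>l}\Big(\frac{b_lt_l}{b_it_i}\Big)^{m_i}\Big(\frac{b_lt_l}{q}\Big)^{m_l}.$$ Let $\boldsymbol u^{L,\mathrm{id}}={}^{\rm T}(u_0,u_{1,1},\dots,u_{1,M},u_{2,1},\dots,u_{N,M})$, where $u_0=\prod_{i>L}t_i^{-\beta_i}\cdot\mathcal F^L$, $u_{k,l}=t_l^{1+\sum_{i>l}\beta_i-\gamma_k}\prod_{i>l}t_i^{-\beta_i}\cdot\mathcal G^{L;k,l}$ for $l\le L$ and $u_{k,l}=t_l^{-\alpha_k+\sum_{i>l}\beta_i}\prod_{i>l}t_i^{-\beta_i}\cdot\mathcal F^{L;k,l}$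 for $l>L$. For $\sigma\in\mathfrak S_M$, $\boldsymbol u^{L,\sigma}$ is obtained from $\boldsymbol u^{L,\mathrm{id}}$ by replacing $(\beta_i,b_i,\log t_i,t_i)$ by $(\beta_{\sigma(i)},b_{\sigma(i)},\log t_{\sigma(i)},t_{\sigma(i)})$ for all $i$. Let $$D^{L,\sigma}=\Big\{|t_{\sigma(i)}|<1\ (i\le L),\ \Big|\frac{\mathbf c}{\mathbf a}\frac{q}{b_{\sigma(i)}t_{\sigma(i)}}\Big|<1\ (i>L),\ \Big|\frac{qt_{\sigma(i)}}{b_{\sigma(j)}t_{\sigma(j)}}\Big|<1\ (i<j)\Big\}.$$ **Matrices.** Rows and columns are indexed by $0$ and the pairs $(k,l)$, $1\le k\le N$, $1\le l\le M$. $A^{L,\mathrm{id}}$ $(0\le L\le M-1)$: put $p=L+1$, $t=t_p$, $\vartheta=\theta(tb_p\mathbf a/\mathbf c)$. The entries are $$A_{0,0}=\prod_{j}\frac{(qb_{\ge p+1}/a_j,\,qb_{\ge p}/c_j)_\infty}{(qb_{\ge p}/a_j,\,qb_{\ge p+1}/c_j)_\infty}\cdot\frac{\theta(t\mathbf a/\mathbf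 c)}{\vartheta}\,t^{-\beta_p},$$ $$A_{0,(d,p)}=\prod_j\frac{(c_d/a_j)_\infty}{(qb_{\ge p}/a_j)_\infty}\prod_{j\ne d}\frac{(qb_{\ge p}/c_j)_\infty}{(c_d/c_j)_\infty}\cdot\frac{(b_p)_\infty}{(c_d/qb_{\ge p+1})_\infty}\cdot\frac{\theta(t\mathbf ac_d/qb_{\ge p+1}\mathbf c)}{\vartheta}\,t^{-1-\sum_{i\ge p}\beta_i+\gamma_d},$$ $$A_{(k,p),0}=\prod_{j\ne k}\frac{(qb_{\ge p+1}/a_j)_\infty}{(qa_k/a_j)_\infty}\cdot\frac{(q/b_p)_\infty}{(qa_k/b_{\ge p})_\infty}\prod_j\frac{(qa_k/c_j)_\infty}{(qb_{\ge p+1}/c_j)_\infty}\cdot\frac{\theta(tb_{\ge p}\mathbf a/a_k\mathbf c)}{\vartheta}\,t^{-\alpha_k+\sum_{i>p}\beta_i},$$ $$A_{(k,p),(d,p)}=\prod_{j\ne k}\frac{(c_d/a_j)_\infty}{(qa_k/a_j)_\infty}\cdot\frac{(c_d/b_{\ge p})_\infty}{(qa_k/b_{\ge p})_\infty}\prod_{j\ne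 d}\frac{(qa_k/c_j)_\infty}{(c_d/c_j)_\infty}\cdot\frac{(a_k/b_{\ge p+1})_\infty}{(c_d/qb_{\ge p+1})_\infty}\cdot\frac{\theta(tb_p\mathbf ac_d/q\mathbf ca_k)}{\vartheta}\,t^{-1-\alpha_k+\gamma_d};$$ the entry at $((k,l),(k,l))$ is $1$ for $l\ne p$, and all other entries are $0$. $B^{L,\mathrm{id}}$ $(1\le L\le M)$: put $p=L$, $t=t_p$. The entries are $$B_{0,0}=\prod_j\frac{(a_j/b_{\ge p+1},\,c_j/b_{\ge p})_\infty}{(a_j/b_{\ge p},\,c_j/b_{\ge p+1})_\infty}\cdot\frac{\theta(tb_p)}{\theta(t)}\,t^{\beta_p},$$ $$B_{0,(d,p)}=\prod_j\frac{(c_j/a_d)_\infty}{(c_j/b_{\ge p+1})_\infty}\prod_{j\ne d}\frac{(a_j/b_{\ge p+1})_\infty}{(a_j/a_d)_\infty}\cdot\frac{(b_p)_\infty}{(b_{\ge p}/a_d)_\infty}\cdot\frac{\theta(ta_d/b_{\ge p+1})}{\theta(t)}\,t^{\alpha_d-\sum_{i>p}\beta_i},$$ $$B_{(k,p),0}=\prod_{j\ne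 k}\frac{(c_j/b_{\ge p})_\infty}{(qc_j/c_k)_\infty}\cdot\frac{(q/b_p)_\infty}{(q^2b_{\ge p+1}/c_k)_\infty}\prod_j\frac{(qa_j/c_k)_\infty}{(a_j/b_{\ge p})_\infty}\cdot\frac{\theta(tqb_{\ge p}/c_k)}{\theta(t)}\,t^{1+\sum_{i\ge p}\beta_i-\gamma_k},$$ $$B_{(k,p),(d,p)}=\prod_{j\ne k}\frac{(c_j/a_d)_\infty}{(qc_j/c_k)_\infty}\cdot\frac{(qb_{\ge p+1}/a_d)_\infty}{(q^2b_{\ge p+1}/c_k)_\infty}\prod_{j\ne d}\frac{(qa_j/c_k)_\infty}{(a_j/a_d)_\infty}\cdot\frac{(qb_{\ge p}/c_k)_\infty}{(b_{\ge p}/a_d)_\infty}\cdot\frac{\theta(tqa_d/c_k)}{\theta(t)}\,t^{1+\alpha_d-\gamma_k};$$ the entry at $((k,l),(k,l))$ is $1$ for $l\ne p$, and all other entries are $0$. $S_{s_r}^{M,\mathrm{id}}$ $(1\le r\le M-1)$, $s_r=(r,r+1)$: put $z=t_r/t_{r+1}$. The entry at $(0,0)$ is $1$, the entry at $((k,l),(k,l))$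 is $1$ for $l\ne r,r+1$, the entries at $((k,l),(k,l'))$ with $l,l'\in\{r,r+1\}$ are $$S^k_{r,r}=\frac{(q/b_{r+1},\,b_r)_\infty}{(q^2b_rb_{\ge r+2}/c_k,\,c_k/qb_{\ge r+1})_\infty}\frac{\theta(zc_k/qb_{\ge r+1})}{\theta(zb_r)}z^{-1-\sum_{i\ge r}\beta_i+\gamma_k},$$ $$S^k_{r,r+1}=\frac{(q^2b_{\ge r+2}/c_k,\,qb_{\ge r}/c_k)_\infty}{(q^2b_rb_{\ge r+2}/c_k,\,qb_{\ge r+1}/c_k)_\infty}\frac{\theta(z)}{\theta(zb_r)}z^{-\beta_r},$$ $$S^k_{r+1,r}=\frac{(c_k/b_{\ge r},\,c_k/qb_{\ge r+2})_\infty}{(c_k/b_rb_{\ge r+2},\,c_k/qb_{\ge r+1})_\infty}\frac{\theta(zb_r/b_{r+1})}{\theta(zb_r)}z^{-\beta_{r+1}},$$ $$S^k_{r+1,r+1}=\frac{(q/b_r,\,b_{r+1})_\infty}{(c_k/b_rb_{\ge r+2},\,qb_{\ge r+1}/c_k)_\infty}\frac{\theta(zqb_rb_{\ge r+2}/c_k)}{\theta(zb_r)}z^{1+\sum_{i\ge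 r+2}\beta_i-\gamma_k},$$ and all other entries are $0$. For $\sigma\in\mathfrak S_M$, the matrices $A^{L,\sigma}$, $B^{L,\sigma}$, $S_{s_r}^{M,\sigma}$ are obtained by replacing $(\beta_i,b_i,\log t_i,t_i)$ by $(\beta_{\sigma(i)},b_{\sigma(i)},\log t_{\sigma(i)},t_{\sigma(i)})$ for all $i$. **Theorem.** Assume that for every $\sigma\in\mathfrak S_M$ and every $1\le i\le M+1$ none of the numbers $a_j/a_k$, $c_j/c_k$ $(1\le j\ne k\le N)$, $a_j/b_{\sigma(i)}\cdots b_{\sigma(M)}$, $c_j/b_{\sigma(i)}\cdots b_{\sigma(M)}$ $(1\le j\le N)$ is an integral power of $q$. Let $\Omega$ be the set of points at which none of $t_i$, $t_ib_i\mathbf a/\mathbf c$ $(1\le i\le M)$, $t_ib_i/t_j$ $(i\ne j)$ is an integral power of $q$. Then: (1) For $0\le L\le M$ and $\sigma\in\mathfrak S_M$, the series in $\boldsymbol u^{L,\sigma}$ converge absolutely on $D^{L,\sigma}$, and $\boldsymbol u^{L,\sigma}$ has an analytic continuation from $D^{L,\sigma}$ to $D^{L,\sigma}\cup\Omega$. (2)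 For $0\le L_1,L_2\le M$ and $\sigma_1,\sigma_2\in\mathfrak S_M$ with $\sigma_2=s_{r_1}\cdots s_{r_I}\sigma_1$, where products of permutations are read from left to right, i.e. $(s_r\sigma)(i)=\sigma(s_r(i))$, the analytic continuations satisfy on $\Omega$ $$\boldsymbol u^{L_2,\sigma_2}=A^{L_2,\sigma_2}A^{L_2+1,\sigma_2}\cdots A^{M-1,\sigma_2}\,S_{s_{r_1}}^{M,s_{r_2}\cdots s_{r_I}\sigma_1}S_{s_{r_2}}^{M,s_{r_3}\cdots s_{r_I}\sigma_1}\cdots S_{s_{r_I}}^{M,\sigma_1}\,B^{M,\sigma_1}B^{M-1,\sigma_1}\cdots B^{L_1+1,\sigma_1}\,\boldsymbol u^{L_1,\sigma_1}.$$ (3) Every entry of $A^{L,\sigma}$, $B^{L,\sigma}$ and $S_{s_r}^{M,\sigma}$ is a pseudo-constant, i.e. invariant under $T_1,\dots,T_M$. -/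

import Mathlib

noncomputable section

namespace QConn

open Finset

/-- `(x)_∞ = ∏_{k ≥ 0} (1 - x q^k)`. -/
def qInf (q x : ℂ) : ℂ := ∏' k : ℕ, (1 - x * q ^ k)

/-- `(x)_n` for `n : ℤ`. It equals `(x)_∞ / (x q^n)_∞`, written without the common factors:
`(x)_n = ∏_{0 ≤ k < n} (1 - x q^k)` for `n ≥ 0` and
`(x)_{-n} = 1 / ∏_{1 ≤ k ≤ n} (1 - x q^{-k})` for `n > 0`. -/
def qPoch (q x : ℂ) : ℤ → ℂ
  | Int.ofNat n => ∏ k ∈ range n, (1 - x * q ^ k)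
  | Int.negSucc n => (∏ k ∈ range (n + 1), (1 - x / q ^ (k + 1)))⁻¹

/-- `θ(x) = (x)_∞ (q/x)_∞`. -/
def theta (q x : ℂ) : ℂ := qInf q x * qInf q (q / x)

/-- The data `log q`, `α`, `β`, `γ`, from which `q = exp (log q)`, `a_j = q^{α_j}`,
`b_i = q^{β_i}`, `c_j = q^{γ_j}`. Here `log q` is any fixed logarithm of `q`. The indices
`1, …, N` and `1, …, M` are the elements of `Fin N` and `Fin M` (shifted by one). -/
structure Params (N M : ℕ) where
  logq : ℂ
  α : Fin N → ℂ
  β : Fin M → ℂ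
  γ : Fin N → ℂ

/-- The entries of the vectors of functions: `none` is the index `0`,
`some (k, l)` the index `(k, l)`. -/
abbrev Idx (N M : ℕ) : Type := Option (Fin N × Fin M)

namespace Params

variable {N M : ℕ} (P : Params N M)

def q : ℂ := Complex.exp P.logq

/-- `q^z`, for the fixed logarithm of `q`. -/
def qPow (z : ℂ) : ℂ := Complex.exp (P.logq * z)

def a (j : Fin N) : ℂ := P.qPow (P.α j)

def b (i : Fin M) : ℂ := P.qPow (P.β i)

def c (j : Fin N) : ℂ := P.qPow (P.γ j)

/-- `a_1 ⋯ a_N / c_1 ⋯ c_N`. -/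
def ac : ℂ := (∏ j, P.a j) / ∏ j, P.c j

/-- `b_{L+1} ⋯ b_M`. -/
def bTail (L : ℕ) : ℂ := ∏ i : Fin M with L ≤ i.val, P.b i

/-- `β_{L+1} + ⋯ + β_M`. -/
def βTail (L : ℕ) : ℂ := ∑ i : Fin M with L ≤ i.val, P.β i

/-- Replace `{b_i}` by `{b_{σ(i)}}` (and `β` accordingly). -/
def perm (σ : Equiv.Perm (Fin M)) : Params N M := { P with β := fun i => P.β (σ i) }

/-- For `0 ≤ L ≤ M` (that is, for `i = L + 1` in the range `1 ≤ i ≤ M + 1`), none of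
`a_j / a_k`, `c_j / c_k` (`j ≠ k`), `a_j / b_i ⋯ b_M`, `c_j / b_i ⋯ b_M` is in `q^ℤ`. -/
def Generic : Prop :=
  (∀ j k : Fin N, j ≠ k → ∀ n : ℤ, P.a j / P.a k ≠ P.q ^ n ∧ P.c j / P.c k ≠ P.q ^ n) ∧
  (∀ L ≤ M, ∀ j : Fin N, ∀ n : ℤ,
    P.a j / P.bTail L ≠ P.q ^ n ∧ P.c j / P.bTail L ≠ P.q ^ n)

/-! The functions are functions of `τ = (τ_1, …, τ_M) ∈ ℂ^M`, where `t_i = exp τ_i` and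
`t_i^z = exp (z τ_i)`: this makes the multivalued powers single valued. -/

/-- `m(L) = m_1 + ⋯ + m_L - m_{L+1} - ⋯ - m_M`. -/
def sgnSum (L : ℕ) (m : Fin M → ℕ) : ℤ :=
  ∑ i, if i.val < L then (m i : ℤ) else -(m i : ℤ)

/-- The term of index `m` of the series `𝓕^L`. -/
def termF₀ (L : ℕ) (τ : Fin M → ℂ) (m : Fin M → ℕ) : ℂ :=
  (∏ j, qPoch P.q (P.a j / P.bTail L) (sgnSum L m) /
      qPoch P.q (P.c j / P.bTail L) (sgnSum L m)) *
  (∏ i, qPoch P.q (P.b i) (m i) / qPoch P.q P.q (m i)) *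
  ∏ i, (if i.val < L then Complex.exp (τ i)
      else P.q / (P.b i * Complex.exp (τ i))) ^ m i

/-- The term of index `m` of the series `𝓕^{L;k,l}`, `L < l ≤ M`. The summation indices are named
such that `m_i` belongs to the variable `t_i` for `i ≠ l`, and `m_l` is the index of the factor
`∏_j (q a_k/c_j)_{m_l} / (q a_k/a_j)_{m_l}`; with these names the terms do not depend on `L`. -/
def termF (k : Fin N) (l : Fin M) (τ : Fin M → ℂ) (m : Fin M → ℕ) : ℂ :=
  (∏ j, qPoch P.q (P.q * P.a k / P.c j) (m l) / qPoch P.q (P.q * P.a k / P.a j) (m l)) *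
  (∏ i with i ≠ l, qPoch P.q (P.b i) (m i) / qPoch P.q P.q (m i)) *
  (qPoch P.q (P.a k / P.bTail (l + 1)) (sgnSum (l + 1) m) /
    qPoch P.q (P.q * P.a k / P.bTail l) (sgnSum (l + 1) m)) *
  (∏ i with i < l,
    (P.q * Complex.exp (τ i) / (P.b l * Complex.exp (τ l))) ^ m i) *
  (∏ i with l < i,
    (P.b l * Complex.exp (τ l) / (P.b i * Complex.exp (τ i))) ^ m i) *
  ((∏ j, P.c j / P.a j) * (P.q / (P.b l * Complex.exp (τ l)))) ^ m l

/-- The term of index `m` of the series `𝓖^{L;k,l}`, `1 ≤ l ≤ L`. The summation indices are named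
such that `m_i` belongs to the variable `t_i` for `i ≠ l`, and `m_l` is the index of the factor
`∏_j (q a_j/c_k)_{m_l} / (q c_j/c_k)_{m_l}`; with these names the terms do not depend on `L`. -/
def termG (k : Fin N) (l : Fin M) (τ : Fin M → ℂ) (m : Fin M → ℕ) : ℂ :=
  (∏ j, qPoch P.q (P.q * P.a j / P.c k) (m l) / qPoch P.q (P.q * P.c j / P.c k) (m l)) *
  (∏ i with i ≠ l, qPoch P.q (P.b i) (m i) / qPoch P.q P.q (m i)) *
  (qPoch P.q (P.c k / (P.q * P.bTail (l + 1))) (sgnSum l m) /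
    qPoch P.q (P.c k / P.bTail l) (sgnSum l m)) *
  (∏ i with i < l,
    (P.q * Complex.exp (τ i) / (P.b l * Complex.exp (τ l))) ^ m i) *
  (∏ i with l < i,
    (P.b l * Complex.exp (τ l) / (P.b i * Complex.exp (τ i))) ^ m i) *
  (P.b l * Complex.exp (τ l) / P.q) ^ m l

/-- `∏_{i > L} t_i^{-β_i}`. -/
def tailPow (L : ℕ) (τ : Fin M → ℂ) : ℂ :=
  ∏ i : Fin M with L ≤ i.val, Complex.exp (-P.β i * τ i)

/-- The vector `u^{L,id}`. -/
def uId (L : ℕ) (τ : Fin M → ℂ) : Idx N M → ℂ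
  | none => P.tailPow L τ * ∑' m : Fin M → ℕ, P.termF₀ L τ m
  | some (k, l) =>
    if l.val < L then
      Complex.exp ((1 + P.βTail (l + 1) - P.γ k) * τ l) * P.tailPow (l + 1) τ *
        ∑' m : Fin M → ℕ, P.termG k l τ m
    else
      Complex.exp ((-P.α k + P.βTail (l + 1)) * τ l) * P.tailPow (l + 1) τ *
        ∑' m : Fin M → ℕ, P.termF k l τ m

/-- The vector `u^{L,σ}`. -/
def u (L : ℕ) (σ : Equiv.Perm (Fin M)) (τ : Fin M → ℂ) : Idx N M → ℂ :=
  (P.perm σ).uId L (fun i => τ (σ i))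

/-- All the series in `u^{L,id}` converge absolutely at `τ`. -/
def ConvergesId (L : ℕ) (τ : Fin M → ℂ) : Prop :=
  Summable (P.termF₀ L τ) ∧
  ∀ (k : Fin N) (l : Fin M),
    (l.val < L → Summable (P.termG k l τ)) ∧ (L ≤ l.val → Summable (P.termF k l τ))

/-- All the series in `u^{L,σ}` converge absolutely at `τ`. -/
def Converges (L : ℕ) (σ : Equiv.Perm (Fin M)) (τ : Fin M → ℂ) : Prop :=
  (P.perm σ).ConvergesId L (fun i => τ (σ i))

/-- The region `D^{L,σ}`. -/
def region (L : ℕ) (σ : Equiv.Perm (Fin M)) : Set (Fin M → ℂ) :=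
  {τ | (∀ i : Fin M, i.val < L → ‖Complex.exp (τ (σ i))‖ < 1) ∧
    (∀ i : Fin M, L ≤ i.val →
      ‖(∏ j, P.c j / P.a j) * (P.q / (P.b (σ i) * Complex.exp (τ (σ i))))‖ < 1) ∧
    (∀ i j : Fin M, i < j →
      ‖P.q * Complex.exp (τ (σ i)) / (P.b (σ j) * Complex.exp (τ (σ j)))‖ < 1)}

/-- The set of regular points: none of `t_i`, `t_i b_i a_1 ⋯ a_N / c_1 ⋯ c_N` and `t_i b_i / t_j`
(`i ≠ j`) is in `q^ℤ`, that is, none of the theta functions in the denominators of the connection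
matrices vanishes. -/
def regular : Set (Fin M → ℂ) :=
  {τ | (∀ (i : Fin M) (n : ℤ), Complex.exp (τ i) ≠ P.q ^ n) ∧
    (∀ (i : Fin M) (n : ℤ), Complex.exp (τ i) * P.b i * P.ac ≠ P.q ^ n) ∧
    (∀ (i j : Fin M), i ≠ j → ∀ n : ℤ,
      Complex.exp (τ i) * P.b i / Complex.exp (τ j) ≠ P.q ^ n)}

/-- `V` is the analytic continuation of `u^{L,σ}` from `D^{L,σ}` to the set of regular points. -/
def IsContinuation (L : ℕ) (σ : Equiv.Perm (Fin M)) (V : (Fin M → ℂ) → Idx N M → ℂ) : Prop :=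
  AnalyticOnNhd ℂ V (P.region L σ ∪ P.regular) ∧ Set.EqOn V (P.u L σ) (P.region L σ)

/-- The matrix `A^{L,id}`, `0 ≤ L ≤ M - 1`. The element `p : Fin M` stands for the position
`L + 1`, so `p.val = L`, and `x` is the logarithm of `t_{L+1}`. -/
def matAId (p : Fin M) (x : ℂ) : Matrix (Idx N M) (Idx N M) ℂ :=
  let q := P.q
  let t := Complex.exp x
  let b₁ := P.bTail p
  let b₂ := P.bTail (p + 1)
  Matrix.of fun row col =>
    match row, col with
    | none, none =>
      (∏ j, (qInf q (q * b₂ / P.a j) * qInf q (q * b₁ / P.c j)) /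
          (qInf q (q * b₁ / P.a j) * qInf q (q * b₂ / P.c j))) *
        (theta q (t * P.ac) / theta q (t * P.b p * P.ac)) *
        Complex.exp (-P.β p * x)
    | none, some (d, l) =>
      if l = p then
        (∏ j, qInf q (P.c d / P.a j) / qInf q (q * b₁ / P.a j)) *
        (∏ j with j ≠ d, qInf q (q * b₁ / P.c j) / qInf q (P.c d / P.c j)) *
        (qInf q (P.b p) / qInf q (P.c d / (q * b₂))) *
        (theta q (t * P.ac * P.c d / (q * b₂)) / theta q (t * P.b p * P.ac)) *
        Complex.exp ((-1 - P.βTail p + P.γ d) * x)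
      else 0
    | some (k, l), none =>
      if l = p then
        (∏ j with j ≠ k, qInf q (q * b₂ / P.a j) / qInf q (q * P.a k / P.a j)) *
        (qInf q (q / P.b p) / qInf q (q * P.a k / b₁)) *
        (∏ j, qInf q (q * P.a k / P.c j) / qInf q (q * b₂ / P.c j)) *
        (theta q (t * b₁ * P.ac / P.a k) / theta q (t * P.b p * P.ac)) *
        Complex.exp ((-P.α k + P.βTail (p + 1)) * x)
      else 0
    | some (k, l), some (d, l') =>
      if l = p ∧ l' = p then
        (∏ j with j ≠ k, qInf q (P.c d / P.a j) / qInf q (q * P.a k / P.a j)) *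
        (qInf q (P.c d / b₁) / qInf q (q * P.a k / b₁)) *
        (∏ j with j ≠ d, qInf q (q * P.a k / P.c j) / qInf q (P.c d / P.c j)) *
        (qInf q (P.a k / b₂) / qInf q (P.c d / (q * b₂))) *
        (theta q (t * P.b p * P.ac * P.c d / (q * P.a k)) / theta q (t * P.b p * P.ac)) *
        Complex.exp ((-1 - P.α k + P.γ d) * x)
      else if k = d ∧ l = l' then 1 else 0

/-- The matrix `B^{L,id}`, `1 ≤ L ≤ M`. The element `p : Fin M` stands for the position `L`,
so `p.val = L - 1`, and `x` is the logarithm of `t_L`. -/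
def matBId (p : Fin M) (x : ℂ) : Matrix (Idx N M) (Idx N M) ℂ :=
  let q := P.q
  let t := Complex.exp x
  let b₀ := P.bTail p
  let b₁ := P.bTail (p + 1)
  Matrix.of fun row col =>
    match row, col with
    | none, none =>
      (∏ j, (qInf q (P.a j / b₁) * qInf q (P.c j / b₀)) /
          (qInf q (P.a j / b₀) * qInf q (P.c j / b₁))) *
        (theta q (t * P.b p) / theta q t) *
        Complex.exp (P.β p * x)
    | none, some (d, l) =>
      if l = p then
        (∏ j, qInf q (P.c j / P.a d) / qInf q (P.c j / b₁)) *
        (∏ j with j ≠ d, qInf q (P.a j / b₁) / qInf q (P.a j / P.a d)) *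
        (qInf q (P.b p) / qInf q (b₀ / P.a d)) *
        (theta q (t * P.a d / b₁) / theta q t) *
        Complex.exp ((P.α d - P.βTail (p + 1)) * x)
      else 0
    | some (k, l), none =>
      if l = p then
        (∏ j with j ≠ k, qInf q (P.c j / b₀) / qInf q (q * P.c j / P.c k)) *
        (qInf q (q / P.b p) / qInf q (q ^ 2 * b₁ / P.c k)) *
        (∏ j, qInf q (q * P.a j / P.c k) / qInf q (P.a j / b₀)) *
        (theta q (t * q * b₀ / P.c k) / theta q t) *
        Complex.exp ((1 + P.βTail p - P.γ k) * x)
      else 0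
    | some (k, l), some (d, l') =>
      if l = p ∧ l' = p then
        (∏ j with j ≠ k, qInf q (P.c j / P.a d) / qInf q (q * P.c j / P.c k)) *
        (qInf q (q * b₁ / P.a d) / qInf q (q ^ 2 * b₁ / P.c k)) *
        (∏ j with j ≠ d, qInf q (q * P.a j / P.c k) / qInf q (P.a j / P.a d)) *
        (qInf q (q * b₀ / P.c k) / qInf q (b₀ / P.a d)) *
        (theta q (t * q * P.a d / P.c k) / theta q t) *
        Complex.exp ((1 + P.α d - P.γ k) * x)
      else if k = d ∧ l = l' then 1 else 0

/-- The positions `r` and `r + 1` in `Fin M`. -/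
def lo (r : Fin (M - 1)) : Fin M := ⟨r.val, by omega⟩

def hi (r : Fin (M - 1)) : Fin M := ⟨r.val + 1, by omega⟩

/-- The transposition `s_r = (r, r + 1)`. -/
def s (r : Fin (M - 1)) : Equiv.Perm (Fin M) := Equiv.swap (lo r) (hi r)

/-- The matrix `S_{s_r}^{M,id}`; `x` is the logarithm of `t_r / t_{r+1}`. -/
def matSId (r : Fin (M - 1)) (x : ℂ) : Matrix (Idx N M) (Idx N M) ℂ :=
  let q := P.q
  let z := Complex.exp x
  let br := P.b (lo r)
  let br' := P.b (hi r)
  -- `b_r ⋯ b_M`, `b_{r+1} ⋯ b_M`, `b_{r+2} ⋯ b_M`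
  let b₀ := P.bTail r
  let b₁ := P.bTail (r + 1)
  let b₂ := P.bTail (r + 2)
  Matrix.of fun row col =>
    match row, col with
    | none, none => 1
    | none, some _ => 0
    | some _, none => 0
    | some (k, l), some (d, l') =>
      if k = d then
        if l = lo r ∧ l' = lo r then
          (qInf q (q / br') * qInf q br /
            (qInf q (q ^ 2 * br * b₂ / P.c k) * qInf q (P.c k / (q * b₁)))) *
          (theta q (z * P.c k / (q * b₁)) / theta q (z * br)) *
          Complex.exp ((-1 - P.βTail r + P.γ k) * x)
        else if l = lo r ∧ l' = hi r then
          (qInf q (q ^ 2 * b₂ / P.c k) * qInf q (q * b₀ / P.c k) /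
            (qInf q (q ^ 2 * br * b₂ / P.c k) * qInf q (q * b₁ / P.c k))) *
          (theta q z / theta q (z * br)) *
          Complex.exp (-P.β (lo r) * x)
        else if l = hi r ∧ l' = lo r then
          (qInf q (P.c k / b₀) * qInf q (P.c k / (q * b₂)) /
            (qInf q (P.c k / (br * b₂)) * qInf q (P.c k / (q * b₁)))) *
          (theta q (z * br / br') / theta q (z * br)) *
          Complex.exp (-P.β (hi r) * x)
        else if l = hi r ∧ l' = hi r then
          (qInf q (q / br) * qInf q br' /
            (qInf q (P.c k / (br * b₂)) * qInf q (q * b₁ / P.c k))) *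
          (theta q (z * q * br * b₂ / P.c k) / theta q (z * br)) *
          Complex.exp ((1 + P.βTail (r + 2) - P.γ k) * x)
        else if l = l' then 1 else 0
      else 0

/-- `A^{L,σ}`, with `L = p.val`. -/
def matA (p : Fin M) (σ : Equiv.Perm (Fin M)) (τ : Fin M → ℂ) :
    Matrix (Idx N M) (Idx N M) ℂ :=
  (P.perm σ).matAId p (τ (σ p))

/-- `B^{L,σ}`, with `L = p.val + 1`. -/
def matB (p : Fin M) (σ : Equiv.Perm (Fin M)) (τ : Fin M → ℂ) :
    Matrix (Idx N M) (Idx N M) ℂ :=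
  (P.perm σ).matBId p (τ (σ p))

/-- `S_{s_r}^{M,σ}`. -/
def matS (r : Fin (M - 1)) (σ : Equiv.Perm (Fin M)) (τ : Fin M → ℂ) :
    Matrix (Idx N M) (Idx N M) ℂ :=
  (P.perm σ).matSId r (τ (σ (lo r)) - τ (σ (hi r)))

/-- The product `A^{L,σ} A^{L+1,σ} ⋯ A^{M-1,σ}`. -/
def prodA (L : ℕ) (σ : Equiv.Perm (Fin M)) (τ : Fin M → ℂ) : Matrix (Idx N M) (Idx N M) ℂ :=
  (((List.finRange M).filter (fun p => L ≤ p.val)).map (fun p => P.matA p σ τ)).prod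

/-- The product `B^{M,σ} B^{M-1,σ} ⋯ B^{L+1,σ}`. -/
def prodB (L : ℕ) (σ : Equiv.Perm (Fin M)) (τ : Fin M → ℂ) : Matrix (Idx N M) (Idx N M) ℂ :=
  (((List.finRange M).filter (fun p => L ≤ p.val)).reverse.map (fun p => P.matB p σ τ)).prod

/-- The permutation `s_{r_1} ⋯ s_{r_I} σ`, where products of permutations are read from left to
right: `(s_r σ)(i) = σ(s_r(i))`. In Mathlib, `*` is composition, so `s_r σ` is `σ * s r`. -/
def wordPerm (σ : Equiv.Perm (Fin M)) : List (Fin (M - 1)) → Equiv.Perm (Fin M)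
  | [] => σ
  | r :: w => wordPerm σ w * s r

/-- The product `S_{s_{r_1}}^{M, s_{r_2} ⋯ s_{r_I} σ} S_{s_{r_2}}^{M, s_{r_3} ⋯ s_{r_I} σ} ⋯
S_{s_{r_I}}^{M, σ}`. -/
def prodS (σ : Equiv.Perm (Fin M)) (τ : Fin M → ℂ) :
    List (Fin (M - 1)) → Matrix (Idx N M) (Idx N M) ℂ
  | [] => 1
  | r :: w => P.matS r (wordPerm σ w) τ * prodS σ τ w

/-- The `q`-shift `t_j ↦ q t_j`. -/
def shift (j : Fin M) (τ : Fin M → ℂ) : Fin M → ℂ := Function.update τ j (τ j + P.logq)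

/-- `f` is a pseudo-constant: `T_j f = f` for all `j`. -/
def IsPseudoConstant (f : (Fin M → ℂ) → ℂ) : Prop :=
  ∀ (j : Fin M) (τ : Fin M → ℂ), f (P.shift j τ) = f τ

end Params

end QConn

end

noncomputable section

namespace QConn

open Finset Filter Topology

/-! ### `q`-shifted factorials -/

section Basic

variable {q : ℂ}

/-! Every component of `u^{L,σ}` is a product of complex powers of the `t_i` with a Laurent series
in `t_1, …, t_M`, and the whole argument takes place on Laurent coefficients. Fix all exponents
except that of `t_p`. Then the coefficients of the components `0` and `(k, p)` of `u^{p+1}` and of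
`u^p` are, as functions of the remaining exponent, the coefficients of the local solutions at `0`
and at `∞` of a one-variable `q`-hypergeometric equation of order `N + 1`; the other exponents only
shift its parameters by powers of `q`. Likewise, passing from `σ` to `σ * s r` at `L = M` is, for
each `k`, an equation of order 2 in `t_r/t_{r+1}`.

The two solution vectors may have disjoint domains of convergence, so the one-variable connection
formula is used in the form "theta function times solution at `0` equals the sum of constant times
theta function times solution at `∞`", compared coefficient by coefficient (`connection`, and
`connection_dual` for the opposite direction). The coefficients `vth` of theta decay like a
Gaussian, so all sums occurring there converge absolutely without any condition on the variable. The
formula itself is a residue theorem: the residues of a rational function with poles `q^i` and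
`q^{-i}/x_d`, `i < n`, sum to zero, and `n → ∞` is taken by dominated convergence. The constants do
not depend on the shifts of the parameters (`betaC_shift`), which is why one matrix serves for all
exponents of the other variables.

The resulting relations (`linkA`, `linkB`, `linkS`) read `E · C_i = ∑ n_κ · C'_κ` with everywhere
convergent `E`, `n_κ`, where `E` is a theta function without zeros at regular points. Chaining them
gives for each `u^{L,σ}` a multiplier `E` such that `E · u^{L,σ}`, up to the powers in front,
converges on any chosen region, in particular on the one opposite to `D^{L,σ}`. Domains of
convergence of Laurent series are logarithmically convex and every point is a midpoint of points of
these two regions, so the product converges everywhere (`reach_univ`). Thus `u^{L,σ}` continues to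
the regular points as a quotient of entire series (`exists_continuation`), and the coefficient
relations become relations between continuations (`Link.relation`). Continuations are unique because
a complex line minus a countable set is connected. The matrix entries are pseudo-constants because
the power in each entry cancels the automorphy factors of its theta quotient. -/

theorem qPoch_natCast (q x : ℂ) (n : ℕ) : qPoch q x n = ∏ k ∈ range n, (1 - x * q ^ k) := rfl

@[simp] theorem qPoch_zero (q x : ℂ) : qPoch q x 0 = 1 := by
  simpa using qPoch_natCast q x 0

theorem qPoch_natCast_succ (q x : ℂ) (n : ℕ) :
    qPoch q x (n + 1 : ℕ) = qPoch q x n * (1 - x * q ^ n) := by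
  rw [qPoch_natCast, qPoch_natCast, prod_range_succ]

theorem qPoch_natCast_add (q x : ℂ) (m n : ℕ) :
    qPoch q x (m + n : ℕ) = qPoch q x m * qPoch q (x * q ^ m) n := by
  rw [qPoch_natCast, qPoch_natCast, qPoch_natCast, prod_range_add]
  simp only [pow_add, mul_assoc]

theorem qPoch_neg_natCast (q x : ℂ) (n : ℕ) :
    qPoch q x (-n : ℤ) = (∏ k ∈ range n, (1 - x / q ^ (k + 1)))⁻¹ := by
  cases n with
  | zero => simp
  | succ n => rfl

/-- `x` is not an integral power of `q`. -/
def NotPow (q x : ℂ) : Prop := ∀ n : ℤ, x ≠ q ^ n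

theorem NotPow.one_sub_ne {x : ℂ} (hq0 : q ≠ 0) (h : NotPow q x) (n : ℤ) : 1 - x * q ^ n ≠ 0 := by
  intro h0
  apply h (-n)
  have : q ^ n ≠ 0 := zpow_ne_zero _ hq0
  rw [zpow_neg]
  field_simp
  linear_combination -h0

theorem NotPow.mul_zpow {x : ℂ} (hq0 : q ≠ 0) (h : NotPow q x) (n : ℤ) :
    NotPow q (x * q ^ n) := by
  intro k hk
  apply h (k - n)
  rw [zpow_sub₀ hq0, ← hk]
  have : q ^ n ≠ 0 := zpow_ne_zero _ hq0
  field_simp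

theorem NotPow.inv {x : ℂ} (h : NotPow q x) : NotPow q x⁻¹ := by
  intro k hk
  apply h (-k)
  rw [zpow_neg, ← hk, inv_inv]

theorem NotPow.congr_zpow {x y : ℂ} (hq0 : q ≠ 0) (h : NotPow q x) (n : ℤ) (hy : y = x * q ^ n) :
    NotPow q y := hy ▸ h.mul_zpow hq0 n

theorem NotPow.congr_mul {x y : ℂ} (hq0 : q ≠ 0) (h : NotPow q x) (hy : y = q * x) :
    NotPow q y := h.congr_zpow hq0 1 (by rw [hy, zpow_one, mul_comm])

theorem NotPow.congr_inv {x y : ℂ} (hq0 : q ≠ 0) (h : NotPow q x) (n : ℤ) (hy : y = q ^ n / x) :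
    NotPow q y := h.inv.congr_zpow hq0 n (by rw [hy]; ring)

theorem summable_qpow (hq : ‖q‖ < 1) (x : ℂ) : Summable fun k : ℕ => ‖-(x * q ^ k)‖ := by
  simp only [norm_neg, norm_mul, norm_pow]
  exact (summable_geometric_of_lt_one (norm_nonneg _) hq).mul_left _

theorem multipliable_qInf (hq : ‖q‖ < 1) (x : ℂ) : Multipliable fun k : ℕ => 1 - x * q ^ k := by
  simpa [sub_eq_add_neg] using multipliable_one_add_of_summable (summable_qpow hq x)

theorem qInf_ne_zero (hq : ‖q‖ < 1) {x : ℂ} (h : ∀ k : ℕ, 1 - x * q ^ k ≠ 0) :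
    qInf q x ≠ 0 := by
  have := tprod_one_add_ne_zero_of_summable (f := fun k : ℕ => -(x * q ^ k))
    (by simpa [← sub_eq_add_neg] using h) (summable_qpow hq x)
  simpa [qInf, sub_eq_add_neg] using this

theorem NotPow.qInf_ne_zero {x : ℂ} (hq0 : q ≠ 0) (hq : ‖q‖ < 1) (h : NotPow q x) :
    qInf q x ≠ 0 :=
  QConn.qInf_ne_zero hq fun k => by simpa using h.one_sub_ne hq0 k

theorem tendsto_qPoch (hq : ‖q‖ < 1) (x : ℂ) :
    Tendsto (fun n : ℕ => qPoch q x n) atTop (𝓝 (qInf q x)) :=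
  (multipliable_qInf hq x).hasProd.tendsto_prod_nat

theorem qInf_eq_qPoch_mul (hq : ‖q‖ < 1) (x : ℂ) (n : ℕ) :
    qInf q x = qPoch q x n * qInf q (x * q ^ n) := by
  have h1 := (tendsto_qPoch hq x).comp (tendsto_add_atTop_nat n)
  have h2 := (tendsto_qPoch hq (x * q ^ n)).const_mul (qPoch q x n)
  refine tendsto_nhds_unique h1 (h2.congr fun k => ?_)
  simp only [Function.comp]
  rw [add_comm k n, qPoch_natCast_add]

theorem qInf_succ (hq : ‖q‖ < 1) (x : ℂ) : qInf q x = (1 - x) * qInf q (x * q) := by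
  have h := qInf_eq_qPoch_mul hq x 1
  rw [qPoch_natCast] at h
  simpa using h

/-- The closed form of `(x)_n` away from the poles. -/
theorem NotPow.qPoch_mul_qInf {x : ℂ} (hq0 : q ≠ 0) (hq : ‖q‖ < 1) (h : NotPow q x) (n : ℤ) :
    qPoch q x n * qInf q (x * q ^ n) = qInf q x := by
  obtain ⟨n, rfl | rfl⟩ := n.eq_nat_or_neg
  · rw [zpow_natCast, ← qInf_eq_qPoch_mul hq]
  -- Read backwards, the product `(x q^{-n})_n` is the reciprocal of `(x)_{-n}`; so the nonnegative
  -- case, applied at `x q^{-n}`, gives the negative one.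
  · have h1 := qInf_eq_qPoch_mul hq (x * q ^ (-n : ℤ)) n
    have h2 : x * q ^ (-n : ℤ) * q ^ n = x := by
      rw [mul_assoc, ← zpow_natCast, ← zpow_add₀ hq0]; simp
    have h3 : qPoch q (x * q ^ (-n : ℤ)) n = ∏ k ∈ range n, (1 - x / q ^ (k + 1)) := by
      rw [qPoch_natCast, ← prod_range_reflect]
      refine prod_congr rfl fun k hk => ?_
      have hk := mem_range.mp hk
      rw [mul_assoc, div_eq_mul_inv, ← zpow_natCast q (n - 1 - k), ← zpow_add₀ hq0,
        ← zpow_natCast q (k + 1), ← zpow_neg]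
      congr 3
      push_cast [show n - 1 - k = n - (k + 1) by omega, Nat.cast_sub (show k + 1 ≤ n by omega)]
      ring
    have h4 : ∏ k ∈ range n, (1 - x / q ^ (k + 1)) ≠ 0 := prod_ne_zero_iff.mpr fun k _ => by
      have := h.one_sub_ne hq0 (-(k + 1 : ℕ))
      rwa [zpow_neg, zpow_natCast, ← div_eq_mul_inv] at this
    rw [h1, h2, h3, qPoch_neg_natCast, inv_mul_cancel_left₀ h4]

theorem NotPow.qPoch_eq {x : ℂ} (hq0 : q ≠ 0) (hq : ‖q‖ < 1) (h : NotPow q x) (n : ℤ) :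
    qPoch q x n = qInf q x / qInf q (x * q ^ n) := by
  rw [eq_div_iff ((h.mul_zpow hq0 n).qInf_ne_zero hq0 hq), h.qPoch_mul_qInf hq0 hq]

theorem NotPow.qPoch_ne_zero {x : ℂ} (hq0 : q ≠ 0) (hq : ‖q‖ < 1) (h : NotPow q x) (n : ℤ) :
    qPoch q x n ≠ 0 := fun h0 => h.qInf_ne_zero hq0 hq (by rw [← h.qPoch_mul_qInf hq0 hq n, h0,
      zero_mul])

theorem NotPow.qPoch_add {x : ℂ} (hq0 : q ≠ 0) (hq : ‖q‖ < 1) (h : NotPow q x) (m n : ℤ) :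
    qPoch q x (m + n) = qPoch q x m * qPoch q (x * q ^ m) n := by
  rw [h.qPoch_eq hq0 hq, h.qPoch_eq hq0 hq, (h.mul_zpow hq0 m).qPoch_eq hq0 hq, zpow_add₀ hq0,
    ← mul_assoc]
  have := (h.mul_zpow hq0 m).qInf_ne_zero hq0 hq
  field_simp

theorem one_sub_pow_succ_ne (hq : ‖q‖ < 1) (k : ℕ) : 1 - q * q ^ k ≠ 0 := by
  intro h
  have h1 : q ^ (k + 1) = 1 := by rw [pow_succ']; linear_combination -h
  have h2 : ‖q‖ ^ (k + 1) < 1 := pow_lt_one₀ (norm_nonneg _) hq (by omega)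
  rw [← norm_pow, h1, norm_one] at h2
  exact lt_irrefl _ h2

theorem qPoch_self_ne_zero (hq : ‖q‖ < 1) (n : ℕ) : qPoch q q n ≠ 0 := by
  rw [qPoch_natCast]
  exact prod_ne_zero_iff.mpr fun k _ => one_sub_pow_succ_ne hq k

theorem qInf_self_ne_zero (hq : ‖q‖ < 1) : qInf q q ≠ 0 :=
  qInf_ne_zero hq (one_sub_pow_succ_ne hq)

/-- In the denominator, `(q)_n` kills the terms with `n < 0`. -/
theorem qPoch_self_of_neg (hq0 : q ≠ 0) {n : ℤ} (hn : n < 0) : qPoch q q n = 0 := by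
  obtain ⟨n, rfl⟩ : ∃ k : ℕ, n = -(k : ℤ) := ⟨n.natAbs, by omega⟩
  rw [qPoch_neg_natCast, inv_eq_zero]
  exact prod_eq_zero (i := 0) (mem_range.mpr (by omega)) (by simp [hq0])

end Basic

/-! ### The theta function and its Laurent coefficients -/

/-- `(-1)^s q^{s(s-1)/2}`, up to the factor `1/(q)_∞` the Laurent coefficients of `θ`. -/
def vth (q : ℂ) (s : ℤ) : ℂ := (-1) ^ s * q ^ (s * (s - 1) / 2)

section Theta

variable {q : ℂ}

@[simp] theorem vth_zero (q : ℂ) : vth q 0 = 1 := by simp [vth]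

theorem vth_ne_zero (hq0 : q ≠ 0) (s : ℤ) : vth q s ≠ 0 :=
  mul_ne_zero (zpow_ne_zero _ (by norm_num)) (zpow_ne_zero _ hq0)

/-- The exponent `s(s-1)/2` is quadratic with polar form `s t`. A shift of the index therefore
multiplies `vth` by a constant and a geometric factor, which is the quasi-periodicity of theta seen
on coefficients. -/
theorem vth_add (hq0 : q ≠ 0) (s t : ℤ) : vth q (s + t) = vth q s * vth q t * q ^ (s * t) := by
  have h : (s + t) * (s + t - 1) / 2 = s * (s - 1) / 2 + t * (t - 1) / 2 + s * t := by
    have h1 : 2 ∣ s * (s - 1) := by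
      have := Int.even_mul_succ_self (s - 1)
      rw [sub_add_cancel, mul_comm] at this
      exact this.two_dvd
    have h2 : 2 ∣ t * (t - 1) := by
      have := Int.even_mul_succ_self (t - 1)
      rw [sub_add_cancel, mul_comm] at this
      exact this.two_dvd
    obtain ⟨u, hu⟩ := h1
    obtain ⟨v, hv⟩ := h2
    rw [hu, hv, show (s + t) * (s + t - 1) = 2 * (u + v + s * t) by linear_combination hu + hv]
    simp
  rw [vth, vth, vth, h, zpow_add₀ hq0, zpow_add₀ hq0, zpow_add₀ (by norm_num)]
  ring

theorem vth_one (q : ℂ) : vth q 1 = -1 := by simp [vth]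

theorem vth_neg_one (q : ℂ) : vth q (-1) = -q := by simp [vth]

theorem vth_succ (hq0 : q ≠ 0) (s : ℤ) : vth q (s + 1) = -(q ^ s) * vth q s := by
  rw [vth_add hq0, vth_one, mul_one]; ring

theorem vth_pred (hq0 : q ≠ 0) (s : ℤ) : vth q (s - 1) = -(q ^ (1 - s)) * vth q s := by
  rw [sub_eq_add_neg, vth_add hq0, vth_neg_one, mul_neg_one, sub_eq_add_neg, zpow_add₀ hq0, zpow_one]
  ring

theorem vth_neg (hq0 : q ≠ 0) (s : ℤ) : vth q (-s) = vth q s * q ^ s := by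
  have h1 : 2 ∣ s * (s - 1) := by
    have := Int.even_mul_succ_self (s - 1)
    rw [sub_add_cancel, mul_comm] at this
    exact this.two_dvd
  obtain ⟨u, hu⟩ := h1
  have h2 : (-s) * (-s - 1) = 2 * (u + s) := by linear_combination hu
  rw [vth, vth, hu, h2, Int.mul_ediv_cancel_left _ two_ne_zero,
    Int.mul_ediv_cancel_left _ two_ne_zero, zpow_add₀ hq0, ← inv_zpow',
    show (-1 : ℂ)⁻¹ = -1 by norm_num, mul_assoc]

theorem theta_mul_q (hq0 : q ≠ 0) (hq : ‖q‖ < 1) {x : ℂ} (hx : x ≠ 0) :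
    theta q (x * q) = -x⁻¹ * theta q x := by
  have h1 := qInf_succ hq x
  have h2 := qInf_succ hq (q / (x * q))
  have h3 : q / (x * q) * q = q / x := by field_simp
  have h4 : q / (x * q) = x⁻¹ := by field_simp
  rw [theta, theta, h1, h2, h3, h4]
  field_simp
  ring

/-- Iteration of `theta_mul_q` in both directions. The factor that appears is the term of index `n`
of theta's own Laurent series. -/
theorem theta_mul_zpow (hq0 : q ≠ 0) (hq : ‖q‖ < 1) {x : ℂ} (hx : x ≠ 0) (n : ℤ) :
    theta q (x * q ^ n) * (vth q n * x ^ n) = theta q x := by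
  induction n with
  | zero => simp
  | succ n ih =>
    have h := theta_mul_q hq0 hq (x := x * q ^ (n : ℤ)) (mul_ne_zero hx (zpow_ne_zero _ hq0))
    rw [zpow_add_one₀ hq0, ← mul_assoc x, h, vth_succ hq0, zpow_add_one₀ hx, ← ih]
    have : q ^ (n : ℤ) ≠ 0 := zpow_ne_zero _ hq0
    field_simp
  | pred n ih =>
    have h := theta_mul_q hq0 hq (x := x * q ^ (-(n : ℤ) - 1))
      (mul_ne_zero hx (zpow_ne_zero _ hq0))
    rw [mul_assoc, ← zpow_add_one₀ hq0, sub_add_cancel] at h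
    rw [h] at ih
    rw [vth_pred hq0, ← ih, zpow_sub_one₀ hx, show (1 : ℤ) - -(n : ℤ) = -(-(n : ℤ) - 1) by ring,
      zpow_neg]
    have : q ^ (-(n : ℤ) - 1) ≠ 0 := zpow_ne_zero _ hq0
    field_simp

theorem NotPow.theta_ne_zero {x : ℂ} (hq0 : q ≠ 0) (hq : ‖q‖ < 1) (h : NotPow q x) :
    theta q x ≠ 0 :=
  mul_ne_zero (h.qInf_ne_zero hq0 hq)
    ((h.congr_inv hq0 1 (by rw [zpow_one])).qInf_ne_zero hq0 hq)

/-- Reflection of the quotient `(x)_n/(y)_n`. -/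
theorem NotPow.qPoch_neg_div {x y : ℂ} (hq0 : q ≠ 0) (hq : ‖q‖ < 1) (hx0 : x ≠ 0) (hy0 : y ≠ 0)
    (hx : NotPow q x) (hy : NotPow q y) (n : ℤ) :
    qPoch q x (-n) / qPoch q y (-n) = (y / x) ^ n * (qPoch q (q / y) n / qPoch q (q / x) n) := by
  -- The product `(x)_{-n} (q/x)_n` is the theta quotient `θ(x)/θ(x q^{-n})`, hence elementary; the
  -- factor `vth q (-n)` does not depend on `x` and drops out of the quotient for `x` and `y`.
  have key : ∀ {x : ℂ}, x ≠ 0 → NotPow q x →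
      qPoch q x (-n) * qPoch q (q / x) n = vth q (-n) * x ^ (-n) := by
    intro x hx0 hx
    have hx' : NotPow q (q / x) := hx.congr_inv hq0 1 (by rw [zpow_one])
    have h := theta_mul_zpow hq0 hq hx0 (-n)
    rw [hx.qPoch_eq hq0 hq, hx'.qPoch_eq hq0 hq, div_mul_div_comm]
    have h1 : q / x * q ^ n = q / (x * q ^ (-n)) := by
      rw [zpow_neg]
      have : q ^ n ≠ 0 := zpow_ne_zero _ hq0
      field_simp
    rw [h1, ← theta, ← theta, ← h, mul_div_cancel_left₀ _
      ((hx.mul_zpow hq0 (-n)).theta_ne_zero hq0 hq)]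
  have h1 := key hx0 hx
  have h2 := key hy0 hy
  have hv := vth_ne_zero hq0 (-n)
  have e1 := (hx.congr_inv (y := q / x) hq0 1 (by rw [zpow_one])).qPoch_ne_zero hq0 hq n
  have e2 := (hy.congr_inv (y := q / y) hq0 1 (by rw [zpow_one])).qPoch_ne_zero hq0 hq n
  have e3 := hy.qPoch_ne_zero hq0 hq (-n)
  have hxn : x ^ n ≠ 0 := zpow_ne_zero _ hx0
  have hyn : y ^ n ≠ 0 := zpow_ne_zero _ hy0
  rw [zpow_neg] at h1 h2
  rw [div_zpow, div_eq_iff e3]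
  field_simp
  have h1' : qPoch q x (-n) * qPoch q (q / x) n * x ^ n = vth q (-n) := by
    rw [h1]; field_simp
  have h2' : qPoch q y (-n) * qPoch q (q / y) n * y ^ n = vth q (-n) := by
    rw [h2]; field_simp
  linear_combination h1' - h2'

end Theta

end QConn

end

noncomputable section

namespace QConn

open Finset Filter Topology

/-! ### Bounds and the Jacobi triple product -/

section Bounds

variable {q : ℂ}

theorem norm_qPoch_le (hq : ‖q‖ < 1) {x : ℂ} {R : ℝ} (hx : ‖x‖ ≤ R) (n : ℕ) :
    ‖qPoch q x n‖ ≤ Real.exp (R * (1 - ‖q‖)⁻¹) := by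
  have hR : 0 ≤ R := (norm_nonneg _).trans hx
  rw [qPoch_natCast, norm_prod]
  calc ∏ k ∈ range n, ‖1 - x * q ^ k‖ ≤ ∏ k ∈ range n, Real.exp (R * ‖q‖ ^ k) := by
        refine prod_le_prod (fun _ _ => norm_nonneg _) fun k _ => ?_
        calc ‖1 - x * q ^ k‖ ≤ ‖(1 : ℂ)‖ + ‖x * q ^ k‖ := norm_sub_le _ _
          _ ≤ R * ‖q‖ ^ k + 1 := by
            rw [norm_one, norm_mul, norm_pow, add_comm]
            gcongr
          _ ≤ _ := Real.add_one_le_exp _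
    _ = Real.exp (R * ∑ k ∈ range n, ‖q‖ ^ k) := by rw [← Real.exp_sum, mul_sum]
    _ ≤ _ := by
      gcongr
      rw [← tsum_geometric_of_lt_one (norm_nonneg _) hq]
      exact (summable_geometric_of_lt_one (norm_nonneg _) hq).sum_le_tsum _
        (fun _ _ => by positivity)

/-- The reciprocals converge, since no factor vanishes and the limit `qInf q x` is nonzero; a
convergent sequence is bounded. -/
theorem exists_le_norm_qPoch (hq : ‖q‖ < 1) {x : ℂ} (h : ∀ k : ℕ, 1 - x * q ^ k ≠ 0) :
    ∃ δ > 0, ∀ n : ℕ, δ ≤ ‖qPoch q x n‖ := by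
  have h0 : ∀ n : ℕ, qPoch q x n ≠ 0 := fun n => by
    rw [qPoch_natCast]; exact prod_ne_zero_iff.mpr fun k _ => h k
  have h1 : Tendsto (fun n : ℕ => ‖(qPoch q x n)⁻¹‖) atTop (𝓝 ‖(qInf q x)⁻¹‖) :=
    ((tendsto_qPoch hq x).inv₀ (qInf_ne_zero hq h)).norm
  obtain ⟨B, hB⟩ := h1.bddAbove_range
  have hB' : ∀ n : ℕ, ‖(qPoch q x n)⁻¹‖ ≤ B := fun n => hB ⟨n, rfl⟩
  have hBpos : 0 < B := lt_of_lt_of_le (norm_pos_iff.mpr (inv_ne_zero (h0 0))) (hB' 0)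
  refine ⟨B⁻¹, inv_pos.mpr hBpos, fun n => ?_⟩
  have := hB' n
  rw [norm_inv] at this
  exact inv_le_of_inv_le₀ (norm_pos_iff.mpr (h0 n)) this

theorem norm_vth_succ (hq0 : q ≠ 0) (s : ℤ) : ‖vth q (s + 1)‖ = ‖q‖ ^ s * ‖vth q s‖ := by
  rw [vth_succ hq0, norm_mul, norm_neg, norm_zpow]

/-- Ratio test: the quotient of successive terms is `‖q‖^n R`, which tends to `0` for every `R`.
Because of this decay, multiplication by theta removes all restrictions on the size of the
variables. -/
theorem summable_vth_nat (hq0 : q ≠ 0) (hq : ‖q‖ < 1) {R : ℝ} (hR : 0 < R) :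
    Summable fun n : ℕ => ‖vth q n‖ * R ^ n := by
  refine summable_of_ratio_test_tendsto_lt_one (l := 0) one_pos
    (Eventually.of_forall fun n => ?_) ?_
  · exact (mul_pos (norm_pos_iff.mpr (vth_ne_zero hq0 _)) (pow_pos hR _)).ne'
  · have h : ∀ n : ℕ, ‖‖vth q (n + 1 : ℕ)‖ * R ^ (n + 1)‖ / ‖‖vth q n‖ * R ^ n‖ =
        ‖q‖ ^ n * R := fun n => by
      have h1 : ‖vth q n‖ ≠ 0 := norm_ne_zero_iff.mpr (vth_ne_zero hq0 _)
      have h2 : R ^ n ≠ 0 := (pow_pos hR _).ne'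
      rw [Real.norm_of_nonneg (by positivity), Real.norm_of_nonneg (by positivity), Nat.cast_succ,
        norm_vth_succ hq0, zpow_natCast, pow_succ]
      field_simp
    simp only [h]
    simpa using (tendsto_pow_atTop_nhds_zero_of_lt_one (norm_nonneg _) hq).mul_const R

theorem summable_vth_neg_nat (hq0 : q ≠ 0) (hq : ‖q‖ < 1) {R : ℝ} (hR : 0 < R) :
    Summable fun n : ℕ => ‖vth q (-n)‖ * R ^ n := by
  refine (summable_vth_nat hq0 hq (R := ‖q‖ * R)
    (mul_pos (norm_pos_iff.mpr hq0) hR)).congr fun n => ?_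
  rw [vth_neg hq0, norm_mul, norm_zpow, zpow_natCast, mul_pow, mul_assoc]

theorem summable_vth (hq0 : q ≠ 0) (hq : ‖q‖ < 1) {R : ℝ} (hR : 0 < R) :
    Summable fun s : ℤ => ‖vth q s‖ * R ^ s := by
  refine Summable.of_nat_of_neg ?_ ?_
  · simpa using summable_vth_nat hq0 hq hR
  · simpa [zpow_neg, inv_pow] using summable_vth_neg_nat hq0 hq (inv_pos.mpr hR)

theorem summable_vth_mul_zpow (hq0 : q ≠ 0) (hq : ‖q‖ < 1) {x : ℂ} (hx : x ≠ 0) :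
    Summable fun s : ℤ => ‖vth q s * x ^ s‖ := by
  simpa using summable_vth hq0 hq (norm_pos_iff.mpr hx)

/-- The recursion holds for all integers: for negative index `qPoch q q` is `0`, and `0⁻¹ = 0` is
the correct value of `1/(q)_s`; at `s = 0` the factor `1 - q^0` vanishes. -/
theorem inv_qPoch_self_pred (hq0 : q ≠ 0) (hq : ‖q‖ < 1) (s : ℤ) :
    (qPoch q q (s - 1))⁻¹ = (1 - q ^ s) * (qPoch q q s)⁻¹ := by
  rcases lt_trichotomy s 0 with h | h | h
  · rw [qPoch_self_of_neg hq0 h, qPoch_self_of_neg hq0 (by omega)]; simp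
  · subst h; rw [qPoch_self_of_neg hq0 (by omega)]; simp
  · obtain ⟨n, rfl⟩ : ∃ n : ℕ, s = (n + 1 : ℕ) := ⟨(s - 1).toNat, by omega⟩
    rw [qPoch_natCast_succ, show ((n + 1 : ℕ) : ℤ) - 1 = n by simp, zpow_natCast, pow_succ']
    have h1 := one_sub_pow_succ_ne hq n
    have h2 := qPoch_self_ne_zero hq n
    field_simp

/-- The finite form of the Jacobi triple product, with `q`-binomial coefficients
`(q)_{2n}/((q)_{n+s} (q)_{n-s})`. The sum over `ℤ` is really over `-n ≤ s ≤ n`, because `1/(q)_j`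
vanishes for `j < 0`; this makes shifts of `s` painless in the induction. -/
theorem hasSum_qPoch_mul_qPoch (hq0 : q ≠ 0) (hq : ‖q‖ < 1) {x : ℂ} (hx : x ≠ 0) (n : ℕ) :
    HasSum (fun s : ℤ => vth q s * x ^ s *
      (qPoch q q (2 * n : ℕ) * ((qPoch q q (n + s))⁻¹ * (qPoch q q (n - s))⁻¹)))
      (qPoch q x n * qPoch q (q / x) n) := by
  induction n with
  | zero =>
    have := hasSum_single (f := fun s : ℤ => vth q s * x ^ s *
      (qPoch q q (2 * 0 : ℕ) * ((qPoch q q ((0 : ℕ) + s))⁻¹ * (qPoch q q ((0 : ℕ) - s))⁻¹))) 0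
      (fun s hs => by
        rcases lt_or_gt_of_ne hs with h | h
        · rw [qPoch_self_of_neg hq0 (n := (0 : ℕ) + s) (by push_cast; omega)]; simp
        · rw [qPoch_self_of_neg hq0 (n := (0 : ℕ) - s) (by push_cast; omega)]; simp)
    simpa using this
  | succ n ih =>
    -- The new factor is `(1 - x q^n)(1 - q^{n+1}/x) = 1 + q^{2n+1} - x q^n - q^{n+1}/x`; the last
    -- two monomials shift the summation index by one in either direction.
    have h1 := ih.mul_left (1 + q ^ (2 * n + 1))
    have h2 := ((Equiv.subRight (1 : ℤ)).hasSum_iff.mpr ih).mul_left (-(x * q ^ n))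
    have h3 := ((Equiv.addRight (1 : ℤ)).hasSum_iff.mpr ih).mul_left (-(q ^ (n + 1) / x))
    have h4 : (1 + q ^ (2 * n + 1)) * (qPoch q x n * qPoch q (q / x) n) +
        -(x * q ^ n) * (qPoch q x n * qPoch q (q / x) n) +
        -(q ^ (n + 1) / x) * (qPoch q x n * qPoch q (q / x) n) =
        qPoch q x (n + 1 : ℕ) * qPoch q (q / x) (n + 1 : ℕ) := by
      rw [qPoch_natCast_succ, qPoch_natCast_succ]
      field_simp
      ring
    rw [← h4]
    have h5 := (h1.add h2).add h3
    refine (congrArg (HasSum · _) (funext fun s => ?_)).mp h5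
    simp only [Function.comp, Equiv.subRight_apply, Equiv.coe_addRight]
    have e1 := inv_qPoch_self_pred hq0 hq (n + 1 + s)
    have e2 := inv_qPoch_self_pred hq0 hq (n + s)
    have e3 := inv_qPoch_self_pred hq0 hq (n + 1 - s)
    have e4 := inv_qPoch_self_pred hq0 hq (n - s)
    rw [show (n : ℤ) + 1 + s - 1 = n + s by ring] at e1
    rw [show (n : ℤ) + s - 1 = n + (s - 1) by ring] at e2
    rw [show (n : ℤ) + 1 - s - 1 = n - s by ring] at e3
    rw [show (n : ℤ) - s - 1 = n - (s + 1) by ring] at e4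
    rw [show ((n : ℤ) - (s - 1)) = n + 1 - s by ring, show (n : ℤ) + (s + 1) = n + 1 + s by ring,
      e2, e4, e1, e3, vth_succ hq0, vth_pred hq0, zpow_add_one₀ hx, zpow_sub_one₀ hx,
      show 2 * (n + 1) = 2 * n + 1 + 1 by ring, qPoch_natCast_succ, qPoch_natCast_succ]
    push_cast
    generalize (qPoch q q ((n : ℤ) + 1 + s))⁻¹ = A
    generalize (qPoch q q ((n : ℤ) + 1 - s))⁻¹ = B
    have hs : q ^ s ≠ 0 := zpow_ne_zero _ hq0
    have z1 : q ^ ((n : ℤ) + 1 + s) = q ^ n * q * q ^ s := by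
      rw [zpow_add₀ hq0, zpow_add_one₀ hq0, zpow_natCast]
    have z2 : q ^ ((n : ℤ) + s) = q ^ n * q ^ s := by rw [zpow_add₀ hq0, zpow_natCast]
    have z3 : q ^ ((n : ℤ) + 1 - s) = q ^ n * q / q ^ s := by
      rw [zpow_sub₀ hq0, zpow_add_one₀ hq0, zpow_natCast]
    have z4 : q ^ ((n : ℤ) - s) = q ^ n / q ^ s := by rw [zpow_sub₀ hq0, zpow_natCast]
    have z5 : q ^ (1 - s) = q / q ^ s := by rw [zpow_sub₀ hq0, zpow_one]
    rw [z1, z2, z3, z4, z5]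
    field_simp
    ring

theorem tendsto_qPoch_intCast_add (hq : ‖q‖ < 1) (x : ℂ) (s : ℤ) :
    Tendsto (fun n : ℕ => qPoch q x (n + s)) atTop (𝓝 (qInf q x)) := by
  have h1 : Tendsto (fun n : ℕ => ((n : ℤ) + s).toNat) atTop atTop :=
    tendsto_atTop.mpr fun b => by
      filter_upwards [eventually_ge_atTop (b + s.natAbs)] with n hn
      omega
  refine ((tendsto_qPoch hq x).comp h1).congr' ?_
  filter_upwards [eventually_ge_atTop s.natAbs] with n hn
  simp only [Function.comp]
  congr 1
  omega

theorem norm_inv_qPoch_self_le (hq0 : q ≠ 0) (hq : ‖q‖ < 1) :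
    ∃ B : ℝ, 0 ≤ B ∧ ∀ s : ℤ, ‖(qPoch q q s)⁻¹‖ ≤ B := by
  obtain ⟨δ, hδ, h⟩ := exists_le_norm_qPoch hq (one_sub_pow_succ_ne hq)
  refine ⟨δ⁻¹, by positivity, fun s => ?_⟩
  rcases lt_or_ge s 0 with hs | hs
  · rw [qPoch_self_of_neg hq0 hs]; simpa using hδ.le
  · obtain ⟨n, rfl⟩ := Int.eq_ofNat_of_zero_le hs
    rw [norm_inv]
    exact inv_anti₀ hδ (h n)

/-- The Jacobi triple product. -/
theorem theta_eq_tsum (hq0 : q ≠ 0) (hq : ‖q‖ < 1) {x : ℂ} (hx : x ≠ 0) :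
    theta q x = (qInf q q)⁻¹ * ∑' s : ℤ, vth q s * x ^ s := by
  obtain ⟨B, hB0, hB⟩ := norm_inv_qPoch_self_le hq0 hq
  -- In the finite form the `q`-binomials are bounded uniformly in `n` and `s` and tend to
  -- `1/(q)_∞`, so dominated convergence applies.
  have h1 : Tendsto (fun n : ℕ => ∑' s : ℤ, vth q s * x ^ s *
      (qPoch q q (2 * n : ℕ) * ((qPoch q q (n + s))⁻¹ * (qPoch q q (n - s))⁻¹))) atTop
      (𝓝 (∑' s : ℤ, vth q s * x ^ s * (qInf q q * ((qInf q q)⁻¹ * (qInf q q)⁻¹)))) := by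
    refine tendsto_tsum_of_dominated_convergence
      (bound := fun s : ℤ => ‖vth q s * x ^ s‖ * (Real.exp (‖q‖ * (1 - ‖q‖)⁻¹) * (B * B)))
      ((summable_vth_mul_zpow hq0 hq hx).mul_right _) (fun s => ?_)
      (Eventually.of_forall fun n s => ?_)
    · have hne := qInf_self_ne_zero hq
      refine Tendsto.const_mul _ (Tendsto.mul ?_ (Tendsto.mul ?_ ?_))
      · exact (tendsto_qPoch hq q).comp (tendsto_id.const_mul_atTop' (by norm_num))
      · exact (tendsto_qPoch_intCast_add hq q s).inv₀ hne
      · simpa only [sub_eq_add_neg] using (tendsto_qPoch_intCast_add hq q (-s)).inv₀ hne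
    · rw [norm_mul, norm_mul (qPoch _ _ _), norm_mul (qPoch _ _ _)⁻¹]
      gcongr
      · exact norm_qPoch_le hq le_rfl _
      · exact hB _
      · exact hB _
  have h2 : Tendsto (fun n : ℕ => qPoch q x n * qPoch q (q / x) n) atTop (𝓝 (theta q x)) :=
    (tendsto_qPoch hq x).mul (tendsto_qPoch hq (q / x))
  have h3 := tendsto_nhds_unique (h2.congr fun n => ((hasSum_qPoch_mul_qPoch hq0 hq hx n).tsum_eq).symm) h1
  rw [h3, tsum_mul_right, mul_comm]
  have hne := qInf_self_ne_zero hq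
  field_simp

end Bounds

end QConn

end

noncomputable section

namespace QConn

open Finset Filter Topology

/-! ### A finite residue identity -/

section Finite

variable {q : ℂ}

theorem prod_range_one_sub_div (hq0 : q ≠ 0) {w : ℂ} (hw : w ≠ 0) (i : ℕ) :
    ∏ l ∈ range i, (1 - w * q ^ l / q ^ i) = w ^ i * qPoch q (q * w⁻¹) i * (vth q (-i))⁻¹ := by
  have h1 : (vth q (-i : ℤ))⁻¹ = ∏ l ∈ range i, (-(q ^ (l + 1))⁻¹) := by
    induction i with
    | zero => simp
    | succ i ih =>
      rw [prod_range_succ, ← ih, Nat.cast_succ, neg_add, ← sub_eq_add_neg, vth_pred hq0, mul_inv,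
        mul_comm, show (1 : ℤ) - -(i : ℤ) = (i + 1 : ℕ) by push_cast; ring, zpow_natCast,
        inv_neg]
  have h0 : w ^ i = ∏ _l ∈ range i, w := by rw [prod_const, card_range]
  rw [h1, qPoch_natCast, ← prod_range_reflect, h0, ← prod_mul_distrib, ← prod_mul_distrib]
  refine prod_congr rfl fun l hl => ?_
  have hl := mem_range.mp hl
  have h2 : q ^ i = q ^ (i - 1 - l) * q ^ (l + 1) := by rw [← pow_add]; congr 1; omega
  have h3 : q ^ (i - 1 - l) ≠ 0 := pow_ne_zero _ hq0
  have h4 : q ^ l ≠ 0 := pow_ne_zero _ hq0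
  rw [h2, pow_succ]
  field_simp
  ring

/-- Up to a power of `q^i`, this is the derivative at `q^i` of the polynomial with zeros `1, q, …,
q^{n-1}`. The factors with `l < i` and with `l > i` give one shifted factorial each. -/
theorem prod_range_erase_one_sub_div (hq0 : q ≠ 0) {i n : ℕ} (hi : i < n) :
    ∏ l ∈ (range n).erase i, (1 - q ^ l / q ^ i) =
      qPoch q q i * qPoch q q (n - 1 - i : ℕ) * (vth q (-i))⁻¹ := by
  have h1 : (range n).erase i = range i ∪ Ico (i + 1) n := by
    ext l; simp only [mem_erase, mem_range, mem_union, mem_Ico]; omega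
  have h2 : Disjoint (range i) (Ico (i + 1) n) := by
    rw [disjoint_left]; intro l; simp only [mem_range, mem_Ico]; omega
  have h3 := prod_range_one_sub_div hq0 one_ne_zero i
  simp only [one_mul, one_pow, inv_one, mul_one] at h3
  rw [h1, prod_union h2, h3, prod_Ico_eq_prod_range, qPoch_natCast q q (n - 1 - i),
    show n - (i + 1) = n - 1 - i by omega, mul_assoc, mul_assoc, mul_comm (vth q _)⁻¹]
  congr 2
  refine prod_congr rfl fun l _ => ?_
  have h4 : q ^ i ≠ 0 := pow_ne_zero _ hq0
  rw [add_assoc, pow_add, mul_div_cancel_left₀ _ h4, pow_add, pow_one]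

theorem qPoch_div_pow (hq0 : q ≠ 0) {w : ℂ} (hw : w ≠ 0) {i n : ℕ} (hi : i ≤ n) :
    qPoch q (w / q ^ i) n =
      w ^ i * qPoch q (q * w⁻¹) i * (vth q (-i))⁻¹ * qPoch q w (n - i : ℕ) := by
  have h : n = i + (n - i) := by omega
  have h4 : q ^ i ≠ 0 := pow_ne_zero _ hq0
  conv_lhs => rw [h]
  rw [qPoch_natCast_add, div_mul_cancel₀ _ h4, ← prod_range_one_sub_div hq0 hw, qPoch_natCast]
  congr 1
  exact prod_congr rfl fun l _ => by ring

variable {J : Type*} [Fintype J] [DecidableEq J]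

/-- The nodes `q^i` and `q^{-i}/x_d`. -/
def node (q : ℂ) (x : J → ℂ) : Option J × ℕ → ℂ
  | (none, i) => q ^ i
  | (some d, i) => (x d * q ^ i)⁻¹

/-- By Lagrange interpolation the sum is the coefficient of degree `#nodes - 1` of `X^{n-m-1} ∏_{j ≠
k} (z_j X)_n`. This polynomial has degree at most `|J| n - m - 1`, which is less than `(|J| + 1) n -
1` as soon as `|m| < n`. The index `k` is left out because later `z k = q`, whose role is taken by
the nodes `q^i`. -/
theorem sum_residues_eq_zero (x z : J → ℂ) (k : J) (m : ℤ) (n : ℕ) (hn : m.natAbs < n)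
    (hinj : Set.InjOn (node q x) ((univ ×ˢ range n : Finset (Option J × ℕ)) : Set (Option J × ℕ))) :
    ∑ p ∈ (univ : Finset (Option J)) ×ˢ range n,
      node q x p ^ ((n : ℤ) - m - 1) * (∏ j ∈ univ.erase k, qPoch q (z j * node q x p) n) /
        ∏ r ∈ ((univ : Finset (Option J)) ×ˢ range n).erase p, (node q x p - node q x r) = 0 := by
  classical
  set Q : Polynomial ℂ := Polynomial.X ^ ((n : ℤ) - m - 1).toNat *
    ∏ j ∈ univ.erase k, ∏ l ∈ range n, (1 - Polynomial.C (z j * q ^ l) * Polynomial.X) with hQ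
  have hJ : 1 ≤ Fintype.card J := Fintype.card_pos_iff.mpr ⟨k⟩
  have hdeg : Q.natDegree ≤ ((n : ℤ) - m - 1).toNat + (Fintype.card J - 1) * n := by
    rw [hQ]
    refine Polynomial.natDegree_mul_le.trans ?_
    rw [Polynomial.natDegree_X_pow]
    gcongr
    refine (Polynomial.natDegree_prod_le _ _).trans ?_
    calc ∑ j ∈ univ.erase k, (∏ l ∈ range n,
          (1 - Polynomial.C (z j * q ^ l) * Polynomial.X)).natDegree
        ≤ ∑ _j ∈ univ.erase k, n := by
          refine sum_le_sum fun j _ => (Polynomial.natDegree_prod_le _ _).trans ?_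
          calc ∑ l ∈ range n, (1 - Polynomial.C (z j * q ^ l) * Polynomial.X).natDegree
              ≤ ∑ _l ∈ range n, 1 := by
                refine sum_le_sum fun l _ => ?_
                refine (Polynomial.natDegree_sub_le _ _).trans ?_
                simp only [Polynomial.natDegree_one, zero_le, sup_of_le_right]
                exact Polynomial.natDegree_C_mul_le _ _ |>.trans Polynomial.natDegree_X_le
            _ = n := by simp
      _ = _ := by rw [sum_const, card_erase_of_mem (mem_univ _), card_univ, smul_eq_mul]
  have hcard : #((univ : Finset (Option J)) ×ˢ range n) = (Fintype.card J + 1) * n := by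
    rw [card_product, card_univ, Fintype.card_option, card_range]
  have hlt : Q.natDegree < #((univ : Finset (Option J)) ×ˢ range n) - 1 := by
    rw [hcard]
    obtain ⟨c, hc⟩ : ∃ c, Fintype.card J = c + 1 := ⟨Fintype.card J - 1, by omega⟩
    rw [hc, Nat.add_sub_cancel] at hdeg
    rw [hc, add_mul, add_mul]
    omega
  have h0 : Q.coeff (#((univ : Finset (Option J)) ×ˢ range n) - 1) = 0 :=
    Polynomial.coeff_eq_zero_of_natDegree_lt hlt
  rw [Lagrange.coeff_eq_sum hinj (Polynomial.degree_le_natDegree.trans_lt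
    (by exact_mod_cast (by omega : Q.natDegree < _)))] at h0
  rw [← h0]
  refine sum_congr rfl fun p _ => ?_
  congr 1
  rw [hQ, Polynomial.eval_mul, Polynomial.eval_pow, Polynomial.eval_X, Polynomial.eval_prod,
    ← zpow_natCast, Int.toNat_of_nonneg (by omega)]
  congr 1
  refine prod_congr rfl fun j _ => ?_
  rw [Polynomial.eval_prod, qPoch_natCast]
  refine prod_congr rfl fun l _ => ?_
  simp
  ring

theorem prod_product_erase {ι : Type*} [Fintype ι] [DecidableEq ι] (f : ι × ℕ → ℂ) (o : ι) {i n : ℕ} :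
    ∏ r ∈ ((univ : Finset ι) ×ˢ range n).erase (o, i), f r =
      (∏ l ∈ (range n).erase i, f (o, l)) * ∏ o' ∈ univ.erase o, ∏ l ∈ range n, f (o', l) := by
  have h : ((univ : Finset ι) ×ˢ range n).erase (o, i) =
      ({o} ×ˢ (range n).erase i) ∪ (univ.erase o ×ˢ range n) := by
    ext ⟨a, b⟩
    simp only [mem_erase, mem_product, mem_univ, true_and, mem_union, mem_singleton, ne_eq,
      Prod.mk.injEq, not_and]
    tauto
  have h2 : Disjoint ({o} ×ˢ (range n).erase i) (univ.erase o ×ˢ range n) := by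
    rw [disjoint_left]
    rintro ⟨a, b⟩
    simp only [mem_product, mem_singleton, mem_erase]
    tauto
  rw [h, prod_union h2, prod_product, prod_product, prod_singleton]

theorem univ_option_erase_none : (univ : Finset (Option J)).erase none = univ.map .some := by
  ext (_ | j) <;> simp

theorem univ_option_erase_some (d : J) :
    (univ : Finset (Option J)).erase (some d) = insert none ((univ.erase d).map .some) := by
  ext (_ | j) <;> simp

theorem zpow_sub_sub_one {y : ℂ} (hy : y ≠ 0) (n : ℕ) (m : ℤ) (hn : 1 ≤ n) :
    y ^ ((n : ℤ) - m - 1) = y ^ (-m) * y ^ (n - 1) := by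
  rw [← zpow_natCast, ← zpow_add₀ hy]
  congr 1
  push_cast [hn]
  ring

/-- Residues at `q^i` on one side, residues at `q^{-i}/x_d` on the other, with differences of nodes
rewritten as shifted factorials. -/
theorem finite_residues (hq0 : q ≠ 0) {x z : J → ℂ} (k : J) (m : ℤ) {n : ℕ} (hn : m.natAbs < n)
    (hx0 : ∀ j, x j ≠ 0)
    (hinj : Set.InjOn (node q x) ((univ ×ˢ range n : Finset (Option J × ℕ)) : Set (Option J × ℕ))) :
    ∑ i ∈ range n, (q ^ i) ^ (-m) * (∏ j ∈ univ.erase k, qPoch q (z j * q ^ i) n) /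
        ((∏ l ∈ (range n).erase i, (1 - q ^ l / q ^ i)) * ∏ j, qPoch q (x j * q ^ i) n) =
      ∑ d, ∑ i ∈ range n, (x d * q ^ i) ^ m *
        (∏ j ∈ univ.erase k, qPoch q (z j / x d / q ^ i) n) /
        ((∏ l ∈ (range n).erase i, (1 - q ^ l / q ^ i)) * qPoch q (x d * q ^ i) n *
          ∏ j ∈ univ.erase d, qPoch q (x j / x d / q ^ i) n) := by
  have h0 := sum_residues_eq_zero (q := q) x z k m n hn hinj
  have hqn : ∀ n : ℕ, q ^ n ≠ 0 := fun n => pow_ne_zero _ hq0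
  rw [sum_product, Fintype.sum_option, add_eq_zero_iff_eq_neg] at h0
  -- The constant comes from `1 - x_j q^l y = -(x_j q^l) (y - (x_j q^l)⁻¹)`, applied to all nodes
  -- `(x_j q^l)⁻¹`; it is common to all residues.
  set κ : ℂ := ∏ j, ∏ l ∈ range n, (-(x j * q ^ l)) with hκ
  have hκ0 : κ ≠ 0 := prod_ne_zero_iff.mpr fun j _ => prod_ne_zero_iff.mpr fun l _ =>
    neg_ne_zero.mpr (mul_ne_zero (hx0 j) (hqn l))
  have e1 : ∀ i ∈ range n, (q ^ i) ^ (-m) * (∏ j ∈ univ.erase k, qPoch q (z j * q ^ i) n) /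
        ((∏ l ∈ (range n).erase i, (1 - q ^ l / q ^ i)) * ∏ j, qPoch q (x j * q ^ i) n) =
      κ⁻¹ * (node q x (none, i) ^ ((n : ℤ) - m - 1) *
        (∏ j ∈ univ.erase k, qPoch q (z j * node q x (none, i)) n) /
        ∏ r ∈ ((univ : Finset (Option J)) ×ˢ range n).erase (none, i),
          (node q x (none, i) - node q x r)) := by
    intro i hi
    have hi' := mem_range.mp hi
    have a1 : ∏ l ∈ (range n).erase i, (q ^ i - q ^ l) =
        (q ^ i) ^ (n - 1) * ∏ l ∈ (range n).erase i, (1 - q ^ l / q ^ i) := by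
      rw [← card_range n, ← card_erase_of_mem hi, ← prod_const, card_range, ← prod_mul_distrib]
      exact prod_congr rfl fun l _ => by have := hqn i; field_simp
    have a2 : ∏ j, qPoch q (x j * q ^ i) n =
        κ * ∏ j, ∏ l ∈ range n, (q ^ i - (x j * q ^ l)⁻¹) := by
      rw [hκ, ← prod_mul_distrib]
      refine prod_congr rfl fun j _ => ?_
      rw [qPoch_natCast, ← prod_mul_distrib]
      exact prod_congr rfl fun l _ => by have := hqn l; have := hx0 j; field_simp; ring
    rw [prod_product_erase, univ_option_erase_none, prod_map]
    simp only [node, Function.Embedding.some_apply]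
    rw [a1, a2, zpow_sub_sub_one (hqn i) n m (by omega)]
    have := pow_ne_zero (n - 1) (hqn i)
    rw [mul_comm ((q ^ i) ^ (-m)) ((q ^ i) ^ (n - 1)), mul_assoc, mul_assoc ((q ^ i) ^ (n - 1)),
      mul_div_mul_left _ _ this, mul_left_comm _ κ, ← div_div, div_eq_inv_mul _ κ, mul_div_assoc]
  have e2 : ∀ d, ∀ i ∈ range n, (x d * q ^ i) ^ m *
        (∏ j ∈ univ.erase k, qPoch q (z j / x d / q ^ i) n) /
        ((∏ l ∈ (range n).erase i, (1 - q ^ l / q ^ i)) * qPoch q (x d * q ^ i) n *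
          ∏ j ∈ univ.erase d, qPoch q (x j / x d / q ^ i) n) =
      -(κ⁻¹ * (node q x (some d, i) ^ ((n : ℤ) - m - 1) *
        (∏ j ∈ univ.erase k, qPoch q (z j * node q x (some d, i)) n) /
        ∏ r ∈ ((univ : Finset (Option J)) ×ˢ range n).erase (some d, i),
          (node q x (some d, i) - node q x r))) := by
    intro d i hi
    have hi' := mem_range.mp hi
    have hxd := hx0 d
    set y : ℂ := (x d * q ^ i)⁻¹ with hy
    have hy0 : y ≠ 0 := inv_ne_zero (mul_ne_zero hxd (hqn i))
    have hdiv : ∀ w : ℂ, w / x d / q ^ i = w * y := fun w => by rw [hy]; field_simp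
    have a0 : ∏ l ∈ range n, (y - q ^ l) = y ^ n * qPoch q (x d * q ^ i) n := by
      rw [qPoch_natCast, ← card_range n, ← prod_const, card_range, ← prod_mul_distrib]
      exact prod_congr rfl fun l _ => by rw [hy]; have := hqn i; field_simp
    have a1 : ∏ l ∈ (range n).erase i, (1 - q ^ l / q ^ i) =
        (∏ l ∈ range n, (-(x d * q ^ l))) * (-y) *
          ∏ l ∈ (range n).erase i, (y - (x d * q ^ l)⁻¹) := by
      rw [← mul_prod_erase _ _ hi, mul_comm (-(x d * q ^ i)), mul_assoc (∏ _ ∈ _, _),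
        show -(x d * q ^ i) * -y = 1 by rw [hy]; have := hqn i; field_simp, mul_one,
        ← prod_mul_distrib]
      exact prod_congr rfl fun l _ => by
        rw [hy]; have := hqn i; have := hqn l; field_simp; ring
    have a2 : ∏ j ∈ univ.erase d, qPoch q (x j * y) n =
        (∏ j ∈ univ.erase d, ∏ l ∈ range n, (-(x j * q ^ l))) *
          ∏ j ∈ univ.erase d, ∏ l ∈ range n, (y - (x j * q ^ l)⁻¹) := by
      rw [← prod_mul_distrib]
      refine prod_congr rfl fun j _ => ?_
      rw [qPoch_natCast, ← prod_mul_distrib]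
      exact prod_congr rfl fun l _ => by have := hqn l; have := hx0 j; field_simp; ring
    have a3 : κ = (∏ l ∈ range n, (-(x d * q ^ l))) *
        ∏ j ∈ univ.erase d, ∏ l ∈ range n, (-(x j * q ^ l)) := by
      rw [hκ, mul_prod_erase univ (fun j => ∏ l ∈ range n, (-(x j * q ^ l))) (mem_univ d)]
    rw [prod_product_erase, univ_option_erase_some, prod_insert (by simp), prod_map]
    simp only [node, Function.Embedding.some_apply, ← hy, hdiv]
    rw [a0, a1, a2, a3, zpow_sub_sub_one hy0 n m (by omega),
      show n = n - 1 + 1 by omega, pow_succ y]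
    simp only [Nat.add_sub_cancel]
    have b1 : y ^ (n - 1) ≠ 0 := pow_ne_zero _ hy0
    have b2 : (x d * q ^ i) ^ m = y ^ (-m) := by rw [hy, inv_zpow', neg_neg]
    rw [b2]
    generalize ∏ l ∈ (range (n - 1 + 1)).erase i, (y - (x d * q ^ l)⁻¹) = P1
    generalize ∏ j ∈ univ.erase d, ∏ l ∈ range (n - 1 + 1), (y - (x j * q ^ l)⁻¹) = P2
    generalize ∏ j ∈ univ.erase k, qPoch q (z j * y) ↑(n - 1 + 1) = P3
    generalize qPoch q (x d * q ^ i) ↑(n - 1 + 1) = P4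
    simp only [div_eq_mul_inv, mul_inv, inv_neg]
    field_simp
  rw [sum_congr rfl e1, ← mul_sum, h0, mul_neg, mul_sum, ← sum_neg_distrib]
  refine sum_congr rfl fun d _ => ?_
  rw [sum_congr rfl (e2 d), sum_neg_distrib, mul_sum]

end Finite

end QConn

end

noncomputable section

namespace QConn

open Finset Filter Topology

/-! ### Normalization of the residue identity, including coinciding nodes -/

section Nodes

variable {q : ℂ}

theorem pow_injective_of_norm_lt (hq0 : q ≠ 0) (hq : ‖q‖ < 1) :
    Function.Injective fun n : ℕ => q ^ n := by
  intro a b h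
  have h1 : ‖q‖ ^ a = ‖q‖ ^ b := by rw [← norm_pow, ← norm_pow]; exact congrArg _ h
  exact pow_right_injective₀ (norm_pos_iff.mpr hq0) hq.ne h1

/-- `hnd` separates the family `q^i` from the others, `hx` separates the families of different `d`,
and `‖q‖ < 1` separates nodes within a family. -/
theorem injOn_node {J : Type*} (hq0 : q ≠ 0) (hq : ‖q‖ < 1) {x : J → ℂ} (hx0 : ∀ j, x j ≠ 0)
    (hx : ∀ j d, j ≠ d → NotPow q (x j / x d)) (hnd : ∀ j (r : ℕ), 1 - x j * q ^ r ≠ 0)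
    (s : Set (Option J × ℕ)) : Set.InjOn (node q x) s := by
  have hqn : ∀ n : ℕ, q ^ n ≠ 0 := fun n => pow_ne_zero _ hq0
  have key : ∀ d (i l : ℕ), q ^ l ≠ (x d * q ^ i)⁻¹ := fun d i l h => by
    apply hnd d (i + l)
    have h1 : x d * q ^ i ≠ 0 := mul_ne_zero (hx0 d) (hqn i)
    rw [pow_add, ← mul_assoc, h, mul_inv_cancel₀ h1, sub_self]
  refine Set.injOn_of_injective ?_
  rintro ⟨_ | d, i⟩ ⟨_ | d', i'⟩ h
  · rw [pow_injective_of_norm_lt hq0 hq h]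
  · exact absurd h (key d' i' i)
  · exact absurd h.symm (key d i i')
  · have h1 : x d * q ^ i = x d' * q ^ i' := inv_injective h
    by_cases hd : d = d'
    · subst hd
      rw [pow_injective_of_norm_lt hq0 hq (mul_left_cancel₀ (hx0 d) h1)]
    · exfalso
      apply hx d d' hd ((i' : ℤ) - i)
      rw [zpow_sub₀ hq0, zpow_natCast, zpow_natCast, div_eq_div_iff (hx0 d') (hqn i), h1, mul_comm]

end Nodes

section Normalized

variable {q : ℂ} {J : Type*} [Fintype J] [DecidableEq J]

/-- The quotient `(x)_{2n} / (x q^i)_n`. -/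
def tcut (q x : ℂ) (n i : ℕ) : ℂ := qPoch q x i * qPoch q (x * q ^ (i + n)) (n - i : ℕ)

theorem tcut_mul (x : ℂ) {n i : ℕ} (hi : i ≤ n) :
    tcut q x n i * qPoch q (x * q ^ i) n = qPoch q x (2 * n : ℕ) := by
  have h := qPoch_natCast_add q x (i + n) (n - i)
  rw [show i + n + (n - i) = 2 * n by omega, qPoch_natCast_add q x i n] at h
  rw [h, tcut]; ring

/-- The normalized residue at `q^i`. -/
def inTerm (q : ℂ) (x z : J → ℂ) (k : J) (m : ℤ) (n i : ℕ) : ℂ :=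
  vth q (-i) * (q ^ i) ^ (-m) * ((qPoch q q i)⁻¹ * (qPoch q q (n - 1 - i : ℕ))⁻¹ *
    (∏ j ∈ univ.erase k, qPoch q (z j * q ^ i) n) * ∏ j, tcut q (x j) n i)

/-- The normalized residue at `q^{-i}/x_d`. -/
def outTerm (q : ℂ) (x z : J → ℂ) (k : J) (m : ℤ) (d : J) (n i : ℕ) : ℂ :=
  vth q (-i) * (x d * q ^ i) ^ m *
    ((∏ j ∈ univ.erase k, z j / x d) / ∏ j ∈ univ.erase d, x j / x d) ^ i *
    ((qPoch q q i)⁻¹ * (qPoch q q (n - 1 - i : ℕ))⁻¹ * tcut q (x d) n i *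
      (∏ j ∈ univ.erase d, qPoch q (x j) (2 * n : ℕ)) *
      (∏ j ∈ univ.erase k, (qPoch q (q * (z j / x d)⁻¹) i * qPoch q (z j / x d) (n - i : ℕ))) *
      ∏ j ∈ univ.erase d, ((qPoch q (q * (x j / x d)⁻¹) i)⁻¹ *
        (qPoch q (x j / x d) (n - i : ℕ))⁻¹))

/-- `finite_residues` multiplied by `∏_j (x_j)_{2n}`. This turns the denominators `(x_j q^i)_n` into
factors `tcut`, so that both sides stay meaningful when some `x_j q^r = 1`. That case must be
covered: the theorem does not exclude that `b_i` or `a_j/c_k` is a power of `q`. -/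
theorem sum_inTerm_eq_of_nondegenerate (hq0 : q ≠ 0) (hq : ‖q‖ < 1) {x z : J → ℂ} (k : J) (m : ℤ)
    {n : ℕ} (hn : m.natAbs < n) (hx0 : ∀ j, x j ≠ 0) (hz0 : ∀ j, z j ≠ 0)
    (hx : ∀ j d, j ≠ d → NotPow q (x j / x d)) (hnd : ∀ j (r : ℕ), 1 - x j * q ^ r ≠ 0) :
    ∑ i ∈ range n, inTerm q x z k m n i = ∑ d, ∑ i ∈ range n, outTerm q x z k m d n i := by
  have h := finite_residues (z := z) hq0 k m hn hx0 (injOn_node hq0 hq hx0 hx hnd _)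
  have hP : ∀ j (i : ℕ), qPoch q (x j * q ^ i) n ≠ 0 := fun j i => by
    rw [qPoch_natCast]
    refine prod_ne_zero_iff.mpr fun l _ => ?_
    rw [mul_assoc, ← pow_add]
    exact hnd j _
  have hv : ∀ i : ℕ, vth q (-i) ≠ 0 := fun i => vth_ne_zero hq0 _
  have e1 : ∀ i ∈ range n, inTerm q x z k m n i = (∏ j, qPoch q (x j) (2 * n : ℕ)) *
      ((q ^ i) ^ (-m) * (∏ j ∈ univ.erase k, qPoch q (z j * q ^ i) n) /
        ((∏ l ∈ (range n).erase i, (1 - q ^ l / q ^ i)) * ∏ j, qPoch q (x j * q ^ i) n)) := by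
    intro i hi
    have hi := mem_range.mp hi
    have h1 : ∏ j, qPoch q (x j) (2 * n : ℕ) =
        (∏ j, tcut q (x j) n i) * ∏ j, qPoch q (x j * q ^ i) n := by
      rw [← prod_mul_distrib]
      exact prod_congr rfl fun j _ => (tcut_mul (x j) hi.le).symm
    have h2 : ∏ j, qPoch q (x j * q ^ i) n ≠ 0 := prod_ne_zero_iff.mpr fun j _ => hP j i
    rw [inTerm, h1, prod_range_erase_one_sub_div hq0 hi]
    generalize ∏ j, qPoch q (x j * q ^ i) n = D at h2
    have := hv i
    have := qPoch_self_ne_zero hq i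
    have := qPoch_self_ne_zero hq (n - 1 - i)
    field_simp
  have e2 : ∀ d, ∀ i ∈ range n, outTerm q x z k m d n i = (∏ j, qPoch q (x j) (2 * n : ℕ)) *
      ((x d * q ^ i) ^ m *
        (∏ j ∈ univ.erase k, qPoch q (z j / x d / q ^ i) n) /
        ((∏ l ∈ (range n).erase i, (1 - q ^ l / q ^ i)) * qPoch q (x d * q ^ i) n *
          ∏ j ∈ univ.erase d, qPoch q (x j / x d / q ^ i) n)) := by
    intro d i hi
    have hi := mem_range.mp hi
    have h1 : ∏ j, qPoch q (x j) (2 * n : ℕ) =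
        tcut q (x d) n i * qPoch q (x d * q ^ i) n *
          ∏ j ∈ univ.erase d, qPoch q (x j) (2 * n : ℕ) := by
      rw [tcut_mul (x d) hi.le, mul_prod_erase univ (fun j => qPoch q (x j) (2 * n : ℕ))
        (mem_univ d)]
    -- The products over `j ≠ k` and over `j ≠ d` have the same number `|J| - 1` of factors, so the
    -- powers of `vth q (-i)` produced by `qPoch_div_pow` in numerator and denominator cancel.
    have h2 : ∀ (w : J → ℂ) (e : J), (∀ j, w j ≠ 0) →
        ∏ j ∈ univ.erase e, qPoch q (w j / x d / q ^ i) n = (∏ j ∈ univ.erase e, w j / x d) ^ i *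
          (∏ j ∈ univ.erase e, (qPoch q (q * (w j / x d)⁻¹) i * qPoch q (w j / x d) (n - i : ℕ))) *
          (vth q (-i))⁻¹ ^ (Fintype.card J - 1) := by
      intro w e hw
      rw [← prod_pow, ← card_univ, ← card_erase_of_mem (mem_univ e), ← prod_const,
        ← prod_mul_distrib, ← prod_mul_distrib]
      refine prod_congr rfl fun j _ => ?_
      rw [qPoch_div_pow hq0 (div_ne_zero (hw j) (hx0 d)) hi.le]
      ring
    rw [outTerm, h1, prod_range_erase_one_sub_div hq0 hi, h2 z k hz0, h2 x d hx0, div_pow,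
      prod_congr rfl fun j _ => (mul_inv _ _).symm, prod_inv_distrib]
    have b1 := hv i
    have b2 := qPoch_self_ne_zero hq i
    have b3 := qPoch_self_ne_zero hq (n - 1 - i)
    have b4 := hP d i
    have b5 : (vth q (-i))⁻¹ ^ (Fintype.card J - 1) ≠ 0 := pow_ne_zero _ (inv_ne_zero b1)
    generalize (vth q (-i))⁻¹ ^ (Fintype.card J - 1) = c at *
    generalize ∏ j ∈ univ.erase d, (qPoch q (q * (x j / x d)⁻¹) i *
      qPoch q (x j / x d) (n - i : ℕ)) = P1
    generalize (∏ j ∈ univ.erase d, x j / x d) ^ i = P2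
    simp only [div_eq_mul_inv, mul_inv, inv_inv]
    field_simp
  rw [sum_congr rfl e1, ← mul_sum, h, mul_sum]
  refine sum_congr rfl fun d _ => ?_
  rw [sum_congr rfl (e2 d), mul_sum]

theorem continuous_qPoch (q : ℂ) (n : ℕ) : Continuous fun x => qPoch q x n := by
  simp only [qPoch_natCast]
  fun_prop

theorem continuous_tcut (q : ℂ) (n i : ℕ) : Continuous fun x => tcut q x n i :=
  (continuous_qPoch q i).mul ((continuous_qPoch q (n - i)).comp (by fun_prop))

/-- The degenerate case follows by moving the nodes `q^i` slightly. -/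
theorem sum_inTerm_eq (hq0 : q ≠ 0) (hq : ‖q‖ < 1) {x z : J → ℂ} (k : J) (m : ℤ)
    {n : ℕ} (hn : m.natAbs < n) (hx0 : ∀ j, x j ≠ 0) (hz0 : ∀ j, z j ≠ 0)
    (hx : ∀ j d, j ≠ d → NotPow q (x j / x d)) :
    ∑ i ∈ range n, inTerm q x z k m n i = ∑ d, ∑ i ∈ range n, outTerm q x z k m d n i := by
  have hqn : ∀ n : ℕ, q ^ n ≠ 0 := fun n => pow_ne_zero _ hq0
  have hne0 : ∀ᶠ s : ℂ in 𝓝[≠] 1, s ≠ 0 :=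
    (eventually_ne_nhds one_ne_zero).filter_mono nhdsWithin_le_nhds
  -- the relevant bad values of `s` do not accumulate at `1`
  have hnd : ∀ᶠ s : ℂ in 𝓝[≠] 1, ∀ j (r : ℕ), 1 - s * x j * q ^ r ≠ 0 := by
    rw [eventually_all]
    intro j
    have h1 : ∀ᶠ s : ℂ in 𝓝 1, ‖s * x j‖ < ‖x j‖ + 1 := by
      have : Tendsto (fun s : ℂ => ‖s * x j‖) (𝓝 1) (𝓝 ‖1 * x j‖) :=
        ((continuous_id.mul continuous_const).norm).tendsto 1
      rw [one_mul] at this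
      exact this.eventually_lt_const (by linarith)
    -- For `r ≥ r₀` the number `s x_j q^r` has modulus less than `1` for all `s` near `1`, so only
    -- finitely many `r` can be bad.
    obtain ⟨r₀, hr₀⟩ := (((tendsto_pow_atTop_nhds_zero_of_lt_one (norm_nonneg _) hq).const_mul
      (‖x j‖ + 1)).eventually_lt_const (by rw [mul_zero]; exact one_pos)).exists_forall_of_atTop
    have h2 : ∀ᶠ s : ℂ in 𝓝[≠] 1, ∀ r ∈ range r₀, 1 - s * x j * q ^ r ≠ 0 := by
      rw [eventually_all_finset]
      intro r _
      by_cases h : 1 - x j * q ^ r = 0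
      · filter_upwards [self_mem_nhdsWithin] with s hs h'
        apply hs
        have h3 : x j * q ^ r = 1 := by linear_combination -h
        rw [Set.mem_singleton_iff]
        linear_combination -h' - s * h3
      · have : Tendsto (fun s : ℂ => 1 - s * x j * q ^ r) (𝓝 1) (𝓝 (1 - 1 * x j * q ^ r)) :=
          Continuous.tendsto (by fun_prop) 1
        rw [one_mul] at this
        exact (this.eventually_ne h).filter_mono nhdsWithin_le_nhds
    filter_upwards [h1.filter_mono nhdsWithin_le_nhds, h2] with s hs1 hs2 r
    by_cases hr : r < r₀
    · exact hs2 r (mem_range.mpr hr)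
    · intro h
      have h3 : s * x j * q ^ r = 1 := by linear_combination -h
      have h4 := congrArg norm h3
      rw [norm_mul, norm_pow, norm_one] at h4
      have h5 := hr₀ r (not_lt.mp hr)
      have h6 : ‖s * x j‖ * ‖q‖ ^ r ≤ (‖x j‖ + 1) * ‖q‖ ^ r := by gcongr
      linarith
  -- Scaling all `x_j` and `z_j` by the same `s` keeps their ratios, so the possibly singular
  -- factors of `outTerm` do not move.
  have hin : Tendsto (fun s : ℂ => ∑ i ∈ range n,
      inTerm q (fun j => s * x j) (fun j => s * z j) k m n i) (𝓝[≠] 1)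
      (𝓝 (∑ i ∈ range n, inTerm q x z k m n i)) := by
    have h1 : Continuous fun s : ℂ => ∑ i ∈ range n,
        inTerm q (fun j => s * x j) (fun j => s * z j) k m n i := by
      refine continuous_finsetSum _ fun i _ => ?_
      unfold inTerm
      refine continuous_const.mul ((continuous_const.mul (continuous_finsetProd _ fun j _ => ?_)).mul
        (continuous_finsetProd _ fun j _ => ?_))
      · exact (continuous_qPoch q n).comp (by fun_prop)
      · exact (continuous_tcut q n i).comp (by fun_prop)
    simpa using (h1.tendsto 1).mono_left nhdsWithin_le_nhds
  have hout : Tendsto (fun s : ℂ => ∑ d, ∑ i ∈ range n,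
      outTerm q (fun j => s * x j) (fun j => s * z j) k m d n i) (𝓝[≠] 1)
      (𝓝 (∑ d, ∑ i ∈ range n, outTerm q x z k m d n i)) := by
    refine tendsto_finsetSum _ fun d _ => tendsto_finsetSum _ fun i _ => ?_
    have h1 : ContinuousAt (fun s : ℂ => vth q (-i) * (s * x d * q ^ i) ^ m *
      ((∏ j ∈ univ.erase k, z j / x d) / ∏ j ∈ univ.erase d, x j / x d) ^ i *
      ((qPoch q q i)⁻¹ * (qPoch q q (n - 1 - i : ℕ))⁻¹ * tcut q (s * x d) n i *
      (∏ j ∈ univ.erase d, qPoch q (s * x j) (2 * n : ℕ)) *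
      (∏ j ∈ univ.erase k, (qPoch q (q * (z j / x d)⁻¹) i * qPoch q (z j / x d) (n - i : ℕ))) *
      ∏ j ∈ univ.erase d, ((qPoch q (q * (x j / x d)⁻¹) i)⁻¹ *
        (qPoch q (x j / x d) (n - i : ℕ))⁻¹))) 1 := by
      refine ((continuousAt_const.mul (ContinuousAt.zpow₀ (by fun_prop) m (Or.inl ?_))).mul
        continuousAt_const).mul ((((continuousAt_const.mul ?_).mul ?_).mul continuousAt_const).mul
        continuousAt_const)
      · rw [one_mul]; exact mul_ne_zero (hx0 d) (hqn i)
      · exact ((continuous_tcut q n i).comp (by fun_prop)).continuousAt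
      · exact (continuous_finsetProd _ fun j _ =>
          (continuous_qPoch q (2 * n)).comp (by fun_prop)).continuousAt
    have h2 := h1.tendsto.mono_left (nhdsWithin_le_nhds (s := {1}ᶜ))
    simp only [one_mul] at h2
    rw [← outTerm] at h2
    refine h2.congr' ?_
    filter_upwards [hne0] with s hs
    simp only [outTerm, mul_div_mul_left _ _ hs]
  refine tendsto_nhds_unique hin (hout.congr' ?_)
  filter_upwards [hne0, hnd] with s hs0 hs
  exact (sum_inTerm_eq_of_nondegenerate hq0 hq k m hn (fun j => mul_ne_zero hs0 (hx0 j))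
    (fun j => mul_ne_zero hs0 (hz0 j)) (fun j d hjd => by
      simpa only [mul_div_mul_left _ _ hs0] using hx j d hjd) hs).symm

end Normalized

end QConn

end

noncomputable section

namespace QConn

open Finset Filter Topology

/-! ### Passage to the limit -/

/-- Bounded convergence of `b n i` to `l i`, in the range `i < n`. -/
structure BddTendsto (b : ℕ → ℕ → ℂ) (l : ℕ → ℂ) : Prop where
  bdd : ∃ K : ℝ, ∀ n i, i < n → ‖b n i‖ ≤ K
  lim : ∀ i, Tendsto (fun n => b n i) atTop (𝓝 (l i))

namespace BddTendsto

theorem mul {b b' : ℕ → ℕ → ℂ} {l l' : ℕ → ℂ} (h : BddTendsto b l) (h' : BddTendsto b' l') :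
    BddTendsto (fun n i => b n i * b' n i) fun i => l i * l' i := by
  obtain ⟨K, hK⟩ := h.bdd
  obtain ⟨K', hK'⟩ := h'.bdd
  refine ⟨⟨K * K', fun n i hi => ?_⟩, fun i => (h.lim i).mul (h'.lim i)⟩
  rw [norm_mul]
  exact mul_le_mul (hK n i hi) (hK' n i hi) (norm_nonneg _) ((norm_nonneg _).trans (hK n i hi))

theorem prod {ι : Type*} (s : Finset ι) {b : ι → ℕ → ℕ → ℂ} {l : ι → ℕ → ℂ}
    (h : ∀ j ∈ s, BddTendsto (b j) (l j)) :
    BddTendsto (fun n i => ∏ j ∈ s, b j n i) fun i => ∏ j ∈ s, l j i := by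
  classical
  induction s using Finset.induction_on with
  | empty => exact ⟨⟨1, by simp⟩, by simp⟩
  | insert a s ha ih =>
    simp only [prod_insert ha]
    exact (h a (mem_insert_self a s)).mul (ih fun j hj => h j (mem_insert_of_mem hj))

/-- Tannery's theorem: `vth q (-i)` decays faster than any geometric sequence, so a uniform bound
for `b` in the range `i < n` provides a summable majorant. -/
theorem tendsto_sum {q : ℂ} (hq0 : q ≠ 0) (hq : ‖q‖ < 1) {b : ℕ → ℕ → ℂ} {l : ℕ → ℂ}
    (h : BddTendsto b l) {ρ : ℂ} (hρ : ρ ≠ 0) :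
    Tendsto (fun n => ∑ i ∈ range n, vth q (-i) * ρ ^ i * b n i) atTop
      (𝓝 (∑' i : ℕ, vth q (-i) * ρ ^ i * l i)) := by
  obtain ⟨K, hK⟩ := h.bdd
  have h1 : ∀ n, ∑ i ∈ range n, vth q (-i) * ρ ^ i * b n i =
      ∑' i : ℕ, if i < n then vth q (-i) * ρ ^ i * b n i else 0 := fun n => by
    rw [tsum_eq_sum (s := range n) fun i hi => if_neg (by simpa using hi)]
    exact sum_congr rfl fun i hi => (if_pos (mem_range.mp hi)).symm
  simp only [h1]
  refine tendsto_tsum_of_dominated_convergence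
    (bound := fun i : ℕ => ‖vth q (-i)‖ * ‖ρ‖ ^ i * |K|)
    ((summable_vth_neg_nat hq0 hq (norm_pos_iff.mpr hρ)).mul_right _) (fun i => ?_)
    (Eventually.of_forall fun n i => ?_)
  · refine ((h.lim i).const_mul _).congr' ?_
    filter_upwards [eventually_gt_atTop i] with n hn
    rw [if_pos hn]
  · split_ifs with hi
    · rw [norm_mul, norm_mul, norm_pow]
      gcongr
      exact (hK n i hi).trans (le_abs_self K)
    · simpa using by positivity

variable {q : ℂ}

theorem of_bounded {l : ℕ → ℂ} {K : ℝ} (h : ∀ i, ‖l i‖ ≤ K) : BddTendsto (fun _ i => l i) l :=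
  ⟨⟨K, fun _ i _ => h i⟩, fun _ => tendsto_const_nhds⟩

theorem qPoch_left (hq : ‖q‖ < 1) (x : ℂ) : BddTendsto (fun _ i => qPoch q x i)
    fun i => qPoch q x i :=
  of_bounded fun i => norm_qPoch_le hq le_rfl i

theorem inv_qPoch_left (hq : ‖q‖ < 1) {x : ℂ} (h : ∀ k : ℕ, 1 - x * q ^ k ≠ 0) :
    BddTendsto (fun _ i => (qPoch q x i)⁻¹) fun i => (qPoch q x i)⁻¹ := by
  obtain ⟨δ, hδ, h⟩ := exists_le_norm_qPoch hq h
  exact of_bounded (K := δ⁻¹) fun i => by rw [norm_inv]; exact inv_anti₀ hδ (h i)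

theorem qPoch_right (hq : ‖q‖ < 1) (x : ℂ) {f : ℕ → ℕ → ℕ}
    (hf : ∀ i, Tendsto (fun n => f n i) atTop atTop) :
    BddTendsto (fun n i => qPoch q x (f n i)) fun _ => qInf q x :=
  ⟨⟨_, fun _ _ _ => norm_qPoch_le hq le_rfl _⟩, fun i => (tendsto_qPoch hq x).comp (hf i)⟩

theorem inv_qPoch_right (hq : ‖q‖ < 1) {x : ℂ} (h : ∀ k : ℕ, 1 - x * q ^ k ≠ 0)
    {f : ℕ → ℕ → ℕ} (hf : ∀ i, Tendsto (fun n => f n i) atTop atTop) :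
    BddTendsto (fun n i => (qPoch q x (f n i))⁻¹) fun _ => (qInf q x)⁻¹ := by
  obtain ⟨δ, hδ, h'⟩ := exists_le_norm_qPoch hq h
  exact ⟨⟨δ⁻¹, fun n i _ => by rw [norm_inv]; exact inv_anti₀ hδ (h' _)⟩,
    fun i => ((tendsto_qPoch hq x).comp (hf i)).inv₀ (qInf_ne_zero hq h)⟩

theorem norm_mul_pow_le (hq : ‖q‖ < 1) (x : ℂ) (i : ℕ) : ‖x * q ^ i‖ ≤ ‖x‖ := by
  rw [norm_mul, norm_pow]
  exact mul_le_of_le_one_right (norm_nonneg _) (pow_le_one₀ (norm_nonneg _) hq.le)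

theorem qPoch_mul_pow (hq : ‖q‖ < 1) (x : ℂ) :
    BddTendsto (fun n i => qPoch q (x * q ^ i) n) fun i => qInf q (x * q ^ i) :=
  ⟨⟨_, fun _ i _ => norm_qPoch_le hq (norm_mul_pow_le hq x i) _⟩,
    fun i => tendsto_qPoch hq (x * q ^ i)⟩

/-- The second factor `(x q^{i+n})_{n-i}` tends to `1`, by `‖∏ (1 + u_k) - 1‖ ≤ exp (∑ ‖u_k‖) - 1`
with `∑ ‖u_k‖ = O(‖q‖^n)`. -/
theorem tcut (hq : ‖q‖ < 1) (x : ℂ) : BddTendsto (tcut q x) fun i => qPoch q x i := by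
  have h : BddTendsto (fun n i => qPoch q (x * q ^ (i + n)) (n - i : ℕ)) fun _ => 1 := by
    refine ⟨⟨_, fun n i _ => norm_qPoch_le hq (norm_mul_pow_le hq x (i + n)) _⟩, fun i => ?_⟩
    rw [tendsto_iff_norm_sub_tendsto_zero]
    have hlim : Tendsto (fun n : ℕ => Real.exp (‖x‖ * ‖q‖ ^ (i + n) * (1 - ‖q‖)⁻¹) - 1) atTop
        (𝓝 (Real.exp (‖x‖ * 0 * (1 - ‖q‖)⁻¹) - 1)) := by
      refine ((Real.continuous_exp.tendsto _).comp (Tendsto.mul_const _ (Tendsto.const_mul _ ?_))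
        ).sub_const 1
      have := (tendsto_pow_atTop_nhds_zero_of_lt_one (norm_nonneg _) hq).comp (tendsto_add_atTop_nat i)
      exact this.congr fun n => by simp [add_comm]
    simp only [mul_zero, zero_mul, Real.exp_zero, sub_self] at hlim
    refine squeeze_zero (fun _ => norm_nonneg _) (fun n => ?_) hlim
    rw [qPoch_natCast]
    simp only [sub_eq_add_neg (1 : ℂ)]
    refine (Finset.norm_prod_one_add_sub_one_le _ _).trans ?_
    gcongr
    calc ∑ k ∈ range (n - i), ‖-(x * q ^ (i + n) * q ^ k)‖
        = ‖x‖ * ‖q‖ ^ (i + n) * ∑ k ∈ range (n - i), ‖q‖ ^ k := by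
          rw [mul_sum]; exact sum_congr rfl fun k _ => by simp
      _ ≤ _ := by
          gcongr
          rw [← tsum_geometric_of_lt_one (norm_nonneg _) hq]
          exact (summable_geometric_of_lt_one (norm_nonneg _) hq).sum_le_tsum _
            (fun _ _ => by positivity)
  have h' := (qPoch_left hq x).mul h
  simp only [mul_one] at h'
  exact h'

end BddTendsto

section Limit

variable {q : ℂ} {J : Type*} [Fintype J] [DecidableEq J]

/-- Limit `n → ∞` of `sum_inTerm_eq`; each factor of the normalized residues is bounded and
convergent in the sense of `BddTendsto`. -/
theorem tsum_inTerm_eq (hq0 : q ≠ 0) (hq : ‖q‖ < 1) {x z : J → ℂ} (k : J) (m : ℤ)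
    (hx0 : ∀ j, x j ≠ 0) (hz0 : ∀ j, z j ≠ 0)
    (hx : ∀ j d, j ≠ d → NotPow q (x j / x d)) :
    ∑' i : ℕ, vth q (-i) * (q ^ (-m)) ^ i * ((qPoch q q i)⁻¹ * (qInf q q)⁻¹ *
      (∏ j ∈ univ.erase k, qInf q (z j * q ^ i)) * ∏ j, qPoch q (x j) i) =
    ∑ d, x d ^ m * ∑' i : ℕ, vth q (-i) *
      (q ^ m * ((∏ j ∈ univ.erase k, z j / x d) / ∏ j ∈ univ.erase d, x j / x d)) ^ i *
      ((qPoch q q i)⁻¹ * (qInf q q)⁻¹ * qPoch q (x d) i *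
      (∏ j ∈ univ.erase d, qInf q (x j)) *
      (∏ j ∈ univ.erase k, (qPoch q (q * (z j / x d)⁻¹) i * qInf q (z j / x d))) *
      ∏ j ∈ univ.erase d, ((qPoch q (q * (x j / x d)⁻¹) i)⁻¹ * (qInf q (x j / x d))⁻¹)) := by
  have hsub : ∀ i : ℕ, Tendsto (fun n : ℕ => n - 1 - i) atTop atTop := fun i =>
    (tendsto_sub_atTop_nat i).comp (tendsto_sub_atTop_nat 1)
  have hQ := BddTendsto.inv_qPoch_left hq (one_sub_pow_succ_ne hq)
  have hQ' := BddTendsto.inv_qPoch_right hq (one_sub_pow_succ_ne hq) (f := fun n i => n - 1 - i) hsub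
  have hin := ((hQ.mul hQ').mul (.prod (univ.erase k) fun j _ => .qPoch_mul_pow hq (z j))).mul
    (.prod univ fun j _ => .tcut hq (x j))
  have hin' := hin.tendsto_sum hq0 hq (ρ := q ^ (-m)) (zpow_ne_zero _ hq0)
  have hxd : ∀ j d, j ≠ d → ∀ r : ℕ, 1 - x j / x d * q ^ r ≠ 0 := fun j d hjd r => by
    simpa using (hx j d hjd).one_sub_ne hq0 r
  have hxd' : ∀ j d, j ≠ d → ∀ r : ℕ, 1 - q * (x j / x d)⁻¹ * q ^ r ≠ 0 := fun j d hjd r => by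
    simpa using ((hx j d hjd).inv.congr_mul hq0 rfl).one_sub_ne hq0 r
  have hout := fun d => (((((hQ.mul hQ').mul (.tcut hq (x d))).mul (.prod (univ.erase d) fun j _ =>
    .qPoch_right hq (x j) (f := fun n _ => 2 * n) fun _ =>
      tendsto_id.const_mul_atTop' (by norm_num))).mul
    (.prod (univ.erase k) fun j _ => (BddTendsto.qPoch_left hq (q * (z j / x d)⁻¹)).mul
      (.qPoch_right hq (z j / x d) (f := fun n i => n - i) tendsto_sub_atTop_nat))).mul
    (.prod (univ.erase d) fun j hj =>
      (BddTendsto.inv_qPoch_left hq (hxd' j d (ne_of_mem_erase hj))).mul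
      (.inv_qPoch_right hq (hxd j d (ne_of_mem_erase hj)) (f := fun n i => n - i)
        tendsto_sub_atTop_nat)))
  have hρ : ∀ d, q ^ m * ((∏ j ∈ univ.erase k, z j / x d) / ∏ j ∈ univ.erase d, x j / x d) ≠ 0 :=
    fun d => mul_ne_zero (zpow_ne_zero _ hq0) (div_ne_zero
      (prod_ne_zero_iff.mpr fun j _ => div_ne_zero (hz0 j) (hx0 d))
      (prod_ne_zero_iff.mpr fun j _ => div_ne_zero (hx0 j) (hx0 d)))
  have hout' := tendsto_finsetSum univ fun d _ =>
    ((hout d).tendsto_sum hq0 hq (hρ d)).const_mul (x d ^ m)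
  refine tendsto_nhds_unique hin' (hout'.congr' ?_)
  filter_upwards [eventually_gt_atTop m.natAbs] with n hn
  have h := sum_inTerm_eq hq0 hq k m hn hx0 hz0 hx
  have hin2 : ∀ i, inTerm q x z k m n i = vth q (-i) * (q ^ (-m)) ^ i * ((qPoch q q i)⁻¹ *
      (qPoch q q (n - 1 - i : ℕ))⁻¹ *
      (∏ j ∈ univ.erase k, qPoch q (z j * q ^ i) n) * ∏ j, QConn.tcut q (x j) n i) := fun i => by
    rw [inTerm]
    congr 2
    rw [← zpow_natCast, ← zpow_natCast, ← zpow_mul, ← zpow_mul, mul_comm]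
  simp only [hin2] at h
  rw [h]
  refine sum_congr rfl fun d _ => ?_
  rw [mul_sum]
  refine sum_congr rfl fun i _ => ?_
  have h3 : (q ^ i) ^ m = (q ^ m) ^ i := by
    rw [← zpow_natCast, ← zpow_natCast, ← zpow_mul, ← zpow_mul, mul_comm]
  rw [outTerm, mul_zpow, mul_pow, h3]
  ring

end Limit

end QConn

end

noncomputable section

namespace QConn

open Finset Filter Topology

/-! ### The one-variable connection formula for Laurent coefficients -/

section OneVar

variable {q : ℂ} {J : Type*} [Fintype J] [DecidableEq J]

theorem qInf_mul_pow_eq (hq0 : q ≠ 0) (hq : ‖q‖ < 1) {z : ℂ} (hz : NotPow q z) (i : ℕ) :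
    qInf q (z * q ^ i) = qInf q z * (qPoch q z i)⁻¹ := by
  have h := qInf_eq_qPoch_mul hq z i
  have h1 := hz.qPoch_ne_zero hq0 hq i
  rw [h]; field_simp

/-- Since `z k = q`, the factor `1/(q)_i` of the residue at `q^i` supplies the missing denominator
of index `k`. After division by a common constant, `tsum_inTerm_eq` becomes the coefficient of `t^m`
in `θ(t) φ(t) = ∑_d const · θ(x_d t) χ_d(t)`, with `φ` the series at `0` and `χ_d` the series at
`∞`. -/
theorem connection_nat (hq0 : q ≠ 0) (hq : ‖q‖ < 1) {x z : J → ℂ} (k : J) (m : ℤ)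
    (hx0 : ∀ j, x j ≠ 0) (hz0 : ∀ j, z j ≠ 0) (hzk : z k = q)
    (hx : ∀ j d, j ≠ d → NotPow q (x j / x d)) (hz : ∀ j, j ≠ k → NotPow q (z j)) :
    ∑' i : ℕ, vth q (m - i) * ∏ j, (qPoch q (x j) i / qPoch q (z j) i) =
    ∑ d, ((∏ j ∈ univ.erase k, qInf q (z j / x d) / qInf q (z j)) *
        ∏ j ∈ univ.erase d, qInf q (x j) / qInf q (x j / x d)) *
      ∑' i : ℕ, vth q (m + i) * x d ^ (m + i) * ((∏ j, z j / x j) ^ i *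
        ∏ j, (qPoch q (q * x d / z j) i / qPoch q (q * x d / x j) i)) := by
  have h := tsum_inTerm_eq hq0 hq k m hx0 hz0 hx
  have hne : qInf q q ≠ 0 := qInf_self_ne_zero hq
  have hZ : ∏ j ∈ univ.erase k, qInf q (z j) ≠ 0 := prod_ne_zero_iff.mpr fun j hj =>
    (hz j (ne_of_mem_erase hj)).qInf_ne_zero hq0 hq
  have e1 : ∀ i : ℕ, vth q (-i) * (q ^ (-m)) ^ i * ((qPoch q q i)⁻¹ * (qInf q q)⁻¹ *
      (∏ j ∈ univ.erase k, qInf q (z j * q ^ i)) * ∏ j, qPoch q (x j) i) =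
      ((vth q m)⁻¹ * (qInf q q)⁻¹ * ∏ j ∈ univ.erase k, qInf q (z j)) *
      (vth q (m - i) * ∏ j, (qPoch q (x j) i / qPoch q (z j) i)) := fun i => by
    have a1 : vth q (m - i) = vth q m * vth q (-i) * (q ^ (-m)) ^ i := by
      rw [sub_eq_add_neg, vth_add hq0, ← zpow_natCast (q ^ (-m)), ← zpow_mul]
      congr 2; ring
    have a2 : ∏ j ∈ univ.erase k, qInf q (z j * q ^ i) =
        (∏ j ∈ univ.erase k, qInf q (z j)) * ∏ j ∈ univ.erase k, (qPoch q (z j) i)⁻¹ := by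
      rw [← prod_mul_distrib]
      exact prod_congr rfl fun j hj => qInf_mul_pow_eq hq0 hq (hz j (ne_of_mem_erase hj)) i
    have a3 : ∏ j, (qPoch q (x j) i / qPoch q (z j) i) = (∏ j, qPoch q (x j) i) *
        ((qPoch q q i)⁻¹ * ∏ j ∈ univ.erase k, (qPoch q (z j) i)⁻¹) := by
      have c := mul_prod_erase univ (fun j => (qPoch q (z j) i)⁻¹) (mem_univ k)
      rw [hzk] at c
      rw [c, ← prod_mul_distrib]
      exact prod_congr rfl fun j _ => div_eq_mul_inv _ _
    rw [a1, a2, a3]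
    have := vth_ne_zero hq0 m
    field_simp
  have e2 : ∀ d, x d ^ m * ∑' i : ℕ, vth q (-i) *
      (q ^ m * ((∏ j ∈ univ.erase k, z j / x d) / ∏ j ∈ univ.erase d, x j / x d)) ^ i *
      ((qPoch q q i)⁻¹ * (qInf q q)⁻¹ * qPoch q (x d) i *
      (∏ j ∈ univ.erase d, qInf q (x j)) *
      (∏ j ∈ univ.erase k, (qPoch q (q * (z j / x d)⁻¹) i * qInf q (z j / x d))) *
      ∏ j ∈ univ.erase d, ((qPoch q (q * (x j / x d)⁻¹) i)⁻¹ * (qInf q (x j / x d))⁻¹)) =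
      ((vth q m)⁻¹ * (qInf q q)⁻¹ * ∏ j ∈ univ.erase k, qInf q (z j)) *
      (((∏ j ∈ univ.erase k, qInf q (z j / x d) / qInf q (z j)) *
        ∏ j ∈ univ.erase d, qInf q (x j) / qInf q (x j / x d)) *
      ∑' i : ℕ, vth q (m + i) * x d ^ (m + i) * ((∏ j, z j / x j) ^ i *
        ∏ j, (qPoch q (q * x d / z j) i / qPoch q (q * x d / x j) i))) := fun d => by
    have hxd := hx0 d
    rw [← tsum_mul_left, ← tsum_mul_left, ← tsum_mul_left]
    refine tsum_congr fun i => ?_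
    have a1 : vth q (m + i) = vth q m * vth q (-i) * (q ^ m) ^ i / q ^ i := by
      rw [vth_add hq0, ← zpow_natCast (q ^ m), ← zpow_mul, vth_neg hq0, zpow_natCast]
      have : q ^ i ≠ 0 := pow_ne_zero _ hq0
      field_simp
    -- Both erased products contain `|J| - 1` factors `1/x_d`, which cancel; this identifies the
    -- argument of the series at `∞`.
    have a2 : (∏ j, z j / x j) * x d =
        q * ((∏ j ∈ univ.erase k, z j / x d) / ∏ j ∈ univ.erase d, x j / x d) := by
      have c1 : ∏ j ∈ univ.erase k, z j / x d =
          (∏ j ∈ univ.erase k, z j) / x d ^ (Fintype.card J - 1) := by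
        rw [prod_div_distrib, prod_const, card_erase_of_mem (mem_univ _), card_univ]
      have c2 : ∏ j ∈ univ.erase d, x j / x d =
          (∏ j ∈ univ.erase d, x j) / x d ^ (Fintype.card J - 1) := by
        rw [prod_div_distrib, prod_const, card_erase_of_mem (mem_univ _), card_univ]
      have c3 : (∏ j ∈ univ.erase d, x j) ≠ 0 := prod_ne_zero_iff.mpr fun j _ => hx0 j
      have c4 : x d ^ (Fintype.card J - 1) ≠ 0 := pow_ne_zero _ hxd
      rw [c1, c2, prod_div_distrib, ← mul_prod_erase univ z (mem_univ k),
        ← mul_prod_erase univ x (mem_univ d), hzk]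
      field_simp
    have a3 : x d ^ (m + i) * (∏ j, z j / x j) ^ i = x d ^ m *
        (q ^ i * ((∏ j ∈ univ.erase k, z j / x d) / ∏ j ∈ univ.erase d, x j / x d) ^ i) := by
      rw [zpow_add₀ hxd, zpow_natCast, ← mul_pow, ← a2, mul_pow]; ring
    have a4 : ∏ j, (qPoch q (q * x d / z j) i / qPoch q (q * x d / x j) i) =
        (qPoch q (x d) i * ∏ j ∈ univ.erase k, qPoch q (q * (z j / x d)⁻¹) i) *
        ((qPoch q q i)⁻¹ * ∏ j ∈ univ.erase d, (qPoch q (q * (x j / x d)⁻¹) i)⁻¹) := by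
      rw [prod_div_distrib, ← mul_prod_erase univ (fun j => qPoch q (q * x d / z j) i) (mem_univ k),
        ← mul_prod_erase univ (fun j => qPoch q (q * x d / x j) i) (mem_univ d), hzk,
        mul_div_cancel_left₀ _ hq0, mul_div_cancel_right₀ _ hxd, prod_inv_distrib, ← mul_inv,
        ← div_eq_mul_inv]
      simp only [inv_div, mul_div_assoc]
    have a5 : ∀ y : ℂ, vth q (m + i) * x d ^ (m + i) * ((∏ j, z j / x j) ^ i * y) =
        vth q m * vth q (-i) * x d ^ m *
        (q ^ m * ((∏ j ∈ univ.erase k, z j / x d) / ∏ j ∈ univ.erase d, x j / x d)) ^ i * y := by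
      intro y
      have : q ^ i ≠ 0 := pow_ne_zero _ hq0
      rw [← mul_assoc, mul_assoc (vth q _), a3, a1, mul_pow (q ^ m)]
      field_simp
    rw [a4, a5, prod_div_distrib (f := fun j => qInf q (z j / x d)),
      prod_div_distrib (f := fun j => qInf q (x j)), prod_mul_distrib, prod_mul_distrib,
      prod_inv_distrib (f := fun j => qInf q (x j / x d))]
    generalize ∏ j ∈ univ.erase k, qInf q (z j) = Z at hZ
    generalize (q ^ m * ((∏ j ∈ univ.erase k, z j / x d) / ∏ j ∈ univ.erase d, x j / x d)) ^ i = ρ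
    have := vth_ne_zero hq0 m
    field_simp
  simp only [e1] at h
  rw [tsum_mul_left, sum_congr rfl fun d _ => e2 d, ← mul_sum] at h
  refine mul_left_cancel₀ ?_ h
  exact mul_ne_zero (mul_ne_zero (inv_ne_zero (vth_ne_zero hq0 m)) (inv_ne_zero hne)) hZ

end OneVar

end QConn

end

/-! ### Shifted parameters: the connection constants do not depend on the shifts -/

noncomputable section

namespace QConn

open Finset Filter Topology

/-- Coefficients of the local solutions at `0`, for the parameters `A_j q^{n_j}`, `C_j q^{n_j}`. -/
def phiC {J : Type*} [Fintype J] (q : ℂ) (A C : J → ℂ) (n : J → ℤ) (k : J) (e : ℤ) : ℂ :=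
  ∏ j, (qPoch q (q * A j / C k) (e + n j) / qPoch q (q * C j / C k) (e + n j))

/-- Coefficients of the local solutions at `∞`, for the parameters `A_j q^{n_j}`, `C_j q^{n_j}`. -/
def chiC {J : Type*} [Fintype J] (q : ℂ) (A C : J → ℂ) (n : J → ℤ) (d : J) (e : ℤ) : ℂ :=
  ∏ j, (qPoch q (q * A d / C j) (-(e + n j)) / qPoch q (q * A d / A j) (-(e + n j)) *
    (C j / A j) ^ (-(e + n j)))

/-- The constants of the connection formula. -/
def betaC {J : Type*} [Fintype J] [DecidableEq J] (q : ℂ) (A C : J → ℂ) (k d : J) : ℂ :=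
  (∏ j ∈ univ.erase k, qInf q (C j / A d) / qInf q (q * C j / C k)) *
    ∏ j ∈ univ.erase d, qInf q (q * A j / C k) / qInf q (A j / A d)

section Shifted

variable {q : ℂ}

theorem vth_sq (hq0 : q ≠ 0) (s : ℤ) : vth q s * vth q s * q ^ s = q ^ (s * s) := by
  have h1 := vth_add hq0 s (-s)
  have h3 : q ^ (s * s) ≠ 0 := zpow_ne_zero _ hq0
  rw [add_neg_cancel, vth_zero, vth_neg hq0, mul_neg, zpow_neg] at h1
  field_simp at h1
  linear_combination -h1

/-- For `n = 0` nothing has to be assumed on `x`. This is used for pairs of parameters with equal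
shifts, whose ratios need not be generic. -/
theorem qPoch_add_natCast (hq0 : q ≠ 0) (hq : ‖q‖ < 1) {x : ℂ} {n : ℤ} (h : n ≠ 0 → NotPow q x)
    (i : ℕ) : qPoch q x (i + n) = qPoch q x n * qPoch q (x * q ^ n) i := by
  by_cases hn : n = 0
  · simp [hn]
  · rw [add_comm, (h hn).qPoch_add hq0 hq]

theorem qPoch_mul_qInf (hq0 : q ≠ 0) (hq : ‖q‖ < 1) {x : ℂ} {n : ℤ} (h : n ≠ 0 → NotPow q x) :
    qPoch q x n * qInf q (x * q ^ n) = qInf q x := by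
  by_cases hn : n = 0
  · simp [hn]
  · exact (h hn).qPoch_mul_qInf hq0 hq n

theorem qPoch_reflect (hq0 : q ≠ 0) (hq : ‖q‖ < 1) {x : ℂ} (hx0 : x ≠ 0) {n : ℤ}
    (h : n ≠ 0 → NotPow q x) :
    qPoch q x n * qPoch q (q / x) (-n) = vth q n * x ^ n := by
  by_cases hn : n = 0
  · simp [hn]
  · have hx := h hn
    have hx' : NotPow q (q / x) := hx.congr_inv hq0 1 (by rw [zpow_one])
    have h := theta_mul_zpow hq0 hq hx0 n
    rw [hx.qPoch_eq hq0 hq, hx'.qPoch_eq hq0 hq, div_mul_div_comm]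
    have h1 : q / x * q ^ (-n) = q / (x * q ^ n) := by
      rw [zpow_neg]
      have : q ^ n ≠ 0 := zpow_ne_zero _ hq0
      field_simp
    rw [h1, ← theta, ← theta, ← h, mul_div_cancel_left₀ _
      ((hx.mul_zpow hq0 n).theta_ne_zero hq0 hq)]

/-- Combines `(x)_n (x q^n)_∞ = (x)_∞` with the reflection `(x)_n (q/x)_{-n} = vth q n · x^n`, for
`x = w/a`; it moves a shift out of an infinite product into the symbols occurring in `chiC`. -/
theorem qInf_shift (hq0 : q ≠ 0) (hq : ‖q‖ < 1) {w a : ℂ} (hw : w ≠ 0) (ha : a ≠ 0) {n : ℤ}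
    (h : n ≠ 0 → NotPow q (w / a)) :
    qInf q (w / a * q ^ n) * (vth q n * a ^ (-n)) =
      qInf q (w / a) * qPoch q (q * a / w) (-n) * w ^ (-n) := by
  have h1 := qPoch_mul_qInf hq0 hq h
  have h2 := qPoch_reflect hq0 hq (div_ne_zero hw ha) h
  have h3 : q * a / w = q / (w / a) := by field_simp
  have h4 : vth q n * a ^ (-n) = qPoch q (w / a) n * qPoch q (q / (w / a)) (-n) * w ^ (-n) := by
    rw [h2, zpow_neg, zpow_neg, div_zpow]
    have : w ^ n ≠ 0 := zpow_ne_zero _ hw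
    field_simp
  rw [h3, h4, ← h1]
  ring

/-- The genericity which the connection formula needs. -/
structure Admissible {J : Type*} (q : ℂ) (A C : J → ℂ) (n : J → ℤ) : Prop where
  A_ne : ∀ j, A j ≠ 0
  C_ne : ∀ j, C j ≠ 0
  AA : ∀ j d, j ≠ d → NotPow q (A j / A d)
  CC : ∀ j d, j ≠ d → NotPow q (C j / C d)
  -- Demanded only for different shifts; so nothing is required of `b_p` alone or of `a_j/c_d` in
  -- the application.
  AC : ∀ j d, n j ≠ n d → NotPow q (A j / C d)

theorem Admissible.CA {J : Type*} {A C : J → ℂ} {n : J → ℤ} (h : Admissible q A C n) (j d : J)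
    (hn : n j ≠ n d) : NotPow q (C j / A d) := by
  simpa using (h.AC d j (Ne.symm hn)).inv

/-- The substitution `t ↦ 1/t` exchanges `0` and `∞`; on parameters it sends `(A, C, n)` to `(1/C,
1/A, -n)`. -/
theorem Admissible.dual {J : Type*} {A C : J → ℂ} {n : J → ℤ} (h : Admissible q A C n) :
    Admissible q (fun j => (C j)⁻¹) (fun j => (A j)⁻¹) (fun j => -n j) where
  A_ne j := inv_ne_zero (h.C_ne j)
  C_ne j := inv_ne_zero (h.A_ne j)
  AA j d hjd := by simpa [div_eq_mul_inv, mul_comm] using h.CC d j hjd.symm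
  CC j d hjd := by simpa [div_eq_mul_inv, mul_comm] using h.AA d j hjd.symm
  AC j d hn := by simpa [div_eq_mul_inv, mul_comm] using h.AC d j fun h' => hn (by rw [h'])

variable {J : Type*} [Fintype J] {A C : J → ℂ} {n : J → ℤ}

/-- The factor `j = k` has denominator `(q)_{e + n_k}`, whose stored value at negative index is `0`,
so that the quotient is `0`. In this way one-sided series are treated as series over `ℤ`. -/
theorem phiC_eq_zero (hq0 : q ≠ 0) (h : Admissible q A C n) {k : J} {e : ℤ} (he : e + n k < 0) :
    phiC q A C n k e = 0 :=
  prod_eq_zero (mem_univ k) (by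
    rw [mul_div_cancel_right₀ _ (h.C_ne k), qPoch_self_of_neg hq0 he, div_zero])

theorem chiC_eq_zero (hq0 : q ≠ 0) (h : Admissible q A C n) {d : J} {e : ℤ} (he : 0 < e + n d) :
    chiC q A C n d e = 0 :=
  prod_eq_zero (mem_univ d) (by
    rw [mul_div_cancel_right₀ _ (h.A_ne d), qPoch_self_of_neg hq0 (by omega), div_zero, zero_mul])

theorem phiC_natCast_sub (hq0 : q ≠ 0) (hq : ‖q‖ < 1) (h : Admissible q A C n) (k : J) (i : ℕ) :
    phiC q A C n k (i - n k) =
      (∏ j, (qPoch q (q * A j / C k) (n j - n k) / qPoch q (q * C j / C k) (n j - n k))) *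
      ∏ j, (qPoch q (q * A j / C k * q ^ (n j - n k)) i /
        qPoch q (q * C j / C k * q ^ (n j - n k)) i) := by
  rw [phiC, ← prod_mul_distrib]
  refine prod_congr rfl fun j _ => ?_
  rw [show (i : ℤ) - n k + n j = i + (n j - n k) by ring,
    qPoch_add_natCast hq0 hq fun hn => (h.AC j k (sub_ne_zero.mp hn)).congr_mul hq0 (by ring),
    qPoch_add_natCast hq0 hq fun hn => (h.CC j k fun hjk => hn (by rw [hjk, sub_self])).congr_mul
      hq0 (by ring), div_mul_div_comm]

theorem chiC_neg_natCast_sub (hq0 : q ≠ 0) (hq : ‖q‖ < 1) (h : Admissible q A C n) (d : J)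
    (i : ℕ) :
    chiC q A C n d (-i - n d) =
      (∏ j, (qPoch q (q * A d / C j) (n d - n j) / qPoch q (q * A d / A j) (n d - n j) *
        (C j / A j) ^ (n d - n j))) * ((∏ j, C j / A j) ^ i *
      ∏ j, (qPoch q (q * A d / C j * q ^ (n d - n j)) i /
        qPoch q (q * A d / A j * q ^ (n d - n j)) i)) := by
  rw [chiC, ← prod_pow, ← prod_mul_distrib, ← prod_mul_distrib]
  refine prod_congr rfl fun j _ => ?_
  rw [show -(-(i : ℤ) - n d + n j) = i + (n d - n j) by ring,
    qPoch_add_natCast hq0 hq fun hn => (h.AC d j (sub_ne_zero.mp hn)).congr_mul hq0 (by ring),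
    qPoch_add_natCast hq0 hq fun hn => (h.AA d j fun hjk => hn (by rw [hjk, sub_self])).congr_mul
      hq0 (by ring), zpow_add₀ (div_ne_zero (h.C_ne j) (h.A_ne j)), zpow_natCast,
      mul_div_mul_comm]
  ring

variable [DecidableEq J]

/-- The left side contains the connection constant for the parameters `A_j q^{n_j}`, `C_j q^{n_j}`.
Pulling the shifts out of the infinite products leaves `betaC q A C k d` times exactly the leading
coefficient of the shifted solution at `∞`. Hence the connection constants are the same for all `n`.
-/
theorem betaC_shift (hq0 : q ≠ 0) (hq : ‖q‖ < 1) (h : Admissible q A C n) (k d : J) :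
    (∏ j, (qPoch q (q * A j / C k) (n j - n k) / qPoch q (q * C j / C k) (n j - n k))) *
      ((∏ j ∈ univ.erase k, qInf q (C j / A d * q ^ (n j - n d)) /
          qInf q (q * C j / C k * q ^ (n j - n k))) *
        ∏ j ∈ univ.erase d, qInf q (q * A j / C k * q ^ (n j - n k)) /
          qInf q (A j / A d * q ^ (n j - n d))) *
      (vth q (-(n d - n k)) * (q * A d / C k) ^ (-(n d - n k)) *
        q ^ (-((n d - n k) * (n d - n k)))) =
    betaC q A C k d * ∏ j, (qPoch q (q * A d / C j) (n d - n j) /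
      qPoch q (q * A d / A j) (n d - n j) * (C j / A j) ^ (n d - n j)) := by
  have hA := h.A_ne
  have hC := h.C_ne
  have hA' := hA d
  have hC' := hC k
  -- split off the exceptional indices
  have p1 : ∏ j, qPoch q (q * A j / C k) (n j - n k) = qPoch q (q * A d / C k) (n d - n k) *
      ∏ j ∈ univ.erase d, qPoch q (q * A j / C k) (n j - n k) :=
    (mul_prod_erase univ (fun j => qPoch q (q * A j / C k) (n j - n k)) (mem_univ d)).symm
  have p2 : ∏ j, qPoch q (q * C j / C k) (n j - n k) =
      ∏ j ∈ univ.erase k, qPoch q (q * C j / C k) (n j - n k) := by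
    rw [← mul_prod_erase univ (fun j => qPoch q (q * C j / C k) (n j - n k)) (mem_univ k)]
    simp
  have p3 : ∏ j, (qPoch q (q * A d / A j) (n d - n j) * A j ^ (n d - n j)) =
      ∏ j ∈ univ.erase d, (qPoch q (q * A d / A j) (n d - n j) * A j ^ (n d - n j)) := by
    rw [← mul_prod_erase univ (fun j => qPoch q (q * A d / A j) (n d - n j) * A j ^ (n d - n j))
      (mem_univ d)]
    simp
  have p4 : ∏ j, (qPoch q (q * A d / C j) (n d - n j) * C j ^ (n d - n j)) =
      qPoch q (q * A d / C k) (n d - n k) * C k ^ (n d - n k) *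
      ∏ j ∈ univ.erase k, (qPoch q (q * A d / C j) (n d - n j) * C j ^ (n d - n j)) :=
    (mul_prod_erase univ (fun j => qPoch q (q * A d / C j) (n d - n j) * C j ^ (n d - n j))
      (mem_univ k)).symm
  have hz : ∀ j ∈ univ.erase k, NotPow q (q * C j / C k) := fun j hj =>
    (h.CC j k (ne_of_mem_erase hj)).congr_mul hq0 (by ring)
  -- the elementary shifts
  have s1 : (∏ j ∈ univ.erase k, qPoch q (q * C j / C k) (n j - n k)) *
      ∏ j ∈ univ.erase k, qInf q (q * C j / C k * q ^ (n j - n k)) =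
      ∏ j ∈ univ.erase k, qInf q (q * C j / C k) := by
    rw [← prod_mul_distrib]
    exact prod_congr rfl fun j hj => qPoch_mul_qInf hq0 hq fun _ => hz j hj
  have s2 : (∏ j ∈ univ.erase d, qPoch q (q * A j / C k) (n j - n k)) *
      ∏ j ∈ univ.erase d, qInf q (q * A j / C k * q ^ (n j - n k)) =
      ∏ j ∈ univ.erase d, qInf q (q * A j / C k) := by
    rw [← prod_mul_distrib]
    exact prod_congr rfl fun j hj => qPoch_mul_qInf hq0 hq fun hn =>
      (h.AC j k (sub_ne_zero.mp hn)).congr_mul hq0 (by ring)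
  have s3 : (∏ j ∈ univ.erase k, qInf q (C j / A d * q ^ (n j - n d))) *
      ∏ j ∈ univ.erase k, (vth q (n j - n d) * A d ^ (-(n j - n d))) =
      (∏ j ∈ univ.erase k, qInf q (C j / A d)) *
      ∏ j ∈ univ.erase k, (qPoch q (q * A d / C j) (n d - n j) * C j ^ (n d - n j)) := by
    rw [← prod_mul_distrib, ← prod_mul_distrib]
    refine prod_congr rfl fun j hj => ?_
    rw [qInf_shift hq0 hq (hC j) hA' fun hn => h.CA j d (sub_ne_zero.mp hn), neg_sub, mul_assoc]
  have s4 : (∏ j ∈ univ.erase d, qInf q (A j / A d * q ^ (n j - n d))) *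
      ∏ j ∈ univ.erase d, (vth q (n j - n d) * A d ^ (-(n j - n d))) =
      (∏ j ∈ univ.erase d, qInf q (A j / A d)) *
      ∏ j ∈ univ.erase d, (qPoch q (q * A d / A j) (n d - n j) * A j ^ (n d - n j)) := by
    rw [← prod_mul_distrib, ← prod_mul_distrib]
    refine prod_congr rfl fun j hj => ?_
    rw [qInf_shift hq0 hq (hA j) hA' fun _ => h.AA j d (ne_of_mem_erase hj), neg_sub, mul_assoc]
  -- The theta factors over `j ≠ k` and over `j ≠ d` differ only by the one with `j = k`, as the one
  -- with `j = d` is `1`. This surplus cancels in `s6` against the third factor on the left of the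
  -- claim, by `vth_sq`.
  have s5 : (vth q (n k - n d) * A d ^ (-(n k - n d))) *
      ∏ j ∈ univ.erase k, (vth q (n j - n d) * A d ^ (-(n j - n d))) =
      ∏ j ∈ univ.erase d, (vth q (n j - n d) * A d ^ (-(n j - n d))) := by
    rw [mul_prod_erase univ (fun j => vth q (n j - n d) * A d ^ (-(n j - n d))) (mem_univ k),
      ← mul_prod_erase univ (fun j => vth q (n j - n d) * A d ^ (-(n j - n d))) (mem_univ d)]
    simp
  have s6 : vth q (-(n d - n k)) * (q * A d / C k) ^ (-(n d - n k)) *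
      q ^ (-((n d - n k) * (n d - n k))) * (vth q (n k - n d) * A d ^ (-(n k - n d))) =
      C k ^ (n d - n k) := by
    have t := vth_sq hq0 (n k - n d)
    rw [show -(n d - n k) = n k - n d by ring, show -(n k - n d) = n d - n k by ring,
      show -((n d - n k) * (n d - n k)) = -((n k - n d) * (n k - n d)) by ring, zpow_neg, ← t,
      show n d - n k = -(n k - n d) by ring]
    generalize n k - n d = N
    have v := vth_ne_zero hq0 N
    rw [div_zpow, mul_zpow, zpow_neg, zpow_neg]
    have := zpow_ne_zero N hq0
    have := zpow_ne_zero N hA'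
    have := zpow_ne_zero N hC'
    field_simp
  have n1 : ∏ j ∈ univ.erase k, qInf q (q * C j / C k * q ^ (n j - n k)) ≠ 0 :=
    prod_ne_zero_iff.mpr fun j hj => ((hz j hj).mul_zpow hq0 _).qInf_ne_zero hq0 hq
  have n2 : ∏ j ∈ univ.erase k, qPoch q (q * C j / C k) (n j - n k) ≠ 0 :=
    prod_ne_zero_iff.mpr fun j hj => (hz j hj).qPoch_ne_zero hq0 hq _
  have n3 : ∏ j ∈ univ.erase d, qInf q (A j / A d * q ^ (n j - n d)) ≠ 0 :=
    prod_ne_zero_iff.mpr fun j hj =>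
      ((h.AA j d (ne_of_mem_erase hj)).mul_zpow hq0 _).qInf_ne_zero hq0 hq
  have n4 : ∏ j ∈ univ.erase d, qInf q (A j / A d) ≠ 0 :=
    prod_ne_zero_iff.mpr fun j hj => (h.AA j d (ne_of_mem_erase hj)).qInf_ne_zero hq0 hq
  have n5 : ∏ j ∈ univ.erase d, (qPoch q (q * A d / A j) (n d - n j) * A j ^ (n d - n j)) ≠ 0 :=
    prod_ne_zero_iff.mpr fun j hj => mul_ne_zero (((h.AA d j
      (ne_of_mem_erase hj).symm).congr_mul hq0 (by ring)).qPoch_ne_zero hq0 hq _)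
      (zpow_ne_zero _ (hA j))
  have n6 : vth q (n k - n d) * A d ^ (-(n k - n d)) ≠ 0 :=
    mul_ne_zero (vth_ne_zero hq0 _) (zpow_ne_zero _ hA')
  have n7 : ∏ j ∈ univ.erase k, (vth q (n j - n d) * A d ^ (-(n j - n d))) ≠ 0 :=
    prod_ne_zero_iff.mpr fun j hj => mul_ne_zero (vth_ne_zero hq0 _) (zpow_ne_zero _ hA')
  have p5 : ∏ j, (qPoch q (q * A d / C j) (n d - n j) /
      qPoch q (q * A d / A j) (n d - n j) * (C j / A j) ^ (n d - n j)) =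
      (∏ j, (qPoch q (q * A d / C j) (n d - n j) * C j ^ (n d - n j))) /
      ∏ j, (qPoch q (q * A d / A j) (n d - n j) * A j ^ (n d - n j)) := by
    rw [← prod_div_distrib]
    exact prod_congr rfl fun j _ => by rw [div_zpow]; ring
  rw [p5, p3, p4, prod_div_distrib, p1, p2, betaC, prod_div_distrib, prod_div_distrib,
    prod_div_distrib, prod_div_distrib, ← s1, ← s2]
  generalize ∏ j ∈ univ.erase k, qInf q (q * C j / C k * q ^ (n j - n k)) = X1 at *
  generalize ∏ j ∈ univ.erase k, qPoch q (q * C j / C k) (n j - n k) = X2 at *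
  generalize ∏ j ∈ univ.erase d, qInf q (A j / A d * q ^ (n j - n d)) = X3 at *
  generalize ∏ j ∈ univ.erase d, qInf q (A j / A d) = X4 at *
  generalize ∏ j ∈ univ.erase d, (qPoch q (q * A d / A j) (n d - n j) * A j ^ (n d - n j)) = X5 at *
  generalize ∏ j ∈ univ.erase k, (vth q (n j - n d) * A d ^ (-(n j - n d))) = X7 at *
  generalize vth q (n k - n d) * A d ^ (-(n k - n d)) = X6 at *
  generalize ∏ j ∈ univ.erase k, qInf q (C j / A d * q ^ (n j - n d)) = Y1 at *
  generalize ∏ j ∈ univ.erase k, qInf q (C j / A d) = Y2 at *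
  generalize ∏ j ∈ univ.erase k, (qPoch q (q * A d / C j) (n d - n j) * C j ^ (n d - n j)) = Y3 at *
  rw [← s5] at s4
  generalize vth q (-(n d - n k)) * (q * A d / C k) ^ (-(n d - n k)) *
      q ^ (-((n d - n k) * (n d - n k))) = Y4 at *
  rw [← s6]
  generalize qPoch q (q * A d / C k) (n d - n k) = Y5 at *
  generalize ∏ j ∈ univ.erase d, qPoch q (q * A j / C k) (n j - n k) = Z1 at *
  generalize ∏ j ∈ univ.erase d, qInf q (q * A j / C k * q ^ (n j - n k)) = Z2 at *
  field_simp
  have s7 : X4 * X5 * Y1 = Y2 * Y3 * (X3 * X6) := by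
    refine mul_right_cancel₀ n7 ?_
    rw [mul_assoc, s3, ← s4]; ring
  linear_combination Y5 * Z1 * Z2 * Y4 * s7

/-- The connection formula between the local solutions at `0` and at `∞`, for Laurent
coefficients. -/
theorem connection (hq0 : q ≠ 0) (hq : ‖q‖ < 1) (h : Admissible q A C n) (k : J) (m : ℤ) :
    ∑' s : ℤ, vth q s * phiC q A C n k (m - s) =
      ∑ d, betaC q A C k d *
        ∑' s : ℤ, vth q s * (q * A d / C k) ^ s * chiC q A C n d (m - s) := by
  have hA := h.A_ne
  have hC := h.C_ne
  -- The solution at `0` of index `k` is supported on exponents `i - n_k`, `i ≥ 0`, and below the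
  -- one at `∞` of index `d` on exponents `-i - n_d`; both bilateral sums become sums over `ℕ`.
  have l1 : ∑' s : ℤ, vth q s * phiC q A C n k (m - s) =
      ∑' i : ℕ, vth q (m + n k - i) * phiC q A C n k (i - n k) := by
    have hinj : Function.Injective fun i : ℕ => m + n k - (i : ℤ) := fun a b hab => by
      simp only at hab; omega
    rw [← hinj.tsum_eq]
    · exact tsum_congr fun i => by rw [show m - (m + n k - (i : ℤ)) = i - n k by ring]
    · intro s hs
      rw [Function.mem_support] at hs
      have : 0 ≤ m - s + n k := by
        by_contra hneg
        exact hs (by rw [phiC_eq_zero hq0 h (not_le.mp hneg), mul_zero])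
      exact ⟨(m - s + n k).toNat, by simp only; omega⟩
  have l2 : ∀ d, ∑' s : ℤ, vth q s * (q * A d / C k) ^ s * chiC q A C n d (m - s) =
      ∑' i : ℕ, vth q (m + n d + i) * (q * A d / C k) ^ (m + n d + i) *
        chiC q A C n d (-i - n d) := fun d => by
    have hinj : Function.Injective fun i : ℕ => m + n d + (i : ℤ) := fun a b hab => by
      simp only at hab; omega
    rw [← hinj.tsum_eq]
    · exact tsum_congr fun i => by rw [show m - (m + n d + (i : ℤ)) = -i - n d by ring]
    · intro s hs
      rw [Function.mem_support] at hs
      have : m - s + n d ≤ 0 := by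
        by_contra hneg
        exact hs (by rw [chiC_eq_zero hq0 h (not_le.mp hneg), mul_zero])
      exact ⟨(s - m - n d).toNat, by simp only; omega⟩
  have hqz : ∀ N : ℤ, q ^ N ≠ 0 := fun N => zpow_ne_zero _ hq0
  -- Normalizing by `C_k q^{n_k}/q` makes the denominator parameter of index `k` equal to `q`, as
  -- `connection_nat` requires; the exponent `m` moves to `m + n_k`.
  have key := connection_nat hq0 hq (x := fun j => q * A j / C k * q ^ (n j - n k))
    (z := fun j => q * C j / C k * q ^ (n j - n k)) k (m + n k)
    (fun j => mul_ne_zero (div_ne_zero (mul_ne_zero hq0 (hA j)) (hC k)) (hqz _))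
    (fun j => mul_ne_zero (div_ne_zero (mul_ne_zero hq0 (hC j)) (hC k)) (hqz _))
    (by simp [hC k])
    (fun j d hjd => (h.AA j d hjd).congr_zpow hq0 (n j - n d) (by
      rw [show n j - n d = n j - n k - (n d - n k) by ring, zpow_sub₀ hq0 (n j - n k)]
      have := hqz (n d - n k); have := hC k; have := hA d
      field_simp))
    (fun j hj => ((h.CC j k hj).congr_mul hq0 (by ring)).mul_zpow hq0 _)
  have r1 : ∀ (w : J → ℂ) (j d : J), q * w j / C k * q ^ (n j - n k) /
      (q * A d / C k * q ^ (n d - n k)) = w j / A d * q ^ (n j - n d) := fun w j d => by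
    rw [show n j - n d = n j - n k - (n d - n k) by ring, zpow_sub₀ hq0 (n j - n k)]
    have := hqz (n d - n k); have := hC k; have := hA d
    field_simp
  have r2 : ∀ (w : J → ℂ) (j d : J), w j ≠ 0 → q * (q * A d / C k * q ^ (n d - n k)) /
      (q * w j / C k * q ^ (n j - n k)) = q * A d / w j * q ^ (n d - n j) := fun w j d hw => by
    rw [show n d - n j = n d - n k - (n j - n k) by ring, zpow_sub₀ hq0 (n d - n k)]
    have := hqz (n j - n k); have := hC k
    field_simp
  simp only [r1 C, r1 A, r2 C _ _ (hC _), r2 A _ _ (hA _), sub_self, zpow_zero, mul_one] at key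
  rw [l1, tsum_congr fun i => by rw [phiC_natCast_sub hq0 hq h, mul_left_comm], tsum_mul_left, key,
    mul_sum]
  refine sum_congr rfl fun d _ => ?_
  have hX : q * A d / C k ≠ 0 := div_ne_zero (mul_ne_zero hq0 (hA d)) (hC k)
  have l3 : ∀ i : ℕ, vth q (m + n d + i) * (q * A d / C k) ^ (m + n d + i) *
      chiC q A C n d (-i - n d) = (∏ j, (qPoch q (q * A d / C j) (n d - n j) /
        qPoch q (q * A d / A j) (n d - n j) * (C j / A j) ^ (n d - n j))) *
      (vth q (m + n d + i) * (q * A d / C k) ^ (m + n d + i) * ((∏ j, C j / A j) ^ i *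
      ∏ j, (qPoch q (q * A d / C j * q ^ (n d - n j)) i /
        qPoch q (q * A d / A j * q ^ (n d - n j)) i))) := fun i => by
    rw [chiC_neg_natCast_sub hq0 hq h, mul_left_comm]
  -- The two sides carry `vth` at `m + n_k + i` and at `m + n_d + i`; the quotient is the third
  -- factor on the left of `betaC_shift`, up to a geometric factor that changes the argument of
  -- theta.
  rw [l2 d, tsum_congr l3, tsum_mul_left, ← mul_assoc (betaC q A C k d),
    ← betaC_shift hq0 hq h, ← mul_assoc, mul_assoc _ (vth q (-(n d - n k)) * _ * _),
    ← tsum_mul_left (a := vth q (-(n d - n k)) * _ * _)]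
  refine congrArg₂ _ rfl (tsum_congr fun i => ?_)
  rw [← mul_assoc (vth q (-(n d - n k)) * _ * _),
    show m + n k + (i : ℤ) = (m + n d + i) + -(n d - n k) by ring]
  refine congrArg₂ _ ?_ rfl
  generalize m + n d + (i : ℤ) = s
  generalize n d - n k = N
  rw [vth_add hq0, mul_zpow, ← zpow_mul, zpow_add₀ hX,
    show N * (s + -N) = -(s * -N) + -(N * N) by ring, zpow_add₀ hq0, zpow_neg q (s * -N)]
  have := hqz (s * -N)
  field_simp

theorem betaC_dual (q : ℂ) (A C : J → ℂ) (k d : J) :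
    betaC q (fun j => (C j)⁻¹) (fun j => (A j)⁻¹) k d =
      (∏ j ∈ univ.erase k, qInf q (C d / A j) / qInf q (q * A k / A j)) *
        ∏ j ∈ univ.erase d, qInf q (q * A k / C j) / qInf q (C d / C j) := by
  simp only [betaC, div_inv_eq_mul, mul_assoc]
  congr 1 <;> refine prod_congr rfl fun j _ => ?_
  · congr 2 <;> ring
  · congr 2 <;> ring

/-- The connection formula in the opposite direction. -/
theorem connection_dual (hq0 : q ≠ 0) (hq : ‖q‖ < 1) (h : Admissible q A C n) (k : J) (m : ℤ) :
    ∑' s : ℤ, vth q s * (q * ∏ j, A j / C j) ^ s * chiC q A C n k (m - s) =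
      ∑ d, betaC q (fun j => (C j)⁻¹) (fun j => (A j)⁻¹) k d *
        ∑' s : ℤ, vth q s * ((∏ j, A j / C j) * (C d / A k)) ^ s * phiC q A C n d (m - s) := by
  have hA := h.A_ne
  have hC := h.C_ne
  -- Apply `connection` to the dual parameters and reverse the signs of `m` and `s`. By `f1` and
  -- `f2` this exchanges `phiC` and `chiC` up to the product `∏_j (C_j/A_j)^{e + n_j}`; by `f3` that
  -- product is constant up to `(∏_j A_j/C_j)^s`, which enters the arguments of the theta functions.
  have key := connection hq0 hq h.dual k (-m)
  have f1 : ∀ e : ℤ, phiC q (fun j => (C j)⁻¹) (fun j => (A j)⁻¹) (fun j => -n j) k (-e) =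
      chiC q A C n k e * ∏ j, (C j / A j) ^ (e + n j) := fun e => by
    rw [phiC, chiC, ← prod_mul_distrib]
    refine prod_congr rfl fun j _ => ?_
    rw [mul_assoc, ← zpow_add₀ (div_ne_zero (hC j) (hA j)), neg_add_cancel, zpow_zero, mul_one,
      show -e + -n j = -(e + n j) by ring]
    congr 2 <;> field_simp [hA j, hC j, hA k]
  have f2 : ∀ (d : J) (e : ℤ), chiC q (fun j => (C j)⁻¹) (fun j => (A j)⁻¹) (fun j => -n j) d (-e) =
      phiC q A C n d e * ∏ j, (C j / A j) ^ (e + n j) := fun d e => by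
    rw [phiC, chiC, ← prod_mul_distrib]
    refine prod_congr rfl fun j _ => ?_
    rw [show -(-e + -n j) = e + n j by ring]
    rw [show q * (C d)⁻¹ / (A j)⁻¹ = q * A j / C d by rw [div_inv_eq_mul]; ring,
      show q * (C d)⁻¹ / (C j)⁻¹ = q * C j / C d by rw [div_inv_eq_mul]; ring,
      show (A j)⁻¹ / (C j)⁻¹ = C j / A j by rw [div_inv_eq_mul]; ring]
  have f3 : ∀ s : ℤ, ∏ j, (C j / A j) ^ (m - s + n j) =
      (∏ j, (C j / A j) ^ (m + n j)) * (∏ j, A j / C j) ^ s := fun s => by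
    rw [← prod_zpow, ← prod_mul_distrib]
    refine prod_congr rfl fun j _ => ?_
    rw [show m - s + n j = m + n j + -s by ring, zpow_add₀ (div_ne_zero (hC j) (hA j)), zpow_neg,
      ← inv_zpow, inv_div]
  have hL : ∏ j, (C j / A j) ^ (m + n j) ≠ 0 :=
    prod_ne_zero_iff.mpr fun j _ => zpow_ne_zero _ (div_ne_zero (hC j) (hA j))
  rw [← (Equiv.neg ℤ).tsum_eq, sum_congr rfl fun d _ => by
    rw [← (Equiv.neg ℤ).tsum_eq fun s : ℤ => vth q s * _ ^ s * _]] at key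
  simp only [Equiv.neg_apply] at key
  have g1 : ∀ s : ℤ, vth q (-s) * phiC q (fun j => (C j)⁻¹) (fun j => (A j)⁻¹) (fun j => -n j) k
      (-m - -s) = (∏ j, (C j / A j) ^ (m + n j)) *
      (vth q s * (q * ∏ j, A j / C j) ^ s * chiC q A C n k (m - s)) := fun s => by
    rw [show -m - -s = -(m - s) by ring, f1, f3, vth_neg hq0, mul_zpow]; ring
  have g2 : ∀ d, ∀ s : ℤ, vth q (-s) * (q * (C d)⁻¹ / (A k)⁻¹) ^ (-s) *
      chiC q (fun j => (C j)⁻¹) (fun j => (A j)⁻¹) (fun j => -n j) d (-m - -s) =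
      (∏ j, (C j / A j) ^ (m + n j)) *
      (vth q s * ((∏ j, A j / C j) * (C d / A k)) ^ s * phiC q A C n d (m - s)) := fun d s => by
    rw [show -m - -s = -(m - s) by ring, f2, f3, vth_neg hq0, mul_zpow, zpow_neg, ← inv_zpow,
      show (q * (C d)⁻¹ / (A k)⁻¹)⁻¹ = q⁻¹ * (C d / A k) by field_simp [hC d, hA k], mul_zpow,
      inv_zpow]
    have := zpow_ne_zero s hq0
    field_simp
  simp only [g1, g2, tsum_mul_left, mul_left_comm _ (∏ j, (C j / A j) ^ (m + n j)), ← mul_sum] at key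
  exact mul_left_cancel₀ hL key

end Shifted

end QConn

end

noncomputable section

namespace QConn

open Finset Filter Topology

/-! ### Laurent series in `t_i = exp τ_i` -/

section Laurent

variable {M : ℕ}

/-- The monomial `t^m`, as a function of `τ = log t`. -/
def mon (m : Fin M → ℤ) (τ : Fin M → ℂ) : ℂ := Complex.exp (∑ i, m i * τ i)

/-- The Laurent series with coefficients `C` converges absolutely at `τ`. -/
def SummableAt (C : (Fin M → ℤ) → ℂ) (τ : Fin M → ℂ) : Prop := Summable fun m => ‖C m * mon m τ‖

/-- The sum of a Laurent series. -/
def ev (C : (Fin M → ℤ) → ℂ) (τ : Fin M → ℂ) : ℂ := ∑' m, C m * mon m τ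

/-- The product of Laurent series. -/
def conv (E C : (Fin M → ℤ) → ℂ) (m : Fin M → ℤ) : ℂ := ∑' k, E k * C (m - k)

theorem mon_ne_zero (m : Fin M → ℤ) (τ : Fin M → ℂ) : mon m τ ≠ 0 := Complex.exp_ne_zero _

theorem mon_add (m k : Fin M → ℤ) (τ : Fin M → ℂ) : mon (m + k) τ = mon m τ * mon k τ := by
  rw [mon, mon, mon, ← Complex.exp_add, ← sum_add_distrib]
  simp [add_mul]

theorem mon_mul_mon_sub (m k : Fin M → ℤ) (τ : Fin M → ℂ) :
    mon k τ * mon (m - k) τ = mon m τ := by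
  rw [← mon_add, add_sub_cancel]

theorem mon_add_right (m : Fin M → ℤ) (τ τ' : Fin M → ℂ) :
    mon m (τ + τ') = mon m τ * mon m τ' := by
  rw [mon, mon, mon, ← Complex.exp_add, ← sum_add_distrib]
  simp [mul_add]

theorem norm_mon (m : Fin M → ℤ) (τ : Fin M → ℂ) :
    ‖mon m τ‖ = Real.exp (∑ i, m i * (τ i).re) := by
  rw [mon, Complex.norm_exp, Complex.re_sum]
  simp

variable {A B C E : (Fin M → ℤ) → ℂ} {τ : Fin M → ℂ}

theorem SummableAt.summable (h : SummableAt C τ) : Summable fun m => C m * mon m τ := h.of_norm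

theorem conv_comm (E C : (Fin M → ℤ) → ℂ) : conv E C = conv C E := by
  funext m
  rw [conv, conv, ← (Equiv.subLeft m).tsum_eq]
  exact tsum_congr fun k => by simp [mul_comm]

/-- The bijection `(m, k) ↦ (k, m - k)`. -/
def convEquiv (M : ℕ) : (Fin M → ℤ) × (Fin M → ℤ) ≃ (Fin M → ℤ) × (Fin M → ℤ) where
  toFun p := (p.2, p.1 - p.2)
  invFun p := (p.1 + p.2, p.1)
  left_inv p := by simp
  right_inv p := by simp

theorem SummableAt.conv_prod (hE : SummableAt E τ) (hC : SummableAt C τ) :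
    Summable fun p : (Fin M → ℤ) × (Fin M → ℤ) => ‖E p.2 * C (p.1 - p.2) * mon p.1 τ‖ := by
  have h := (convEquiv M).summable_iff.mpr (Summable.mul_norm hE hC)
  refine h.congr fun p => ?_
  simp only [Function.comp, convEquiv, Equiv.coe_fn_mk]
  rw [← mon_mul_mon_sub p.1 p.2]
  congr 1
  ring

theorem SummableAt.conv_summable (hE : SummableAt E τ) (hC : SummableAt C τ) (m : Fin M → ℤ) :
    Summable fun k => ‖E k * C (m - k)‖ := by
  have h := (hE.conv_prod hC).prod_factor m
  simp only [norm_mul _ (mon m τ)] at h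
  exact (summable_mul_right_iff (norm_ne_zero_iff.mpr (mon_ne_zero m τ))).mp h

theorem SummableAt.conv (hE : SummableAt E τ) (hC : SummableAt C τ) :
    SummableAt (conv E C) τ := by
  refine Summable.of_nonneg_of_le (fun _ => norm_nonneg _) (fun m => ?_) (hE.conv_prod hC).prod
  rw [QConn.conv, ← tsum_mul_right]
  exact norm_tsum_le_tsum_norm ((hE.conv_prod hC).prod_factor m)

theorem ev_conv (hE : SummableAt E τ) (hC : SummableAt C τ) :
    ev (conv E C) τ = ev E τ * ev C τ := by
  rw [ev, ev, ev, tsum_mul_tsum_of_summable_norm hE hC, ← (convEquiv M).tsum_eq,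
    Summable.tsum_prod]
  · refine tsum_congr fun m => ?_
    rw [conv, ← tsum_mul_right]
    refine tsum_congr fun k => ?_
    simp only [convEquiv, Equiv.coe_fn_mk]
    rw [← mon_mul_mon_sub m k]
    ring
  · refine (hE.conv_prod hC).of_norm.congr fun p => ?_
    simp only [convEquiv, Equiv.coe_fn_mk]
    rw [← mon_mul_mon_sub p.1 p.2]
    ring

/-- Products of two-sided series need not be associative formally. A common point of absolute
convergence permits interchanging the sums: the terms of `C` are bounded there, and those of the
product of `A` and `B` are summable. -/
theorem conv_assoc (hA : SummableAt A τ) (hB : SummableAt B τ) (hC : SummableAt C τ) :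
    conv (conv A B) C = conv A (conv B C) := by
  funext m
  have hbd : ∃ K : ℝ, ∀ k, ‖C k * mon k τ‖ ≤ K :=
    ⟨∑' k, ‖C k * mon k τ‖, fun k => hC.le_tsum k fun _ _ => norm_nonneg _⟩
  obtain ⟨K, hK⟩ := hbd
  have hs : Summable fun p : (Fin M → ℤ) × (Fin M → ℤ) => A p.2 * B (p.1 - p.2) * C (m - p.1) := by
    have h1 : Summable fun p : (Fin M → ℤ) × (Fin M → ℤ) =>
        A p.2 * B (p.1 - p.2) * C (m - p.1) * mon m τ := by
      refine Summable.of_norm_bounded ((hA.conv_prod hB).mul_right K) fun p => ?_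
      rw [← mon_mul_mon_sub m p.1, show A p.2 * B (p.1 - p.2) * C (m - p.1) *
        (mon p.1 τ * mon (m - p.1) τ) = (A p.2 * B (p.1 - p.2) * mon p.1 τ) *
        (C (m - p.1) * mon (m - p.1) τ) by ring, norm_mul]
      gcongr
      exact hK _
    exact (summable_mul_right_iff (mon_ne_zero m τ)).mp h1
  calc conv (conv A B) C m = ∑' k, ∑' j, A j * B (k - j) * C (m - k) := by
        rw [conv]; exact tsum_congr fun k => by rw [conv, tsum_mul_right]
    _ = ∑' j, ∑' k, A j * B (k - j) * C (m - k) :=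
        Summable.tsum_comm (f := fun j k => A j * B (k - j) * C (m - k)) hs.prod_symm
    _ = conv A (conv B C) m := by
        rw [conv]
        refine tsum_congr fun j => ?_
        rw [conv, ← tsum_mul_left, ← (Equiv.addRight j).tsum_eq]
        refine tsum_congr fun l => ?_
        simp only [Equiv.coe_addRight, add_sub_cancel_right]
        rw [mul_assoc, show m - (l + j) = m - j - l by abel]

theorem conv_left_comm (hA : SummableAt A τ) (hB : SummableAt B τ) (hC : SummableAt C τ) :
    conv A (conv B C) = conv B (conv A C) := by
  rw [← conv_assoc hA hB hC, conv_comm A B, conv_assoc hB hA hC]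

theorem SummableAt.sum {ι : Type*} {s : Finset ι} {F : ι → (Fin M → ℤ) → ℂ}
    (h : ∀ i ∈ s, SummableAt (F i) τ) : SummableAt (fun m => ∑ i ∈ s, F i m) τ := by
  refine Summable.of_nonneg_of_le (fun _ => norm_nonneg _) (fun m => ?_) (summable_sum h)
  rw [sum_mul]
  exact norm_sum_le _ _

theorem ev_sum {ι : Type*} {s : Finset ι} {F : ι → (Fin M → ℤ) → ℂ}
    (h : ∀ i ∈ s, SummableAt (F i) τ) : ev (fun m => ∑ i ∈ s, F i m) τ = ∑ i ∈ s, ev (F i) τ := by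
  simp only [ev, sum_mul]
  exact Summable.tsum_finsetSum fun i hi => (h i hi).summable

theorem conv_sum {ι : Type*} {s : Finset ι} {F : ι → (Fin M → ℤ) → ℂ} (hE : SummableAt E τ)
    (h : ∀ i ∈ s, SummableAt (F i) τ) :
    conv E (fun m => ∑ i ∈ s, F i m) = fun m => ∑ i ∈ s, conv E (F i) m := by
  funext m
  simp only [conv, mul_sum]
  exact Summable.tsum_finsetSum fun i hi => (hE.conv_summable (h i hi) m).of_norm

/-- Logarithmic convexity of the domain of convergence: `‖mon m τ‖` is the geometric mean of its
values at `τ₁` and `τ₂`, hence at most their sum. -/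
theorem SummableAt.midpoint {τ₁ τ₂ : Fin M → ℂ} (h₁ : SummableAt C τ₁) (h₂ : SummableAt C τ₂)
    (h : τ₁ + τ₂ = 2 • τ) : SummableAt C τ := by
  refine Summable.of_nonneg_of_le (fun _ => norm_nonneg _) (fun m => ?_) (h₁.add h₂)
  have h3 : ‖mon m τ‖ * ‖mon m τ‖ = ‖mon m τ₁‖ * ‖mon m τ₂‖ := by
    rw [← norm_mul, ← norm_mul, ← mon_add_right, ← mon_add_right, h, two_nsmul]
  rw [norm_mul, norm_mul, norm_mul, ← mul_add]
  gcongr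
  nlinarith [sq_nonneg (‖mon m τ₁‖ - ‖mon m τ₂‖), norm_nonneg (mon m τ), norm_nonneg (mon m τ₁),
    norm_nonneg (mon m τ₂)]

/-- The linear form `τ ↦ ∑ m_i τ_i`. -/
def linForm (m : Fin M → ℤ) : (Fin M → ℂ) →L[ℂ] ℂ :=
  ∑ i, (m i : ℂ) • ContinuousLinearMap.proj i

theorem linForm_apply (m : Fin M → ℤ) (τ : Fin M → ℂ) : linForm m τ = ∑ i, m i * τ i := by
  simp [linForm]

theorem norm_linForm_le (m : Fin M → ℤ) : ‖linForm m‖ ≤ ∑ i, (|m i| : ℝ) := by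
  refine ContinuousLinearMap.opNorm_le_bound _ (by positivity) fun τ => ?_
  rw [linForm_apply, sum_mul]
  refine (norm_sum_le _ _).trans (sum_le_sum fun i _ => ?_)
  rw [norm_mul]
  gcongr
  · simp
  · exact norm_le_pi_norm τ i

/-- Moving `τ` by `±r` in each coordinate, with the signs of the `m_i`, multiplies `‖mon m τ‖`
exactly by `exp (r ∑ |m_i|)`. There are finitely many sign patterns, so the sum over all of them is
a majorant. -/
theorem summable_exp_mul {r : ℝ} (hr : 0 ≤ r) (h : ∀ ρ : Fin M → ℂ, ‖ρ‖ ≤ r → SummableAt C (τ + ρ)) :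
    Summable fun m => ‖C m * mon m τ‖ * Real.exp (r * ∑ i, (|m i| : ℝ)) := by
  let ρ : (Fin M → Bool) → Fin M → ℂ := fun ε i => if ε i then (r : ℂ) else -r
  have hρ : ∀ ε, ‖ρ ε‖ ≤ r := fun ε => (pi_norm_le_iff_of_nonneg hr).mpr fun i => by
    simp only [ρ]; split_ifs <;> simp [abs_of_nonneg hr]
  have hs : Summable fun m => ∑ ε : Fin M → Bool, ‖C m * mon m (τ + ρ ε)‖ :=
    summable_sum fun ε _ => h (ρ ε) (hρ ε)
  refine Summable.of_nonneg_of_le (fun _ => by positivity) (fun m => ?_) hs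
  refine le_trans (le_of_eq ?_) (single_le_sum (f := fun ε => ‖C m * mon m (τ + ρ ε)‖)
    (fun _ _ => norm_nonneg _) (mem_univ fun i => decide (0 ≤ m i)))
  rw [mon_add_right, ← mul_assoc, norm_mul _ (mon m (ρ _)), norm_mon, mul_sum]
  congr 2
  refine sum_congr rfl fun i _ => ?_
  simp only [ρ, decide_eq_true_eq]
  split_ifs with hi
  · rw [abs_of_nonneg (by exact_mod_cast hi)]; simp [mul_comm]
  · rw [abs_of_neg (by exact_mod_cast not_le.mp hi)]; simp [mul_comm]

theorem hasSum_tsum_pow_div_factorial {ι : Type*} {c z : ι → ℂ} {R : ι → ℝ}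
    (hz : ∀ m, ‖z m‖ ≤ R m) (hc : Summable fun m => ‖c m‖ * Real.exp (R m)) :
    HasSum (fun n : ℕ => ∑' m, c m * (z m ^ n / n.factorial)) (∑' m, c m * Complex.exp (z m)) := by
  have hR : ∀ m, 0 ≤ R m := fun m => (norm_nonneg _).trans (hz m)
  have hexp : ∀ z : ℂ, HasSum (fun n : ℕ => z ^ n / (n.factorial : ℂ)) (Complex.exp z) := fun z => by
    simpa [Complex.exp_eq_exp_ℂ] using NormedSpace.expSeries_div_hasSum_exp z
  have hexpr : ∀ z : ℝ, HasSum (fun n : ℕ => z ^ n / (n.factorial : ℝ)) (Real.exp z) := fun z => by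
    simpa [Real.exp_eq_exp_ℝ] using NormedSpace.expSeries_div_hasSum_exp z
  have hF' : Summable fun x : ι × ℕ => ‖c x.1‖ * (R x.1 ^ x.2 / (x.2.factorial : ℝ)) := by
    rw [summable_prod_of_nonneg fun x => by
      have := hR x.1
      simp only [Pi.zero_apply]; positivity]
    refine ⟨fun m => (hexpr (R m)).summable.mul_left ‖c m‖, ?_⟩
    refine hc.congr fun m => ?_
    simp only
    rw [tsum_mul_left, (hexpr (R m)).tsum_eq]
  have hF : Summable fun x : ι × ℕ => c x.1 * (z x.1 ^ x.2 / x.2.factorial) := by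
    refine Summable.of_norm_bounded hF' fun x => ?_
    rw [norm_mul, norm_div, norm_pow, RCLike.norm_natCast]
    gcongr
    exact hz _
  have h1 := hF.hasSum
  rw [← (Equiv.prodComm ℕ ι).hasSum_iff] at h1
  have h2 := h1.prod_fiberwise fun n => (hF.prod_symm.prod_factor n).hasSum
  rw [hF.tsum_prod] at h2
  have h3 : ∑' m, c m * Complex.exp (z m) = ∑' m, ∑' n : ℕ, c m * (z m ^ n / n.factorial) :=
    tsum_congr fun m => by rw [tsum_mul_left, (hexp (z m)).tsum_eq]
  rw [h3]
  exact h2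

/-- The Taylor series at `τ` is written down: each `mon m (τ + y)` expands as `mon m τ · exp
(linForm m y)`, and the terms of degree `n` are summed over `m`. `summable_exp_mul` bounds the
coefficients by `const · r^{-n}` and justifies exchanging the two sums. -/
theorem analyticOnNhd_ev {U : Set (Fin M → ℂ)} (hU : IsOpen U) (h : ∀ τ ∈ U, SummableAt C τ) :
    AnalyticOnNhd ℂ (ev C) U := by
  intro τ hτ
  obtain ⟨ε, hε, hball⟩ := Metric.isOpen_iff.mp hU τ hτ
  obtain ⟨r, hr, hrε⟩ : ∃ r : NNReal, 0 < (r : ℝ) ∧ (r : ℝ) < ε :=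
    ⟨⟨ε / 2, by positivity⟩, half_pos hε, half_lt_self hε⟩
  let ν : (Fin M → ℤ) → ℝ := fun m => ∑ i, (|m i| : ℝ)
  have hν : ∀ m, 0 ≤ ν m := fun m => by positivity
  let g : (Fin M → ℤ) → ℝ := fun m => ‖C m * mon m τ‖ * Real.exp (r * ν m)
  have hg : Summable g := summable_exp_mul hr.le fun ρ hρ => h _ (hball (by
    rw [Metric.mem_ball, dist_eq_norm, add_sub_cancel_left]; exact hρ.trans_lt hrε))
  let w : (n : ℕ) → (Fin M → ℤ) → ContinuousMultilinearMap ℂ (fun _ : Fin n => Fin M → ℂ) ℂ :=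
    fun n m => (C m * mon m τ * (n.factorial : ℂ)⁻¹) •
      (ContinuousMultilinearMap.mkPiAlgebraFin ℂ n ℂ).compContinuousLinearMap fun _ => linForm m
  have hw : ∀ n m, ‖w n m‖ ≤ ((r : ℝ) ^ n)⁻¹ * g m := fun n m => by
    have h1 : ‖(ContinuousMultilinearMap.mkPiAlgebraFin ℂ n ℂ).compContinuousLinearMap
        fun _ => linForm m‖ ≤ ν m ^ n := by
      refine (ContinuousMultilinearMap.norm_compContinuousLinearMap_le _ _).trans ?_
      rw [ContinuousMultilinearMap.norm_mkPiAlgebraFin, one_mul, prod_const, card_univ,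
        Fintype.card_fin]
      gcongr
      exact norm_linForm_le m
    have h2 := Real.pow_div_factorial_le_exp _ (mul_nonneg hr.le (hν m)) n
    rw [norm_smul, norm_mul, norm_inv, RCLike.norm_natCast]
    calc ‖C m * mon m τ‖ * ((n.factorial : ℝ))⁻¹ * _ ≤
        ‖C m * mon m τ‖ * ((n.factorial : ℝ))⁻¹ * ν m ^ n := by gcongr
      _ = ((r : ℝ) ^ n)⁻¹ * (‖C m * mon m τ‖ * ((r * ν m) ^ n / n.factorial)) := by
        rw [mul_pow]; field_simp
      _ ≤ _ := by simp only [g]; gcongr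
  have hws : ∀ n, Summable (w n) := fun n =>
    Summable.of_norm_bounded (hg.mul_left _) (hw n)
  let p : FormalMultilinearSeries ℂ (Fin M → ℂ) ℂ := fun n => ∑' m, w n m
  have hp : ∀ n, ‖p n‖ * (r : ℝ) ^ n ≤ ∑' m, g m := fun n => by
    have := tsum_of_norm_bounded (hg.mul_left ((r : ℝ) ^ n)⁻¹).hasSum (hw n)
    rw [tsum_mul_left] at this
    calc ‖p n‖ * (r : ℝ) ^ n ≤ ((r : ℝ) ^ n)⁻¹ * (∑' m, g m) * (r : ℝ) ^ n := by gcongr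
      _ = _ := by field_simp
  refine ⟨p, r, p.le_radius_of_bound _ hp, by exact_mod_cast hr, fun {y} hy => ?_⟩
  have hy' : ‖y‖ ≤ r := by
    rw [Metric.eball_coe] at hy
    simpa using (Metric.mem_ball.mp hy).le
  have happ : ∀ n m, w n m (fun _ => y) = C m * mon m τ * ((linForm m y) ^ n / n.factorial) :=
    fun n m => by
      simp only [w, smul_apply, ContinuousMultilinearMap.compContinuousLinearMap_apply,
        ContinuousMultilinearMap.mkPiAlgebraFin_apply, List.ofFn_const, List.prod_replicate,
        smul_eq_mul]
      ring
  have hlin : ∀ m, ‖linForm m y‖ ≤ r * ν m := fun m => by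
    rw [mul_comm]
    exact ((linForm m).le_opNorm y).trans (by gcongr; exact norm_linForm_le m)
  have hpy : ∀ n, p n (fun _ => y) = ∑' m, C m * mon m τ * ((linForm m y) ^ n / n.factorial) :=
    fun n => ((ContinuousMultilinearMap.apply ℂ (fun _ : Fin n => Fin M → ℂ) ℂ
      (fun _ => y)).map_tsum (hws n)).trans (tsum_congr fun m => happ n m)
  have hev : ev C (τ + y) = ∑' m, C m * mon m τ * Complex.exp (linForm m y) := by
    rw [ev]
    refine tsum_congr fun m => ?_
    rw [mon_add_right, ← mul_assoc, linForm_apply]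
    rfl
  rw [hev, funext hpy]
  exact hasSum_tsum_pow_div_factorial hlin hg

/-- The Laurent series `∑ f_s t^{s v}` in the single monomial `t^v`. -/
def line (v : Fin M → ℤ) (f : ℤ → ℂ) : (Fin M → ℤ) → ℂ := Function.extend (fun s : ℤ => s • v) f 0

theorem line_injective {v : Fin M → ℤ} (hv : v ≠ 0) : Function.Injective fun s : ℤ => s • v :=
  smul_left_injective ℤ hv

theorem line_apply {v : Fin M → ℤ} (hv : v ≠ 0) (f : ℤ → ℂ) (s : ℤ) : line v f (s • v) = f s :=
  (line_injective hv).extend_apply f 0 s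

theorem line_eq_zero {v : Fin M → ℤ} {f : ℤ → ℂ} {m : Fin M → ℤ}
    (hm : m ∉ Set.range fun s : ℤ => s • v) : line v f m = 0 :=
  Function.extend_apply' f (0 : (Fin M → ℤ) → ℂ) m hm

theorem mon_zsmul (v : Fin M → ℤ) (τ : Fin M → ℂ) (s : ℤ) : mon (s • v) τ = mon v τ ^ s := by
  rw [mon, mon, ← Complex.exp_int_mul, mul_sum]
  simp [mul_assoc]

theorem conv_line {v : Fin M → ℤ} (hv : v ≠ 0) (f : ℤ → ℂ) (C : (Fin M → ℤ) → ℂ)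
    (m : Fin M → ℤ) : conv (line v f) C m = ∑' s : ℤ, f s * C (m - s • v) := by
  rw [conv, ← (line_injective hv).tsum_eq]
  · simp only [line_apply hv]
  · intro k hk
    by_contra h
    exact hk (by simp only [line_eq_zero h, zero_mul])

theorem summableAt_line {v : Fin M → ℤ} (hv : v ≠ 0) {f : ℤ → ℂ}
    (h : Summable fun s : ℤ => ‖f s * mon v τ ^ s‖) : SummableAt (line v f) τ := by
  rw [SummableAt, ← (line_injective hv).summable_iff]
  · simpa only [Function.comp_def, line_apply hv, mon_zsmul] using h
  · intro k hk
    simp only [line_eq_zero hk, zero_mul, norm_zero]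

theorem ev_line {v : Fin M → ℤ} (hv : v ≠ 0) (f : ℤ → ℂ) :
    ev (line v f) τ = ∑' s : ℤ, f s * mon v τ ^ s := by
  rw [ev, ← (line_injective hv).tsum_eq]
  · simp only [line_apply hv, mon_zsmul]
  · intro k hk
    by_contra h
    exact hk (by simp only [line_eq_zero h, zero_mul])

/-- The Laurent coefficients of `θ(x t^v)`, up to a constant. -/
def thetaC (q : ℂ) (v : Fin M → ℤ) (x : ℂ) : (Fin M → ℤ) → ℂ := line v fun s => vth q s * x ^ s

theorem summableAt_thetaC {q : ℂ} (hq0 : q ≠ 0) (hq : ‖q‖ < 1) {v : Fin M → ℤ} (hv : v ≠ 0) {x : ℂ}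
    (hx : x ≠ 0) (τ : Fin M → ℂ) : SummableAt (thetaC q v x) τ := by
  refine summableAt_line hv ?_
  simpa only [mul_assoc, ← mul_zpow] using
    summable_vth_mul_zpow hq0 hq (mul_ne_zero hx (mon_ne_zero v τ))

theorem ev_thetaC {q : ℂ} (hq0 : q ≠ 0) (hq : ‖q‖ < 1) {v : Fin M → ℤ} (hv : v ≠ 0) {x : ℂ}
    (hx : x ≠ 0) (τ : Fin M → ℂ) : ev (thetaC q v x) τ = qInf q q * theta q (x * mon v τ) := by
  rw [thetaC, ev_line hv, theta_eq_tsum hq0 hq (mul_ne_zero hx (mon_ne_zero v τ)),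
    mul_inv_cancel_left₀ (qInf_self_ne_zero hq)]
  exact tsum_congr fun s => by rw [mul_zpow, mul_assoc]

end Laurent

end QConn

end

noncomputable section

namespace QConn

open Finset Filter Topology

/-! ### Absolute convergence -/

section Convergence

variable {q : ℂ}

theorem exists_norm_qPoch_div_le (hq : ‖q‖ < 1) (x : ℂ) {y : ℂ} (h : ∀ k : ℕ, 1 - y * q ^ k ≠ 0) :
    ∃ K : ℝ, 0 < K ∧ ∀ n : ℕ, ‖qPoch q x n / qPoch q y n‖ ≤ K := by
  obtain ⟨δ, hδ, hy⟩ := exists_le_norm_qPoch hq h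
  refine ⟨Real.exp (‖x‖ * (1 - ‖q‖)⁻¹) / δ, by positivity, fun n => ?_⟩
  rw [norm_div]
  gcongr
  · exact norm_qPoch_le hq le_rfl n
  · exact hy n

theorem NotPow.exists_norm_qPoch_neg_div_le (hq0 : q ≠ 0) (hq : ‖q‖ < 1) {x y : ℂ} (hx0 : x ≠ 0)
    (hy0 : y ≠ 0) (hx : NotPow q x) (hy : NotPow q y) :
    ∃ K : ℝ, 0 < K ∧ ∀ n : ℕ, ‖qPoch q x (-n) / qPoch q y (-n)‖ ≤ K * ‖y / x‖ ^ n := by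
  obtain ⟨K, hK, h⟩ := exists_norm_qPoch_div_le hq (q / y) (y := q / x) fun k => by
    simpa using (hx.congr_inv (y := q / x) hq0 1 (by rw [zpow_one])).one_sub_ne hq0 k
  refine ⟨K, hK, fun n => ?_⟩
  rw [NotPow.qPoch_neg_div hq0 hq hx0 hy0 hx hy, norm_mul, zpow_natCast, norm_pow, mul_comm]
  gcongr
  exact h n

/-- `W` is bounded on `ℕ` and grows at most like `κ^n` at `-n`. -/
def BoundedGrowth (κ : ℝ) (W : ℤ → ℂ) : Prop :=
  ∃ K : ℝ, 0 < K ∧ ∀ n : ℕ, ‖W n‖ ≤ K ∧ ‖W (-n)‖ ≤ K * κ ^ n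

theorem NotPow.boundedGrowth (hq0 : q ≠ 0) (hq : ‖q‖ < 1) {x y : ℂ} (hx0 : x ≠ 0)
    (hy0 : y ≠ 0) (hx : NotPow q x) (hy : NotPow q y) :
    BoundedGrowth ‖y / x‖ fun s => qPoch q x s / qPoch q y s := by
  obtain ⟨K, hK, h⟩ := exists_norm_qPoch_div_le hq x (y := y) fun k => by
    simpa using hy.one_sub_ne hq0 k
  obtain ⟨K', hK', h'⟩ := hx.exists_norm_qPoch_neg_div_le hq0 hq hx0 hy0 hy
  refine ⟨K + K', by positivity, fun n => ⟨(h n).trans (by linarith), (h' n).trans ?_⟩⟩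
  gcongr
  linarith

theorem BoundedGrowth.prod {ι : Type*} {s : Finset ι} {κ : ι → ℝ} {W : ι → ℤ → ℂ}
    (h : ∀ i ∈ s, BoundedGrowth (κ i) (W i)) :
    BoundedGrowth (∏ i ∈ s, κ i) fun n => ∏ i ∈ s, W i n := by
  choose! K hK h using h
  refine ⟨∏ i ∈ s, K i, prod_pos hK, fun n => ⟨?_, ?_⟩⟩
  · rw [norm_prod]
    exact prod_le_prod (fun _ _ => norm_nonneg _) fun i hi => (h i hi n).1
  · rw [norm_prod, ← prod_pow, ← prod_mul_distrib]
    exact prod_le_prod (fun _ _ => norm_nonneg _) fun i hi => (h i hi n).2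

theorem summable_prod_pow {M : ℕ} {Y : Fin M → ℝ} (h0 : ∀ i, 0 ≤ Y i) (h1 : ∀ i, Y i < 1) :
    Summable fun m : Fin M → ℕ => ∏ i, Y i ^ m i := by
  induction M with
  | zero => exact Summable.of_finite
  | succ M ih =>
    have h := Summable.mul_of_nonneg (summable_geometric_of_lt_one (h0 0) (h1 0))
      (ih (Y := fun i => Y i.succ) (fun i => h0 _) fun i => h1 _) (fun n => pow_nonneg (h0 0) n)
      fun m => prod_nonneg fun i _ => pow_nonneg (h0 _) _
    rw [← (Fin.consEquiv fun _ => ℕ).summable_iff]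
    refine h.congr fun p => ?_
    simp [Fin.prod_univ_succ, Fin.consEquiv]

theorem zpow_sum₀ {ι K : Type*} [Field K] {x : K} (hx : x ≠ 0) (s : Finset ι) (f : ι → ℤ) :
    x ^ (∑ i ∈ s, f i) = ∏ i ∈ s, x ^ f i := by
  classical
  induction s using Finset.induction_on with
  | empty => simp
  | insert a s ha ih => rw [sum_insert ha, prod_insert ha, zpow_add₀ hx, ih]

/-- The weight `c^{-m(L)}` distributes over the variables and turns `X_i` into `X_i/c` for `i < L`
and `c X_i` for `i ≥ L`; the sum is a product of geometric series. -/
theorem summable_zpow_sgnSum {M : ℕ} (L : ℕ) {X : Fin M → ℝ} (hX : ∀ i, 0 < X i) {c : ℝ}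
    (hc : 0 < c) (h1 : ∀ i : Fin M, i.val < L → X i < c) (h2 : ∀ i : Fin M, L ≤ i.val → c * X i < 1) :
    Summable fun m : Fin M → ℕ => c ^ (-Params.sgnSum L m) * ∏ i, X i ^ m i := by
  have h := summable_prod_pow (Y := fun i : Fin M => if i.val < L then X i / c else c * X i)
    (fun i => by have := hX i; split_ifs <;> positivity) fun i => by
      split_ifs with hi
      · exact (div_lt_one hc).mpr (h1 i hi)
      · exact h2 i (not_lt.mp hi)
  refine h.congr fun m => ?_
  rw [Params.sgnSum, ← sum_neg_distrib, zpow_sum₀ hc.ne', ← prod_mul_distrib]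
  refine prod_congr rfl fun i _ => ?_
  split_ifs with hi
  · rw [zpow_neg, zpow_natCast, div_pow, div_eq_inv_mul]
  · rw [neg_neg, zpow_natCast, mul_pow]

/-- If `κ` itself does not exceed all `X_i` with `i < L`, a number slightly larger than the greatest
of these works; `h3` leaves the room needed for the indices `i ≥ L`. -/
theorem exists_separating {M : ℕ} (L : ℕ) {X : Fin M → ℝ} {κ : ℝ}
    (hκ : κ ≤ 1) (h1 : ∀ i : Fin M, i.val < L → X i < 1)
    (h2 : ∀ i : Fin M, L ≤ i.val → κ * X i < 1)
    (h3 : ∀ i j : Fin M, i.val < L → L ≤ j.val → X i * X j < 1) :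
    ∃ c, κ ≤ c ∧ c ≤ 1 ∧ (∀ i : Fin M, i.val < L → X i < c) ∧
      ∀ i : Fin M, L ≤ i.val → c * X i < 1 := by
  by_cases h : ∀ i : Fin M, i.val < L → X i < κ
  · exact ⟨κ, le_rfl, hκ, h, h2⟩
  push Not at h
  obtain ⟨i₁, hi₁, hk⟩ := h
  obtain ⟨i₀, hi₀, hmax⟩ := exists_max_image (univ.filter fun i : Fin M => i.val < L) X
    ⟨i₁, by simpa using hi₁⟩
  simp only [mem_filter, mem_univ, true_and] at hi₀ hmax
  have e1 : ∀ᶠ c in 𝓝[>] (X i₀), X i₀ < c := eventually_mem_nhdsWithin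
  have e2 : ∀ᶠ c in 𝓝[>] (X i₀), c < 1 :=
    nhdsWithin_le_nhds (eventually_lt_nhds (h1 i₀ hi₀))
  have e3 : ∀ᶠ c in 𝓝[>] (X i₀), ∀ j : Fin M, L ≤ j.val → c * X j < 1 := by
    refine nhdsWithin_le_nhds (eventually_all.mpr fun j => ?_)
    by_cases hj : L ≤ j.val
    · have : Tendsto (fun c => c * X j) (𝓝 (X i₀)) (𝓝 (X i₀ * X j)) := tendsto_id.mul_const _
      filter_upwards [this.eventually (eventually_lt_nhds (h3 i₀ j hi₀ hj))] with c hc _ using hc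
    · exact Eventually.of_forall fun c h => absurd h hj
  obtain ⟨c, hc1, hc2, hc3⟩ := (e1.and (e2.and e3)).exists
  exact ⟨c, (hk.trans (hmax i₁ hi₁)).trans hc1.le, hc2.le, fun i hi => (hmax i hi).trans_lt hc1, hc3⟩

/-- For `κ ≤ 1` one has `‖W s‖ ≤ K c^{-s}` for every `c` with `κ ≤ c ≤ 1`, on positive and on
negative `s`; `exists_separating` chooses a `c` for which `summable_zpow_sgnSum` applies. -/
theorem summable_of_growth {M : ℕ} (L : ℕ) {X : Fin M → ℝ} (hX : ∀ i, 0 < X i) {κ : ℝ} (hκ : 0 < κ)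
    (h1 : ∀ i : Fin M, i.val < L → X i < 1) (h2 : ∀ i : Fin M, L ≤ i.val → κ * X i < 1)
    (h3 : ∀ i j : Fin M, i.val < L → L ≤ j.val → X i * X j < 1) {W : ℤ → ℂ}
    (hW : BoundedGrowth κ W) {c : ℝ} {f : (Fin M → ℕ) → ℂ}
    (hf : ∀ m, ‖f m‖ ≤ c * ‖W (Params.sgnSum L m)‖ * ∏ i, X i ^ m i) : Summable f := by
  obtain ⟨K, hK, hW⟩ := hW
  have hprod : ∀ m : Fin M → ℕ, 0 ≤ ∏ i, X i ^ m i := fun m =>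
    prod_nonneg fun i _ => pow_nonneg (hX i).le _
  have hf' : ∀ m, ‖f m‖ ≤ |c| * (‖W (Params.sgnSum L m)‖ * ∏ i, X i ^ m i) := fun m =>
    (hf m).trans (by
      rw [mul_assoc]
      exact mul_le_mul_of_nonneg_right (le_abs_self c) (mul_nonneg (norm_nonneg _) (hprod m)))
  refine Summable.of_norm_bounded (Summable.mul_left |c| ?_) hf'
  rcases le_or_gt κ 1 with hκ1 | hκ1
  · obtain ⟨d, hd1, hd2, hd3, hd4⟩ := exists_separating L hκ1 h1 h2 h3
    have hd0 : 0 < d := hκ.trans_le hd1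
    refine Summable.of_nonneg_of_le (fun m => mul_nonneg (norm_nonneg _) (hprod m)) (fun m => ?_)
      ((summable_zpow_sgnSum L hX hd0 hd3 hd4).mul_left K)
    rw [← mul_assoc]
    refine mul_le_mul_of_nonneg_right ?_ (hprod m)
    obtain ⟨n, hn | hn⟩ := (Params.sgnSum L m).eq_nat_or_neg <;> rw [hn]
    · refine (hW n).1.trans (le_mul_of_one_le_right hK.le ?_)
      rw [zpow_neg, zpow_natCast]
      exact (one_le_inv₀ (by positivity)).mpr (pow_le_one₀ hd0.le hd2)
    · refine (hW n).2.trans ?_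
      rw [neg_neg, zpow_natCast]
      gcongr
  -- For `κ > 1` a single weight is not used: `‖W s‖ ≤ K (1 + κ^{-s})`, and the weights `c = 1` and
  -- `c = κ` both give convergent series.
  · have s1 := summable_zpow_sgnSum L hX one_pos h1 fun i hi => by
      have := h2 i hi
      nlinarith [hX i]
    have s2 := summable_zpow_sgnSum L hX hκ (fun i hi => (h1 i hi).trans hκ1) h2
    refine Summable.of_nonneg_of_le (fun m => mul_nonneg (norm_nonneg _) (hprod m)) (fun m => ?_)
      ((s1.add s2).mul_left K)
    rw [← add_mul, ← mul_assoc]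
    refine mul_le_mul_of_nonneg_right ?_ (hprod m)
    rw [one_zpow]
    obtain ⟨n, hn | hn⟩ := (Params.sgnSum L m).eq_nat_or_neg <;> rw [hn]
    · refine (hW n).1.trans (le_mul_of_one_le_right hK.le ?_)
      have : 0 < κ ^ (-(n : ℤ)) := zpow_pos hκ _
      linarith
    · refine (hW n).2.trans ?_
      rw [neg_neg, zpow_natCast]
      gcongr
      linarith

end Convergence

end QConn

end

noncomputable section

namespace QConn

open Finset Filter Topology

namespace Params

variable {N M : ℕ} (P : Params N M)

/-! ### Parameters and genericity -/

theorem q_ne_zero : P.q ≠ 0 := Complex.exp_ne_zero _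

theorem qPow_ne_zero (z : ℂ) : P.qPow z ≠ 0 := Complex.exp_ne_zero _

theorem a_ne_zero (j : Fin N) : P.a j ≠ 0 := P.qPow_ne_zero _

theorem b_ne_zero (i : Fin M) : P.b i ≠ 0 := P.qPow_ne_zero _

theorem c_ne_zero (j : Fin N) : P.c j ≠ 0 := P.qPow_ne_zero _

theorem bTail_ne_zero (L : ℕ) : P.bTail L ≠ 0 := prod_ne_zero_iff.mpr fun i _ => P.b_ne_zero i

theorem ac_ne_zero : P.ac ≠ 0 := div_ne_zero (prod_ne_zero_iff.mpr fun j _ => P.a_ne_zero j)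
  (prod_ne_zero_iff.mpr fun j _ => P.c_ne_zero j)

theorem filter_le_eq_insert (l : Fin M) : (univ.filter fun i : Fin M => l.val ≤ i.val) =
    insert l (univ.filter fun i : Fin M => l.val + 1 ≤ i.val) := by
  ext i
  simp only [mem_filter, mem_univ, true_and, mem_insert, Fin.ext_iff]
  omega

theorem bTail_eq_mul (l : Fin M) : P.bTail l = P.b l * P.bTail (l + 1) := by
  rw [bTail, bTail, filter_le_eq_insert, prod_insert (by simp)]

theorem βTail_eq_add (l : Fin M) : P.βTail l = P.β l + P.βTail (l + 1) := by
  rw [βTail, βTail, filter_le_eq_insert, sum_insert (by simp)]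

theorem bTail_of_le {L : ℕ} (h : M ≤ L) : P.bTail L = 1 := by
  rw [bTail, filter_eq_empty_iff.mpr fun {i} _ => by have := i.isLt; omega, prod_empty]

@[simp] theorem perm_q (σ : Equiv.Perm (Fin M)) : (P.perm σ).q = P.q := rfl

@[simp] theorem perm_a (σ : Equiv.Perm (Fin M)) : (P.perm σ).a = P.a := rfl

@[simp] theorem perm_c (σ : Equiv.Perm (Fin M)) : (P.perm σ).c = P.c := rfl

@[simp] theorem perm_b (σ : Equiv.Perm (Fin M)) (i : Fin M) : (P.perm σ).b i = P.b (σ i) := rfl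

variable {P}

theorem Generic.a_div_a (h : P.Generic) {j k : Fin N} (hjk : j ≠ k) : NotPow P.q (P.a j / P.a k) :=
  fun n => (h.1 j k hjk n).1

theorem Generic.c_div_c (h : P.Generic) {j k : Fin N} (hjk : j ≠ k) : NotPow P.q (P.c j / P.c k) :=
  fun n => (h.1 j k hjk n).2

theorem Generic.a_div_bTail (h : P.Generic) (j : Fin N) (L : ℕ) :
    NotPow P.q (P.a j / P.bTail L) := fun n => by
  rcases le_total L M with hL | hL
  · exact (h.2 L hL j n).1
  · rw [P.bTail_of_le hL, ← P.bTail_of_le le_rfl]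
    exact (h.2 M le_rfl j n).1

theorem Generic.c_div_bTail (h : P.Generic) (j : Fin N) (L : ℕ) :
    NotPow P.q (P.c j / P.bTail L) := fun n => by
  rcases le_total L M with hL | hL
  · exact (h.2 L hL j n).2
  · rw [P.bTail_of_le hL, ← P.bTail_of_le le_rfl]
    exact (h.2 M le_rfl j n).2

variable (P)

/-! ### Laurent coefficients of the local solutions -/

/-- The factor of the Laurent coefficients which belongs to the variable `t_i`. -/
def wt (L : ℕ) (i : Fin M) (e : ℤ) : ℂ :=
  if i.val < L then qPoch P.q (P.b i) e / qPoch P.q P.q e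
  else qPoch P.q (P.b i) (-e) / qPoch P.q P.q (-e) * (P.b i / P.q) ^ e

/-- The Laurent coefficients of `𝓕^L`. -/
def coefF₀ (L : ℕ) (e : Fin M → ℤ) : ℂ :=
  (∏ j, qPoch P.q (P.a j / P.bTail L) (∑ i, e i) / qPoch P.q (P.c j / P.bTail L) (∑ i, e i)) *
    ∏ i, P.wt L i (e i)

/-- The Laurent coefficients of `𝓖^{L;k,l}`. -/
def coefG (k : Fin N) (l : Fin M) (e : Fin M → ℤ) : ℂ :=
  (∏ j, qPoch P.q (P.q * P.a j / P.c k) (∑ i, e i) / qPoch P.q (P.q * P.c j / P.c k) (∑ i, e i)) *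
  (qPoch P.q (P.q * P.bTail l / P.c k) (e l) / qPoch P.q (P.q ^ 2 * P.bTail (l + 1) / P.c k) (e l)) *
  ∏ i ∈ univ.erase l, P.wt l i (e i)

/-- The Laurent coefficients of `𝓕^{L;k,l}`. -/
def coefF (k : Fin N) (l : Fin M) (e : Fin M → ℤ) : ℂ :=
  (∏ j, qPoch P.q (P.q * P.a k / P.c j) (-∑ i, e i) /
    qPoch P.q (P.q * P.a k / P.a j) (-∑ i, e i) * (P.c j / P.a j) ^ (-∑ i, e i)) *
  (qPoch P.q (P.a k / P.bTail (l + 1)) (-e l) / qPoch P.q (P.q * P.a k / P.bTail l) (-e l) *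
    (P.b l / P.q) ^ e l) *
  ∏ i ∈ univ.erase l, P.wt l i (e i)

/-- The Laurent coefficients of the series in `u^{L,id}`. -/
def coef (L : ℕ) : Idx N M → (Fin M → ℤ) → ℂ
  | none => P.coefF₀ L
  | some (k, l) => if l.val < L then P.coefG k l else P.coefF k l

/-- The non-integral powers in front of the series in `u^{L,id}`. -/
def pre (L : ℕ) (τ : Fin M → ℂ) : Idx N M → ℂ
  | none => P.tailPow L τ
  | some (k, l) =>
    (if l.val < L then Complex.exp ((1 + P.βTail (l + 1) - P.γ k) * τ l)
      else Complex.exp ((-P.α k + P.βTail (l + 1)) * τ l)) * P.tailPow (l + 1) τ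

theorem wt_eq_zero_of_lt {L : ℕ} {i : Fin M} (hi : i.val < L) {e : ℤ} (he : e < 0) :
    P.wt L i e = 0 := by
  rw [wt, if_pos hi, qPoch_self_of_neg P.q_ne_zero he, div_zero]

theorem wt_eq_zero_of_le {L : ℕ} {i : Fin M} (hi : L ≤ i.val) {e : ℤ} (he : 0 < e) :
    P.wt L i e = 0 := by
  rw [wt, if_neg (not_lt.mpr hi), qPoch_self_of_neg P.q_ne_zero (by omega), div_zero, zero_mul]

theorem mon_eq_prod (e : Fin M → ℤ) (τ : Fin M → ℂ) : mon e τ = ∏ i, Complex.exp (τ i) ^ e i := by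
  rw [mon, Complex.exp_sum]
  exact prod_congr rfl fun i _ => Complex.exp_int_mul _ _

/-- Comparison of a series over `ℕ^M` with the Laurent series of its terms. -/
theorem summable_iff_and_tsum_eq {T : (Fin M → ℕ) → ℂ} {C : (Fin M → ℤ) → ℂ} {τ : Fin M → ℂ}
    {f : (Fin M → ℕ) → Fin M → ℤ} (hf : Function.Injective f) (hT : ∀ m, T m = C (f m) * mon (f m) τ)
    (h0 : ∀ e, e ∉ Set.range f → C e = 0) :
    (Summable T ↔ SummableAt C τ) ∧ ∑' m, T m = ev C τ := by
  have hmon : ∀ e, e ∉ Set.range f → C e * mon e τ = 0 := fun e he => by rw [h0 e he, zero_mul]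
  constructor
  · rw [SummableAt, summable_norm_iff, ← hf.summable_iff hmon]
    exact iff_of_eq (congrArg Summable (funext hT))
  · rw [ev, ← hf.tsum_eq, tsum_congr hT]
    exact fun e he => by_contra fun h => he (hmon e h)

/-- The exponents of the term of index `m` of `𝓕^L`. -/
def signed (L : ℕ) (m : Fin M → ℕ) (i : Fin M) : ℤ := if i.val < L then (m i : ℤ) else -(m i : ℤ)

theorem signed_injective (L : ℕ) : Function.Injective (signed (M := M) L) := fun m m' h => by
  funext i
  have := congrFun h i
  simp only [signed] at this
  split_ifs at this <;> omega

theorem wt_signed (L : ℕ) (m : Fin M → ℕ) (i : Fin M) (T : ℂ) :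
    P.wt L i (signed L m i) * T ^ (signed L m i) =
      qPoch P.q (P.b i) (m i) / qPoch P.q P.q (m i) *
        (if i.val < L then T else P.q / (P.b i * T)) ^ m i := by
  rw [wt, signed]
  split_ifs with hi
  · rw [zpow_natCast]
  · rw [neg_neg, mul_assoc, ← mul_zpow, zpow_neg, zpow_natCast, ← inv_pow, inv_eq_one_div]
    congr 2
    have := P.q_ne_zero
    rcases eq_or_ne T 0 with h | h
    · simp [h]
    · field_simp [P.b_ne_zero i]

theorem termF₀_eq (L : ℕ) (τ : Fin M → ℂ) (m : Fin M → ℕ) :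
    P.termF₀ L τ m = P.coefF₀ L (signed L m) * mon (signed L m) τ := by
  rw [termF₀, coefF₀, mon_eq_prod, mul_assoc, mul_assoc, ← prod_mul_distrib, ← prod_mul_distrib]
  simp only [wt_signed]
  rfl

theorem coefF₀_eq_zero {L : ℕ} {e : Fin M → ℤ} (he : e ∉ Set.range (signed (M := M) L)) :
    P.coefF₀ L e = 0 := by
  by_contra h
  apply he
  have hw : ∀ i, P.wt L i (e i) ≠ 0 := fun i hi => h (by
    rw [coefF₀, prod_eq_zero (mem_univ i) hi, mul_zero])
  refine ⟨fun i => (e i).natAbs, funext fun i => ?_⟩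
  simp only [signed]
  split_ifs with hi
  · have : 0 ≤ e i := not_lt.mp fun h => hw i (P.wt_eq_zero_of_lt hi h)
    omega
  · have : e i ≤ 0 := not_lt.mp fun h => hw i (P.wt_eq_zero_of_le (not_lt.mp hi) h)
    omega

/-- The exponents of the term of index `m` of `𝓖^{L;k,l}` (`ε = 1`) and `𝓕^{L;k,l}` (`ε = -1`). -/
def pivoted (ε : ℤ) (l : Fin M) (m : Fin M → ℕ) : Fin M → ℤ :=
  Function.update (signed l m) l (ε * m l - ∑ i ∈ univ.erase l, signed l m i)

theorem pivoted_of_ne (ε : ℤ) {l i : Fin M} (hi : i ≠ l) (m : Fin M → ℕ) :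
    pivoted ε l m i = signed l m i := Function.update_of_ne hi _ _

theorem pivoted_self (ε : ℤ) (l : Fin M) (m : Fin M → ℕ) :
    pivoted ε l m l = ε * m l - ∑ i ∈ univ.erase l, signed l m i := Function.update_self _ _ _

/-- In these series `t_l` occurs in the monomial of every index, so its exponent mixes all the
`m_i`. The total degree isolates `m_l`, and this makes the map from indices to exponents injective.
-/
theorem sum_pivoted (ε : ℤ) (l : Fin M) (m : Fin M → ℕ) : ∑ i, pivoted ε l m i = ε * m l := by
  rw [← add_sum_erase _ _ (mem_univ l), pivoted_self,
    sum_congr rfl fun i hi => pivoted_of_ne ε (ne_of_mem_erase hi) m, sub_add_cancel]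

theorem sgnSum_eq (l : Fin M) (m : Fin M → ℕ) :
    sgnSum l m = ∑ i ∈ univ.erase l, signed l m i - m l := by
  rw [sgnSum, ← add_sum_erase _ _ (mem_univ l), if_neg (lt_irrefl _)]
  simp only [signed]
  ring

theorem sgnSum_succ_eq (l : Fin M) (m : Fin M → ℕ) :
    sgnSum (l + 1) m = ∑ i ∈ univ.erase l, signed l m i + m l := by
  rw [sgnSum, ← add_sum_erase _ _ (mem_univ l), if_pos (Nat.lt_succ_self _), add_comm]
  congr 1
  refine sum_congr rfl fun i hi => ?_
  have : i.val ≠ l.val := fun h => ne_of_mem_erase hi (Fin.ext h)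
  simp only [signed]
  split_ifs <;> omega

theorem pivoted_injective {ε : ℤ} (hε : ε ≠ 0) (l : Fin M) :
    Function.Injective (pivoted ε l) := fun m m' h => by
  funext i
  by_cases hi : i = l
  · have := congrArg (fun e => ∑ i, e i) h
    simp only [sum_pivoted] at this
    rw [hi]
    exact_mod_cast mul_left_cancel₀ hε this
  · have := congrFun h i
    rw [pivoted_of_ne ε hi, pivoted_of_ne ε hi, signed, signed] at this
    split_ifs at this <;> omega

/-- Nonvanishing of the weights forces the right sign of each exponent `e_i`, `i ≠ l`, and the total
degree supplies `m_l`. -/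
theorem mem_range_pivoted {ε : ℤ} (hε : ε * ε = 1) {l : Fin M} {e : Fin M → ℤ}
    (hw : ∀ i ≠ l, P.wt l i (e i) ≠ 0) (hl : 0 ≤ ε * ∑ i, e i) : e ∈ Set.range (pivoted ε l) := by
  refine ⟨fun i => if i = l then (ε * ∑ i, e i).toNat else (e i).natAbs, ?_⟩
  have h1 : ∀ i ≠ l, signed l (fun i => if i = l then (ε * ∑ i, e i).toNat else (e i).natAbs) i =
      e i := fun i hi => by
    simp only [signed, if_neg hi]
    split_ifs with h
    · have : 0 ≤ e i := not_lt.mp fun h' => hw i hi (P.wt_eq_zero_of_lt h h')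
      omega
    · have : e i ≤ 0 := not_lt.mp fun h' => hw i hi (P.wt_eq_zero_of_le (not_lt.mp h) h')
      omega
  funext i
  by_cases hi : i = l
  · subst hi
    rw [pivoted_self, sum_congr rfl fun j hj => h1 j (ne_of_mem_erase hj), if_pos rfl,
      Int.toNat_of_nonneg hl, ← mul_assoc, hε, one_mul, ← add_sum_erase _ _ (mem_univ i)]
    ring
  · rw [pivoted_of_ne ε hi, h1 i hi]

theorem prod_lt_mul_prod_gt (l : Fin M) (f g : Fin M → ℂ) :
    (∏ i with i < l, f i) * ∏ i with l < i, g i =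
      ∏ i ∈ univ.erase l, if i.val < l.val then f i else g i := by
  rw [← filter_ne', prod_ite, filter_filter, filter_filter]
  congr 1
  · refine prod_congr (Finset.ext fun i => ?_) fun _ _ => rfl
    simp only [mem_filter, mem_univ, true_and, Fin.lt_def, ne_eq, Fin.ext_iff]
    omega
  · refine prod_congr (Finset.ext fun i => ?_) fun _ _ => rfl
    simp only [mem_filter, mem_univ, true_and, Fin.lt_def, ne_eq, Fin.ext_iff]
    omega

/-- The monomials in the terms of `𝓖^{L;k,l}` and `𝓕^{L;k,l}`. -/
theorem pivoted_monomial (ε : ℤ) (l : Fin M) (τ : Fin M → ℂ) (m : Fin M → ℕ) :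
    (∏ i with i ≠ l, qPoch P.q (P.b i) (m i) / qPoch P.q P.q (m i)) *
      (∏ i with i < l, (P.q * Complex.exp (τ i) / (P.b l * Complex.exp (τ l))) ^ m i) *
      (∏ i with l < i, (P.b l * Complex.exp (τ l) / (P.b i * Complex.exp (τ i))) ^ m i) *
      (P.b l * Complex.exp (τ l) / P.q) ^ (ε * m l) =
    (∏ i ∈ univ.erase l, P.wt l i (pivoted ε l m i)) * (P.b l / P.q) ^ (pivoted ε l m l) *
      mon (pivoted ε l m) τ := by
  have hq := P.q_ne_zero
  have hX : P.b l * Complex.exp (τ l) / P.q ≠ 0 :=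
    div_ne_zero (mul_ne_zero (P.b_ne_zero l) (Complex.exp_ne_zero _)) hq
  -- The definition of the pivot exponent splits this power into the part belonging to `t_l` and one
  -- factor for each other variable, which cancels the `t_l` in the monomial of that variable.
  have hXl : (P.b l * Complex.exp (τ l) / P.q) ^ (ε * m l) =
      (P.b l * Complex.exp (τ l) / P.q) ^ (pivoted ε l m l) *
        ∏ i ∈ univ.erase l, (P.b l * Complex.exp (τ l) / P.q) ^ signed l m i := by
    rw [← zpow_sum₀ hX, ← zpow_add₀ hX, pivoted_self, sub_add_cancel]
  have hpt : ∀ i ∈ univ.erase l, qPoch P.q (P.b i) (m i) / qPoch P.q P.q (m i) *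
      (if i.val < l.val then (P.q * Complex.exp (τ i) / (P.b l * Complex.exp (τ l))) ^ m i
        else (P.b l * Complex.exp (τ l) / (P.b i * Complex.exp (τ i))) ^ m i) *
      (P.b l * Complex.exp (τ l) / P.q) ^ signed l m i =
      P.wt l i (pivoted ε l m i) * Complex.exp (τ i) ^ pivoted ε l m i := fun i hi => by
    have hb := P.b_ne_zero l
    have hb' := P.b_ne_zero i
    have hT := Complex.exp_ne_zero (τ i)
    have hT' := Complex.exp_ne_zero (τ l)
    rw [pivoted_of_ne ε (ne_of_mem_erase hi), wt_signed, mul_assoc, signed]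
    congr 1
    split_ifs with h
    · rw [zpow_natCast, ← mul_pow]
      congr 1
      field_simp
    · rw [zpow_neg, zpow_natCast, ← inv_pow, ← mul_pow]
      congr 1
      field_simp
  rw [mul_assoc (∏ i with i ≠ l, _), prod_lt_mul_prod_gt, filter_ne', hXl, mon_eq_prod,
    ← mul_prod_erase univ _ (mem_univ l), mul_left_comm, ← prod_mul_distrib, ← prod_mul_distrib,
    prod_congr rfl hpt, prod_mul_distrib, mul_div_right_comm, mul_zpow]
  ring

variable {P}

theorem Generic.q_mul_c_div_c (h : P.Generic) (k j : Fin N) (n : ℕ) (hq : ‖P.q‖ < 1) :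
    1 - P.q * P.c j / P.c k * P.q ^ n ≠ 0 := by
  by_cases hjk : j = k
  · rw [hjk, mul_div_cancel_right₀ _ (P.c_ne_zero k)]
    exact one_sub_pow_succ_ne hq n
  · simpa using ((h.c_div_c hjk).congr_mul P.q_ne_zero (mul_div_assoc _ _ _)).one_sub_ne P.q_ne_zero n

theorem Generic.q_mul_a_div_a (h : P.Generic) (k j : Fin N) (n : ℕ) (hq : ‖P.q‖ < 1) :
    1 - P.q * P.a k / P.a j * P.q ^ n ≠ 0 := by
  by_cases hjk : k = j
  · rw [hjk, mul_div_cancel_right₀ _ (P.a_ne_zero j)]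
    exact one_sub_pow_succ_ne hq n
  · simpa using ((h.a_div_a hjk).congr_mul P.q_ne_zero (mul_div_assoc _ _ _)).one_sub_ne P.q_ne_zero n

theorem Generic.c_div_q_mul_bTail (h : P.Generic) (j : Fin N) (L : ℕ) :
    NotPow P.q (P.c j / (P.q * P.bTail L)) :=
  (h.c_div_bTail j L).congr_zpow P.q_ne_zero (-1) (by rw [zpow_neg_one, mul_comm P.q]; field_simp)

theorem Generic.q_mul_a_div_bTail (h : P.Generic) (j : Fin N) (L : ℕ) :
    NotPow P.q (P.q * P.a j / P.bTail L) :=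
  (h.a_div_bTail j L).congr_mul P.q_ne_zero (mul_div_assoc _ _ _)

/-- The exponent of `t_l` is `-m(l-1)` in the notation of the series, so the corresponding quotient
of factorials has to be reflected to match `coefG`; this is where genericity enters. The series
`𝓕^{L;k,l}` needs no reflection. -/
theorem termG_eq (hq : ‖P.q‖ < 1) (h : P.Generic) (k : Fin N) (l : Fin M) (τ : Fin M → ℂ)
    (m : Fin M → ℕ) :
    P.termG k l τ m = P.coefG k l (pivoted 1 l m) * mon (pivoted 1 l m) τ := by
  have hq0 := P.q_ne_zero
  have hb := P.b_ne_zero l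
  have hb' := P.bTail_ne_zero (l + 1)
  have hc := P.c_ne_zero k
  have key := P.pivoted_monomial 1 l τ m
  have hs : sgnSum l m = -pivoted 1 l m l := by rw [sgnSum_eq, pivoted_self]; ring
  have hr := NotPow.qPoch_neg_div hq0 hq (div_ne_zero hc (mul_ne_zero hq0 hb'))
    (div_ne_zero hc (P.bTail_ne_zero l)) (h.c_div_q_mul_bTail k (l + 1)) (h.c_div_bTail k l)
    (pivoted 1 l m l)
  rw [show P.c k / P.bTail l / (P.c k / (P.q * P.bTail (l + 1))) = (P.b l / P.q)⁻¹ by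
      rw [bTail_eq_mul]; field_simp,
    show P.q / (P.c k / P.bTail l) = P.q * P.bTail l / P.c k by rw [div_div_eq_mul_div],
    show P.q / (P.c k / (P.q * P.bTail (l + 1))) = P.q ^ 2 * P.bTail (l + 1) / P.c k by
      rw [div_div_eq_mul_div]; ring] at hr
  rw [one_mul, zpow_natCast] at key
  have hz : (P.b l / P.q) ^ (pivoted 1 l m l) ≠ 0 := zpow_ne_zero _ (div_ne_zero hb hq0)
  rw [termG, coefG, hs, hr, sum_pivoted, one_mul, inv_zpow]
  have : ∀ x₁ x₂ x₃ x₄ x₅ x₆ : ℂ, x₁ * x₂ * x₃ * x₄ * x₅ * x₆ = x₁ * x₃ * (x₂ * x₄ * x₅ * x₆) :=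
    fun _ _ _ _ _ _ => by ring
  rw [this, key]
  field_simp

theorem termF_eq (k : Fin N) (l : Fin M) (τ : Fin M → ℂ) (m : Fin M → ℕ) :
    P.termF k l τ m = P.coefF k l (pivoted (-1) l m) * mon (pivoted (-1) l m) τ := by
  have hq0 := P.q_ne_zero
  have hb := P.b_ne_zero l
  have key := P.pivoted_monomial (-1) l τ m
  have hs : sgnSum (l + 1) m = -pivoted (-1) l m l := by rw [sgnSum_succ_eq, pivoted_self]; ring
  rw [neg_one_mul, zpow_neg, zpow_natCast, ← inv_pow, inv_div] at key
  rw [termF, coefF, hs, sum_pivoted, neg_one_mul, neg_neg, mul_pow, prod_mul_distrib]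
  simp only [zpow_natCast]
  rw [prod_pow]
  have : ∀ x₁ x₂ x₃ x₄ x₅ x₆ x₇ : ℂ, x₁ * x₂ * x₃ * x₄ * x₅ * (x₆ * x₇) =
      x₁ * x₃ * x₆ * (x₂ * x₄ * x₅ * x₇) := fun _ _ _ _ _ _ _ => by ring
  rw [this, key]
  ring

theorem coefG_eq_zero {k : Fin N} {l : Fin M} {e : Fin M → ℤ}
    (he : e ∉ Set.range (pivoted (M := M) 1 l)) : P.coefG k l e = 0 := by
  by_contra h
  refine he (P.mem_range_pivoted (by norm_num) (fun i hi h0 => h ?_) ?_)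
  · rw [coefG, prod_eq_zero (mem_erase.mpr ⟨hi, mem_univ i⟩) h0, mul_zero]
  · by_contra hneg
    refine h ?_
    rw [coefG, prod_eq_zero (mem_univ k), zero_mul, zero_mul]
    rw [mul_div_cancel_right₀ _ (P.c_ne_zero k), qPoch_self_of_neg P.q_ne_zero (by omega), div_zero]

theorem coefF_eq_zero {k : Fin N} {l : Fin M} {e : Fin M → ℤ}
    (he : e ∉ Set.range (pivoted (M := M) (-1) l)) : P.coefF k l e = 0 := by
  by_contra h
  refine he (P.mem_range_pivoted (by norm_num) (fun i hi h0 => h ?_) ?_)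
  · rw [coefF, prod_eq_zero (mem_erase.mpr ⟨hi, mem_univ i⟩) h0, mul_zero]
  · by_contra hneg
    refine h ?_
    rw [coefF, prod_eq_zero (mem_univ k), zero_mul, zero_mul]
    rw [mul_div_cancel_right₀ _ (P.a_ne_zero k), qPoch_self_of_neg P.q_ne_zero (by omega), div_zero,
      zero_mul]

theorem summable_termF₀_iff (L : ℕ) (τ : Fin M → ℂ) :
    (Summable (P.termF₀ L τ) ↔ SummableAt (P.coefF₀ L) τ) ∧
      ∑' m, P.termF₀ L τ m = ev (P.coefF₀ L) τ :=
  summable_iff_and_tsum_eq (signed_injective L) (P.termF₀_eq L τ) fun _ he => P.coefF₀_eq_zero he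

theorem summable_termG_iff (hq : ‖P.q‖ < 1) (h : P.Generic) (k : Fin N) (l : Fin M)
    (τ : Fin M → ℂ) :
    (Summable (P.termG k l τ) ↔ SummableAt (P.coefG k l) τ) ∧
      ∑' m, P.termG k l τ m = ev (P.coefG k l) τ :=
  summable_iff_and_tsum_eq (pivoted_injective one_ne_zero l) (termG_eq hq h k l τ)
    fun _ he => coefG_eq_zero he

theorem summable_termF_iff (k : Fin N) (l : Fin M) (τ : Fin M → ℂ) :
    (Summable (P.termF k l τ) ↔ SummableAt (P.coefF k l) τ) ∧
      ∑' m, P.termF k l τ m = ev (P.coefF k l) τ :=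
  summable_iff_and_tsum_eq (pivoted_injective (by norm_num) l) (termF_eq k l τ)
    fun _ he => coefF_eq_zero he

theorem uId_eq (hq : ‖P.q‖ < 1) (h : P.Generic) (L : ℕ) (τ : Fin M → ℂ) (ι : Idx N M) :
    P.uId L τ ι = P.pre L τ ι * ev (P.coef L ι) τ := by
  match ι with
  | none => rw [uId, pre, coef, (summable_termF₀_iff L τ).2]
  | some (k, l) =>
    simp only [uId, pre, coef]
    split_ifs
    · rw [(summable_termG_iff hq h k l τ).2]
    · rw [(summable_termF_iff k l τ).2]

theorem convergesId_iff (hq : ‖P.q‖ < 1) (h : P.Generic) (L : ℕ) (τ : Fin M → ℂ) :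
    P.ConvergesId L τ ↔ ∀ ι, SummableAt (P.coef L ι) τ := by
  rw [ConvergesId, (summable_termF₀_iff L τ).1]
  refine ⟨fun hc ι => ?_, fun hc => ⟨hc none, fun k l => ⟨fun hl => ?_, fun hl => ?_⟩⟩⟩
  · match ι with
    | none => exact hc.1
    | some (k, l) =>
      simp only [coef]
      split_ifs with hl
      · exact (summable_termG_iff hq h k l τ).1.mp ((hc.2 k l).1 hl)
      · exact (summable_termF_iff k l τ).1.mp ((hc.2 k l).2 (not_lt.mp hl))
  · have := hc (some (k, l))
    rw [coef, if_pos hl] at this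
    exact (summable_termG_iff hq h k l τ).1.mpr this
  · have := hc (some (k, l))
    rw [coef, if_neg (not_lt.mpr hl)] at this
    exact (summable_termF_iff k l τ).1.mpr this

/-! ### Convergence on the regions -/

theorem exists_norm_prod_qPoch_le {ι : Type*} {q : ℂ} (hq : ‖q‖ < 1) (s : Finset ι) (x y : ι → ℂ)
    (h : ∀ i ∈ s, ∀ k : ℕ, 1 - y i * q ^ k ≠ 0) :
    ∃ K : ℝ, 0 < K ∧ ∀ m : ι → ℕ, ‖∏ i ∈ s, qPoch q (x i) (m i) / qPoch q (y i) (m i)‖ ≤ K := by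
  choose! K hK h using fun i (hi : i ∈ s) => exists_norm_qPoch_div_le hq (x i) (h i hi)
  refine ⟨∏ i ∈ s, K i, prod_pos hK, fun m => ?_⟩
  rw [norm_prod]
  exact prod_le_prod (fun _ _ => norm_nonneg _) fun i hi => h i hi (m i)

/-- The growth rate at negative degree is `κ = ∏_j |c_j/a_j|`, so `κ X_i < 1` is the second
inequality defining the region, and the products `X_i X_j` are covered by the third. -/
theorem summable_termF₀ (hq : ‖P.q‖ < 1) (h : P.Generic) {L : ℕ} {τ : Fin M → ℂ}
    (hτ : τ ∈ P.region L 1) : Summable (P.termF₀ L τ) := by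
  have hq0 := P.q_ne_zero
  obtain ⟨h1, h2, h3⟩ := hτ
  simp only [Equiv.Perm.coe_one, id_eq] at h1 h2 h3
  obtain ⟨K, hK, hb⟩ := exists_norm_prod_qPoch_le hq univ P.b (fun _ => P.q)
    fun _ _ => one_sub_pow_succ_ne hq
  have hW := BoundedGrowth.prod (s := univ) fun j _ => NotPow.boundedGrowth hq0 hq
    (div_ne_zero (P.a_ne_zero j) (P.bTail_ne_zero L)) (div_ne_zero (P.c_ne_zero j)
    (P.bTail_ne_zero L)) (h.a_div_bTail j L) (h.c_div_bTail j L)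
  have hκ : ∏ j, ‖P.c j / P.bTail L / (P.a j / P.bTail L)‖ = ‖∏ j, P.c j / P.a j‖ := by
    rw [norm_prod]
    exact prod_congr rfl fun j _ => by rw [div_div_div_cancel_right₀ (P.bTail_ne_zero L)]
  rw [hκ] at hW
  refine summable_of_growth L (X := fun i => ‖if i.val < L then Complex.exp (τ i)
      else P.q / (P.b i * Complex.exp (τ i))‖) (fun i => ?_) (norm_pos_iff.mpr
      (prod_ne_zero_iff.mpr fun j _ => div_ne_zero (P.c_ne_zero j) (P.a_ne_zero j)))
    (fun i hi => ?_) (fun i hi => ?_) (fun i j hi hj => ?_) hW (c := K) (fun m => ?_)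
  · have := P.b_ne_zero i
    rw [norm_pos_iff]
    split_ifs <;> simp [hq0, this]
  · simpa only [if_pos hi] using h1 i hi
  · simpa only [if_neg (not_lt.mpr hi), ← norm_mul] using h2 i hi
  · simp only [if_pos hi, if_neg (not_lt.mpr hj)]
    rw [← norm_mul, mul_div, mul_comm]
    exact h3 i j (by omega)
  · simp only [← norm_pow]
    rw [← norm_prod, termF₀, norm_mul, norm_mul, mul_comm ‖∏ j, _‖]
    gcongr
    exact hb m

theorem norm_prod_lt_mul_prod_gt (l : Fin M) (f g : Fin M → ℂ) (m : Fin M → ℕ) (z : ℂ) :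
    ‖∏ i with i < l, f i ^ m i‖ * ‖∏ i with l < i, g i ^ m i‖ * ‖z ^ m l‖ =
      ∏ i, ‖if i = l then z else if i.val < l.val then f i else g i‖ ^ m i := by
  rw [← norm_mul, prod_lt_mul_prod_gt, norm_prod, ← prod_erase_mul univ _ (mem_univ l), if_pos rfl,
    norm_pow]
  congr 1
  refine prod_congr rfl fun i hi => ?_
  rw [if_neg (ne_of_mem_erase hi)]
  split_ifs <;> rw [norm_pow]

/-- Here `κ = |q/b_l|`, and the pivot index counts positively in `m(l)`, so the split is at `l + 1`.
Products of monomials from the two sides telescope, `t_l` cancels, and inequalities of the region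
remain. -/
theorem summable_termF (hq : ‖P.q‖ < 1) (h : P.Generic) {L : ℕ} {τ : Fin M → ℂ}
    (hτ : τ ∈ P.region L 1) (k : Fin N) {l : Fin M} (hl : L ≤ l.val) :
    Summable (P.termF k l τ) := by
  have hq0 := P.q_ne_zero
  have hbl := P.b_ne_zero l
  have hbl' := P.bTail_ne_zero (l + 1)
  have ha := P.a_ne_zero k
  have hT := fun i => Complex.exp_ne_zero (τ i)
  have hb := P.b_ne_zero
  have hca : ∏ j, P.c j / P.a j ≠ 0 :=
    prod_ne_zero_iff.mpr fun j _ => div_ne_zero (P.c_ne_zero j) (P.a_ne_zero j)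
  obtain ⟨h1, h2, h3⟩ := hτ
  simp only [Equiv.Perm.coe_one, id_eq] at h1 h2 h3
  obtain ⟨K, hK, hKb⟩ := exists_norm_prod_qPoch_le hq (univ.filter (· ≠ l)) P.b (fun _ => P.q)
    fun _ _ => one_sub_pow_succ_ne hq
  obtain ⟨K', hK', hKb'⟩ := exists_norm_prod_qPoch_le hq univ (fun j => P.q * P.a k / P.c j)
    (fun j => P.q * P.a k / P.a j) fun j _ n => h.q_mul_a_div_a k j n hq
  have hW := NotPow.boundedGrowth hq0 hq (div_ne_zero ha hbl')
    (div_ne_zero (mul_ne_zero hq0 ha) (P.bTail_ne_zero l)) (h.a_div_bTail k (l + 1))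
    (h.q_mul_a_div_bTail k l)
  rw [show P.q * P.a k / P.bTail l / (P.a k / P.bTail (l + 1)) = P.q / P.b l by
    rw [bTail_eq_mul]; field_simp] at hW
  refine summable_of_growth (l + 1) (X := fun i => ‖if i = l then (∏ j, P.c j / P.a j) *
      (P.q / (P.b l * Complex.exp (τ l))) else if i.val < l.val then
      P.q * Complex.exp (τ i) / (P.b l * Complex.exp (τ l)) else
      P.b l * Complex.exp (τ l) / (P.b i * Complex.exp (τ i))‖) (fun i => ?_) (norm_pos_iff.mpr
      (div_ne_zero hq0 hbl)) (fun i hi => ?_) (fun i hi => ?_) (fun i j hi hj => ?_) hW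
      (c := K' * K) (fun m => ?_)
  · have := P.b_ne_zero i
    rw [norm_pos_iff]
    split_ifs
    · exact mul_ne_zero hca (by simp [hq0, hbl])
    · simp [hq0, hbl]
    · simp [hbl, this]
  · by_cases hil : i = l
    · simpa only [if_pos hil] using h2 l hl
    · have : i.val < l.val := by have := fun h => hil (Fin.ext h); omega
      simpa only [if_neg hil, if_pos this] using h3 i l this
  · have hil : i ≠ l := fun h => by rw [h] at hi; omega
    simp only [if_neg hil, if_neg (show ¬ i.val < l.val by omega), ← norm_mul]
    refine lt_of_eq_of_lt (congrArg norm ?_) (h3 l i (by rw [Fin.lt_def]; omega))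
    have := hb i
    field_simp
  · have hjl : j ≠ l := fun h => by rw [h] at hj; omega
    simp only [if_neg hjl, if_neg (show ¬ j.val < l.val by omega), ← norm_mul]
    by_cases hil : i = l
    · simp only [if_pos hil]
      refine lt_of_eq_of_lt (congrArg norm ?_) (h2 j (by omega))
      have := hb j; have := hT l; have := hT j
      field_simp
    · simp only [if_neg hil,
        if_pos (show i.val < l.val by have := fun h => hil (Fin.ext h); omega)]
      refine lt_of_eq_of_lt (congrArg norm ?_) (h3 i j (by rw [Fin.lt_def]; omega))
      have := hb j; have := hT l; have := hT j
      field_simp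
  · rw [← norm_prod_lt_mul_prod_gt, termF, norm_mul, norm_mul, norm_mul, norm_mul, norm_mul,
      ← mul_assoc, ← mul_assoc]
    gcongr
    · exact hKb' fun _ => m l
    · exact hKb m

/-- As for `termF`, but the pivot index counts negatively in `m(l-1)`, so the split is at `l`, and
the products with the pivot monomial telescope to `t_i`, `i < l`. -/
theorem summable_termG (hq : ‖P.q‖ < 1) (h : P.Generic) {L : ℕ} {τ : Fin M → ℂ}
    (hτ : τ ∈ P.region L 1) (k : Fin N) {l : Fin M} (hl : l.val < L) :
    Summable (P.termG k l τ) := by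
  have hq0 := P.q_ne_zero
  have hbl := P.b_ne_zero l
  have hbl' := P.bTail_ne_zero (l + 1)
  have hc := P.c_ne_zero k
  have hT := fun i => Complex.exp_ne_zero (τ i)
  have hb := P.b_ne_zero
  obtain ⟨h1, h2, h3⟩ := hτ
  simp only [Equiv.Perm.coe_one, id_eq] at h1 h2 h3
  obtain ⟨K, hK, hKb⟩ := exists_norm_prod_qPoch_le hq (univ.filter (· ≠ l)) P.b (fun _ => P.q)
    fun _ _ => one_sub_pow_succ_ne hq
  obtain ⟨K', hK', hKb'⟩ := exists_norm_prod_qPoch_le hq univ (fun j => P.q * P.a j / P.c k)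
    (fun j => P.q * P.c j / P.c k) fun j _ n => h.q_mul_c_div_c k j n hq
  have hW := NotPow.boundedGrowth hq0 hq (div_ne_zero hc (mul_ne_zero hq0 hbl'))
    (div_ne_zero hc (P.bTail_ne_zero l)) (h.c_div_q_mul_bTail k (l + 1))
    (h.c_div_bTail k l)
  rw [show P.c k / P.bTail l / (P.c k / (P.q * P.bTail (l + 1))) = P.q / P.b l by
    rw [bTail_eq_mul]; field_simp] at hW
  refine summable_of_growth l (X := fun i => ‖if i = l then P.b l * Complex.exp (τ l) / P.q
      else if i.val < l.val then
      P.q * Complex.exp (τ i) / (P.b l * Complex.exp (τ l)) else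
      P.b l * Complex.exp (τ l) / (P.b i * Complex.exp (τ i))‖) (fun i => ?_) (norm_pos_iff.mpr
      (div_ne_zero hq0 hbl)) (fun i hi => ?_) (fun i hi => ?_) (fun i j hi hj => ?_) hW
      (c := K' * K) (fun m => ?_)
  · have := P.b_ne_zero i
    rw [norm_pos_iff]
    split_ifs <;> simp [hq0, hbl, this]
  · have hil : i ≠ l := fun h => by rw [h] at hi; omega
    simpa only [if_neg hil, if_pos hi] using h3 i l hi
  · by_cases hil : i = l
    · simp only [if_pos hil, ← norm_mul]
      refine lt_of_eq_of_lt (congrArg norm ?_) (h1 l hl)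
      field_simp
    · have := fun h => hil (Fin.ext h)
      simp only [if_neg hil, if_neg (not_lt.mpr hi), ← norm_mul]
      refine lt_of_eq_of_lt (congrArg norm ?_) (h3 l i (by rw [Fin.lt_def]; omega))
      have := hb i
      field_simp
  · have hil : i ≠ l := fun h => by rw [h] at hi; omega
    simp only [if_neg hil, if_pos hi, ← norm_mul]
    by_cases hjl : j = l
    · simp only [if_pos hjl]
      refine lt_of_eq_of_lt (congrArg norm ?_) (h1 i (by omega))
      have := hT l
      field_simp
    · simp only [if_neg hjl, if_neg (not_lt.mpr hj)]
      refine lt_of_eq_of_lt (congrArg norm ?_) (h3 i j (by rw [Fin.lt_def]; omega))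
      have := hb j; have := hT l; have := hT j
      field_simp
  · rw [← norm_prod_lt_mul_prod_gt, termG, norm_mul, norm_mul, norm_mul, norm_mul, norm_mul,
      ← mul_assoc, ← mul_assoc]
    gcongr
    · exact hKb' fun _ => m l
    · exact hKb m

theorem convergesId (hq : ‖P.q‖ < 1) (h : P.Generic) {L : ℕ} {τ : Fin M → ℂ}
    (hτ : τ ∈ P.region L 1) : P.ConvergesId L τ :=
  ⟨summable_termF₀ hq h hτ, fun k _ => ⟨summable_termG hq h hτ k, summable_termF hq h hτ k⟩⟩

end Params

end QConn

end

noncomputable section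

namespace QConn

open Finset Filter Topology

/-! ### Connection relations between families of Laurent series -/

section Frame

variable {M : ℕ}

/-- Permutation of the variables of a Laurent series. -/
def pull (σ : Equiv.Perm (Fin M)) (C : (Fin M → ℤ) → ℂ) (m : Fin M → ℤ) : ℂ := C (m ∘ σ)

/-- Permutation of exponents. -/
def permExp (σ : Equiv.Perm (Fin M)) : (Fin M → ℤ) ≃ (Fin M → ℤ) where
  toFun m := m ∘ σ
  invFun m := m ∘ σ.symm
  left_inv m := by funext i; simp
  right_inv m := by funext i; simp

theorem mon_comp (σ : Equiv.Perm (Fin M)) (m : Fin M → ℤ) (τ : Fin M → ℂ) :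
    mon (m ∘ σ) (τ ∘ σ) = mon m τ :=
  congrArg Complex.exp (Equiv.sum_comp σ fun i => (m i : ℂ) * τ i)

theorem summableAt_pull {σ : Equiv.Perm (Fin M)} {C : (Fin M → ℤ) → ℂ} {τ : Fin M → ℂ} :
    SummableAt (pull σ C) τ ↔ SummableAt C (τ ∘ σ) := by
  rw [SummableAt, SummableAt,
    ← (permExp σ).summable_iff (f := fun m => ‖C m * mon m (τ ∘ σ)‖)]
  exact iff_of_eq (congrArg Summable (funext fun m => by
    simp only [Function.comp_apply, permExp, Equiv.coe_fn_mk, mon_comp, pull]))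

theorem ev_pull (σ : Equiv.Perm (Fin M)) (C : (Fin M → ℤ) → ℂ) (τ : Fin M → ℂ) :
    ev (pull σ C) τ = ev C (τ ∘ σ) := by
  rw [ev, ev, ← (permExp σ).tsum_eq fun m => C m * mon m (τ ∘ σ)]
  exact tsum_congr fun m => by simp only [permExp, Equiv.coe_fn_mk, mon_comp, pull]

theorem conv_pull (σ : Equiv.Perm (Fin M)) (E C : (Fin M → ℤ) → ℂ) :
    conv (pull σ E) (pull σ C) = pull σ (conv E C) := by
  funext m
  rw [pull, conv, conv, ← (permExp σ).tsum_eq fun k => E k * C (m ∘ σ - k)]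
  rfl

/-- The Laurent series `C` converges everywhere. -/
def Entire (C : (Fin M → ℤ) → ℂ) : Prop := ∀ τ, SummableAt C τ

variable {ι : Type*}

/-- After multiplication by a Laurent series without zeros in `U`, the family `C` converges
in `D`. -/
def Reach (U : Set (Fin M → ℂ)) (C : ι → (Fin M → ℤ) → ℂ) (D : Set (Fin M → ℂ)) : Prop :=
  ∃ E, Entire E ∧ (∀ τ ∈ U, ev E τ ≠ 0) ∧ ∀ i, ∀ τ ∈ D, SummableAt (conv E (C i)) τ

theorem summableAt_single_zero (τ : Fin M → ℂ) :
    SummableAt (Pi.single (0 : Fin M → ℤ) (1 : ℂ)) τ :=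
  summable_of_ne_finset_zero (s := {0}) fun m hm => by
    rw [Pi.single_eq_of_ne (by simpa using hm), zero_mul, norm_zero]

theorem conv_single_zero (C : (Fin M → ℤ) → ℂ) : conv (Pi.single 0 1) C = C := by
  funext m
  rw [conv, tsum_eq_single 0 fun k hk => by rw [Pi.single_eq_of_ne hk, zero_mul]]
  simp

theorem ev_single_zero (τ : Fin M → ℂ) : ev (Pi.single (0 : Fin M → ℤ) (1 : ℂ)) τ = 1 := by
  rw [ev, tsum_eq_single 0 fun k hk => by rw [Pi.single_eq_of_ne hk, zero_mul]]
  simp [mon]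

theorem Reach.refl {U : Set (Fin M → ℂ)} {C : ι → (Fin M → ℤ) → ℂ} {D : Set (Fin M → ℂ)}
    (h : ∀ i, ∀ τ ∈ D, SummableAt (C i) τ) : Reach U C D :=
  ⟨Pi.single 0 1, summableAt_single_zero, fun τ _ => by rw [ev_single_zero]; exact one_ne_zero,
    fun i τ hτ => by rw [conv_single_zero]; exact h i τ hτ⟩

variable [Fintype ι]

/-- A relation `E c = ∑_κ n_κ C'_κ` of Laurent series, which says `u = ∑_κ R_κ u'_κ` for
`u = p · c` and `u' = p' · C'`. -/
def RowLink (U : Set (Fin M → ℂ)) (E c : (Fin M → ℤ) → ℂ) (p : (Fin M → ℂ) → ℂ)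
    (C' : ι → (Fin M → ℤ) → ℂ) (p₁ : (Fin M → ℂ) → ι → ℂ) (R : (Fin M → ℂ) → ι → ℂ) : Prop :=
  ∃ n : ι → (Fin M → ℤ) → ℂ, (∀ κ, Entire (n κ)) ∧ (conv E c = fun m => ∑ κ, conv (n κ) (C' κ) m) ∧
    ∀ τ ∈ U, ∀ κ, p τ * ev (n κ) τ = ev E τ * R τ κ * p₁ τ κ

/-- The relation `u = X u'` for `u = p · C` and `u' = p' · C'`, up to a factor `E` without zeros
in `U`. -/
def Link (U : Set (Fin M → ℂ)) (C : ι → (Fin M → ℤ) → ℂ) (p : (Fin M → ℂ) → ι → ℂ)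
    (C' : ι → (Fin M → ℤ) → ℂ) (p' : (Fin M → ℂ) → ι → ℂ) (X : (Fin M → ℂ) → Matrix ι ι ℂ) : Prop :=
  ∃ E, Entire E ∧ (∀ τ ∈ U, ev E τ ≠ 0) ∧
    ∀ i, RowLink U E (C i) (fun τ => p τ i) C' p' fun τ => X τ i

/-- A row of a connection matrix has nonzero entries only within one block of components; the
coefficients outside the block are taken to be `0`. -/
theorem RowLink.of_injective {U : Set (Fin M → ℂ)} {E c : (Fin M → ℤ) → ℂ} {p : (Fin M → ℂ) → ℂ}
    {C' : ι → (Fin M → ℤ) → ℂ} {p' : (Fin M → ℂ) → ι → ℂ} {R : (Fin M → ℂ) → ι → ℂ}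
    {J : Type*} [Fintype J] {f : J → ι} (hf : Function.Injective f) (n : J → (Fin M → ℤ) → ℂ)
    (hn : ∀ d, Entire (n d)) (h : conv E c = fun m => ∑ d, conv (n d) (C' (f d)) m)
    (hR : ∀ τ ∈ U, ∀ d, p τ * ev (n d) τ = ev E τ * R τ (f d) * p' τ (f d))
    (hR0 : ∀ τ, ∀ κ ∉ Set.range f, R τ κ = 0) : RowLink U E c p C' p' R := by
  have h0 : ∀ κ ∉ Set.range f, Function.extend f n 0 κ = 0 := fun κ hκ =>
    Function.extend_apply' _ _ _ hκ
  have h1 : ∀ d, Function.extend f n 0 (f d) = n d := hf.extend_apply n 0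
  refine ⟨Function.extend f n 0, fun κ τ => ?_, ?_, fun τ hτ κ => ?_⟩
  · by_cases hκ : κ ∈ Set.range f
    · obtain ⟨d, rfl⟩ := hκ
      rw [h1]
      exact hn d τ
    · rw [h0 κ hκ]
      simp [SummableAt]
  · rw [h]
    funext m
    refine Fintype.sum_of_injective f hf _ _ (fun κ hκ => ?_) fun d => by rw [h1]
    rw [h0 κ hκ]
    simp [conv]
  · by_cases hκ : κ ∈ Set.range f
    · obtain ⟨d, rfl⟩ := hκ
      rw [h1]
      exact hR τ hτ d
    · rw [h0 κ hκ, hR0 τ κ hκ]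
      simp [ev]

/-- For components that do not change, both sides are multiplied by the same `E`. -/
theorem RowLink.of_eq {U : Set (Fin M → ℂ)} {E c : (Fin M → ℤ) → ℂ} {p : (Fin M → ℂ) → ℂ}
    {C' : ι → (Fin M → ℤ) → ℂ} {p' : (Fin M → ℂ) → ι → ℂ} {R : (Fin M → ℂ) → ι → ℂ}
    (hE : Entire E) (i : ι) (hc : c = C' i) (hp : ∀ τ, p τ = p' τ i) (hR : ∀ τ, R τ i = 1)
    (hR0 : ∀ τ, ∀ κ ≠ i, R τ κ = 0) : RowLink U E c p C' p' R :=
  RowLink.of_injective (J := Unit) (f := fun _ => i) (fun _ _ _ => rfl) (fun _ => E) (fun _ => hE)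
    (by simp [hc]) (fun τ _ _ => by rw [hp, hR]; ring)
    fun τ κ hκ => hR0 τ κ fun h => hκ ⟨(), h.symm⟩

theorem Link.mono {U U' : Set (Fin M → ℂ)} {C : ι → (Fin M → ℤ) → ℂ} {p : (Fin M → ℂ) → ι → ℂ}
    {C' : ι → (Fin M → ℤ) → ℂ} {p' : (Fin M → ℂ) → ι → ℂ} {X : (Fin M → ℂ) → Matrix ι ι ℂ}
    (h : Link U C p C' p' X) (hU : U' ⊆ U) : Link U' C p C' p' X := by
  obtain ⟨E, hE, h0, h⟩ := h
  refine ⟨E, hE, fun τ hτ => h0 τ (hU hτ), fun i => ?_⟩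
  obtain ⟨n, h1, h2, h3⟩ := h i
  exact ⟨n, h1, h2, fun τ hτ => h3 τ (hU hτ)⟩

theorem Link.pull {U : Set (Fin M → ℂ)} {C : ι → (Fin M → ℤ) → ℂ} {p : (Fin M → ℂ) → ι → ℂ}
    {C' : ι → (Fin M → ℤ) → ℂ} {p' : (Fin M → ℂ) → ι → ℂ} {X : (Fin M → ℂ) → Matrix ι ι ℂ}
    (h : Link U C p C' p' X) (σ : Equiv.Perm (Fin M)) :
    Link {τ | τ ∘ σ ∈ U} (fun i => pull σ (C i)) (fun τ => p (τ ∘ σ)) (fun i => pull σ (C' i))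
      (fun τ => p' (τ ∘ σ)) fun τ => X (τ ∘ σ) := by
  obtain ⟨E, hE, h0, h⟩ := h
  refine ⟨QConn.pull σ E, fun τ => summableAt_pull.mpr (hE _), fun τ hτ => ?_, fun i => ?_⟩
  · rw [ev_pull]
    exact h0 _ hτ
  obtain ⟨n, h1, h2, h3⟩ := h i
  refine ⟨fun κ => QConn.pull σ (n κ), fun κ τ => summableAt_pull.mpr (h1 κ _), ?_,
    fun τ hτ κ => ?_⟩
  · simp only [conv_pull, h2]
    rfl
  · rw [ev_pull, ev_pull]
    exact h3 _ hτ κ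

/-- If `E'` is a multiplier for `C'`, then `E' E` is one for `C`, since `E' E C_i = ∑ n_κ (E'
C'_κ)`. The points where `C` and where `C'` converge only justify the rearrangements and need not be
related to each other or to `D`. -/
theorem Link.reach {U : Set (Fin M → ℂ)} {C : ι → (Fin M → ℤ) → ℂ} {p : (Fin M → ℂ) → ι → ℂ}
    {C' : ι → (Fin M → ℤ) → ℂ} {p' : (Fin M → ℂ) → ι → ℂ} {X : (Fin M → ℂ) → Matrix ι ι ℂ}
    (h : Link U C p C' p' X) {D : Set (Fin M → ℂ)} (hD : Reach U C' D)
    (hC : ∃ τ, ∀ i, SummableAt (C i) τ) (hC' : ∃ τ, ∀ i, SummableAt (C' i) τ) : Reach U C D := by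
  obtain ⟨E, hE, h0, h⟩ := h
  obtain ⟨E', hE', h0', hs⟩ := hD
  obtain ⟨ρ, hC⟩ := hC
  obtain ⟨ρ', hC'⟩ := hC'
  refine ⟨conv E' E, fun τ => (hE' τ).conv (hE τ), fun τ hτ => ?_, fun i τ hτ => ?_⟩
  · rw [ev_conv (hE' τ) (hE τ)]
    exact mul_ne_zero (h0' τ hτ) (h0 τ hτ)
  obtain ⟨n, h1, h2, -⟩ := h i
  rw [conv_assoc (hE' ρ) (hE ρ) (hC i), h2,
    conv_sum (hE' ρ') fun κ _ => (h1 κ ρ').conv (hC' κ)]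
  refine SummableAt.sum fun κ _ => ?_
  rw [conv_left_comm (hE' ρ') (h1 κ ρ') (hC' κ)]
  exact (h1 κ τ).conv (hs κ τ hτ)

/-- The linear relation between the continuations which follows from a `Link`. -/
theorem Link.relation {U : Set (Fin M → ℂ)} {C : ι → (Fin M → ℤ) → ℂ} {p : (Fin M → ℂ) → ι → ℂ}
    {C' : ι → (Fin M → ℤ) → ℂ} {p' : (Fin M → ℂ) → ι → ℂ} {X : (Fin M → ℂ) → Matrix ι ι ℂ}
    (h : Link U C p C' p' X) (hC : ∃ τ, ∀ i, SummableAt (C i) τ)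
    (hC' : ∃ τ, ∀ i, SummableAt (C' i) τ) {F F' : (Fin M → ℤ) → ℂ} (hF : Entire F)
    (hF' : Entire F') {τ : Fin M → ℂ} (hτ : τ ∈ U) (h0 : ev F τ ≠ 0) (h0' : ev F' τ ≠ 0)
    (hFC : ∀ i, Entire (conv F (C i))) (hFC' : ∀ i, Entire (conv F' (C' i))) (i : ι) :
    p τ i * (ev (conv F (C i)) τ / ev F τ) =
      ∑ κ, X τ i κ * (p' τ κ * (ev (conv F' (C' κ)) τ / ev F' τ)) := by
  obtain ⟨E, hE, hE0, h⟩ := h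
  obtain ⟨ρ, hC⟩ := hC
  obtain ⟨ρ', hC'⟩ := hC'
  obtain ⟨n, h1, h2, h3⟩ := h i
  have hn : ∀ κ ∈ (univ : Finset ι), SummableAt (conv (n κ) (C' κ)) ρ' := fun κ _ =>
    (h1 κ ρ').conv (hC' κ)
  -- Both multipliers are applied to the relation and moved next to `C i` and `C' κ`, on each side
  -- at a point where that side converges. In the result all factors are entire, so it can be
  -- evaluated at `τ`.
  have key : conv F' (conv E (conv F (C i))) = fun m => ∑ κ, conv F (conv (n κ) (conv F' (C' κ))) m := by
    rw [conv_left_comm (hE ρ) (hF ρ) (hC i), h2, conv_sum (hF ρ') hn,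
      conv_sum (hF' ρ') fun κ hκ => (hF ρ').conv (hn κ hκ)]
    funext m
    refine sum_congr rfl fun κ _ => ?_
    rw [conv_left_comm (hF' ρ') (hF ρ') (hn κ (mem_univ κ)),
      conv_left_comm (hF' ρ') (h1 κ ρ') (hC' κ)]
  have hn' : ∀ κ, SummableAt (conv (n κ) (conv F' (C' κ))) τ := fun κ =>
    (h1 κ τ).conv (hFC' κ τ)
  have key2 : ev _ τ = ev _ τ := congrArg (fun c => ev c τ) key
  rw [ev_conv (hF' τ) ((hE τ).conv (hFC i τ)), ev_conv (hE τ) (hFC i τ),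
    ev_sum fun κ _ => (hF τ).conv (hn' κ)] at key2
  simp only [ev_conv (hF τ) (hn' _), ev_conv (h1 _ τ) (hFC' _ τ), ← mul_sum] at key2
  have e0 := hE0 τ hτ
  have key3 : ev E τ * (p τ i * (ev (conv F (C i)) τ / ev F τ)) =
      ∑ κ, p τ i * ev (n κ) τ * (ev (conv F' (C' κ)) τ / ev F' τ) := by
    have : ∑ κ, p τ i * ev (n κ) τ * (ev (conv F' (C' κ)) τ / ev F' τ) =
        p τ i * (∑ κ, ev (n κ) τ * ev (conv F' (C' κ)) τ) / ev F' τ := by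
      rw [mul_sum, sum_div]
      exact sum_congr rfl fun κ _ => by ring
    rw [this]
    field_simp
    linear_combination p τ i * key2
  refine mul_left_cancel₀ e0 ?_
  rw [key3, mul_sum]
  refine sum_congr rfl fun κ _ => ?_
  rw [h3 τ hτ κ]
  ring

end Frame

end QConn

end

noncomputable section

namespace QConn

open Finset Filter Topology

namespace Params

variable {N M : ℕ} (P : Params N M)

/-! ### The links between `u^{L,id}` and `u^{L+1,id}` -/

/-- Numerator parameters of the one variable connection problem in `t_p`. -/
def numPar (p : Fin M) : Option (Fin N) → ℂ
  | none => P.b p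
  | some j => P.a j / P.bTail (p + 1)

/-- Denominator parameters of the one variable connection problem in `t_p`. -/
def denPar (p : Fin M) : Option (Fin N) → ℂ
  | none => P.q
  | some j => P.c j / P.bTail (p + 1)

/-- Shifts of the parameters by the exponents of the other variables. -/
def shiftPar (N : ℕ) (p : Fin M) (e : Fin M → ℤ) : Option (Fin N) → ℤ
  | none => 0
  | some _ => ∑ i ∈ univ.erase p, e i

/-- The components of `u` which are connected in the variable `t_p`. -/
def blockIdx (p : Fin M) : Option (Fin N) → Idx N M
  | none => none
  | some k => some (k, p)

theorem blockIdx_injective (p : Fin M) : Function.Injective (blockIdx (N := N) p) := by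
  rintro (_ | j) (_ | k) h <;> simp_all [blockIdx]

/-- The factor of the coefficients which does not depend on the exponent of `t_p`. -/
def restWt (p : Fin M) (e : Fin M → ℤ) : ℂ := ∏ i ∈ univ.erase p, P.wt p i (e i)

theorem wt_succ {p i : Fin M} (hi : i ≠ p) (e : ℤ) : P.wt (p + 1) i e = P.wt p i e := by
  have : i.val ≠ p.val := fun h => hi (Fin.ext h)
  simp only [wt, show (i.val < p.val + 1) = (i.val < p.val) by
    rw [eq_iff_iff]; omega]

theorem prod_erase_none {J : Type*} [Fintype J] [DecidableEq J] (f : Option J → ℂ) :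
    ∏ j ∈ univ.erase none, f j = ∏ j, f (some j) := by
  rw [show (univ.erase none : Finset (Option J)) = univ.map Function.Embedding.some by
    ext (_ | j) <;> simp, prod_map]
  rfl

theorem prod_erase_some {J : Type*} [Fintype J] [DecidableEq J] (f : Option J → ℂ) (k : J) :
    ∏ j ∈ univ.erase (some k), f j = f none * ∏ j with j ≠ k, f (some j) := by
  rw [show (univ.erase (some k) : Finset (Option J)) =
    insert none ((univ.filter (· ≠ k)).map Function.Embedding.some) by
      ext (_ | j) <;> simp, prod_insert (by simp), prod_map]
  rfl

section Ratios

variable (p : Fin M)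

theorem bTail_div (x : ℂ) : x / P.bTail (p + 1) / P.b p = x / P.bTail p := by
  rw [div_div, bTail_eq_mul, mul_comm (P.bTail _)]

theorem div_bTail_inv (x y : ℂ) : x * P.b p / (y / P.bTail (p + 1)) = x * P.bTail p / y := by
  rw [bTail_eq_mul, div_div_eq_mul_div, mul_assoc]

theorem div_cancel_bTail (x y z : ℂ) :
    x * (y / P.bTail (p + 1)) / (z / P.bTail (p + 1)) = x * y / z := by
  rw [mul_div_assoc, div_div_div_cancel_right₀ (P.bTail_ne_zero _), mul_div_assoc]

theorem den_div_num (j d : Option (Fin N)) : P.denPar p j / P.numPar p d =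
    match j, d with
    | none, none => P.q / P.b p
    | some j, none => P.c j / P.bTail p
    | none, some d => P.q * P.bTail (p + 1) / P.a d
    | some j, some d => P.c j / P.a d := by
  rcases j with _ | j <;> rcases d with _ | d <;> simp only [denPar, numPar]
  · rw [div_div_eq_mul_div]
  · exact P.bTail_div p _
  · exact div_div_div_cancel_right₀ (P.bTail_ne_zero _) _ _

theorem q_mul_den_div_den (j k : Option (Fin N)) : P.q * P.denPar p j / P.denPar p k =
    match j, k with
    | none, none => P.q
    | some j, none => P.c j / P.bTail (p + 1)
    | none, some k => P.q ^ 2 * P.bTail (p + 1) / P.c k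
    | some j, some k => P.q * P.c j / P.c k := by
  rcases j with _ | j <;> rcases k with _ | k <;> simp only [denPar]
  · exact mul_div_cancel_right₀ _ P.q_ne_zero
  · rw [div_div_eq_mul_div, pow_two]
  · exact mul_div_cancel_left₀ _ P.q_ne_zero
  · exact P.div_cancel_bTail p _ _ _

theorem q_mul_num_div_den (j k : Option (Fin N)) : P.q * P.numPar p j / P.denPar p k =
    match j, k with
    | none, none => P.b p
    | some j, none => P.a j / P.bTail (p + 1)
    | none, some k => P.q * P.bTail p / P.c k
    | some j, some k => P.q * P.a j / P.c k := by
  rcases j with _ | j <;> rcases k with _ | k <;> simp only [denPar, numPar]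
  · exact mul_div_cancel_left₀ _ P.q_ne_zero
  · exact P.div_bTail_inv p _ _
  · exact mul_div_cancel_left₀ _ P.q_ne_zero
  · exact P.div_cancel_bTail p _ _ _

theorem num_div_num (j d : Option (Fin N)) : P.numPar p j / P.numPar p d =
    match j, d with
    | none, none => 1
    | some j, none => P.a j / P.bTail p
    | none, some d => P.bTail p / P.a d
    | some j, some d => P.a j / P.a d := by
  rcases j with _ | j <;> rcases d with _ | d <;> simp only [numPar]
  · exact div_self (P.b_ne_zero p)
  · simpa using P.div_bTail_inv p 1 (P.a d)
  · exact P.bTail_div p _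
  · exact div_div_div_cancel_right₀ (P.bTail_ne_zero _) _ _

theorem q_mul_num_div_num (k j : Option (Fin N)) : P.q * P.numPar p k / P.numPar p j =
    match k, j with
    | none, none => P.q
    | none, some j => P.q * P.bTail p / P.a j
    | some k, none => P.q * P.a k / P.bTail p
    | some k, some j => P.q * P.a k / P.a j := by
  rcases j with _ | j <;> rcases k with _ | k <;> simp only [numPar]
  · exact mul_div_cancel_right₀ _ (P.b_ne_zero p)
  · rw [← mul_div_assoc, P.bTail_div p]
  · exact P.div_bTail_inv p _ _
  · exact P.div_cancel_bTail p _ _ _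

theorem den_div_den (d j : Option (Fin N)) : P.denPar p d / P.denPar p j =
    match d, j with
    | none, none => 1
    | none, some j => P.q * P.bTail (p + 1) / P.c j
    | some d, none => P.c d / (P.q * P.bTail (p + 1))
    | some d, some j => P.c d / P.c j := by
  rcases j with _ | j <;> rcases d with _ | d <;> simp only [denPar]
  · exact div_self P.q_ne_zero
  · rw [div_div, mul_comm]
  · rw [div_div_eq_mul_div]
  · exact div_div_div_cancel_right₀ (P.bTail_ne_zero _) _ _

end Ratios

variable {P}

/-- Ratios of equal type, and mixed ratios with different shifts, reduce to `a_j/a_k`, `c_j/c_k`,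
`a_j/b_i⋯b_M` and `c_j/b_i⋯b_M` up to powers of `q`: precisely what `Generic` controls. -/
theorem admissible (h : P.Generic) (p : Fin M) (e : Fin M → ℤ) :
    Admissible P.q (P.numPar p) (P.denPar p) (shiftPar N p e) := by
  have hq0 := P.q_ne_zero
  have inv : ∀ {x y : ℂ}, NotPow P.q (x / y) → NotPow P.q (y / x) := fun h => by
    simpa using h.inv
  refine ⟨fun j => ?_, fun j => ?_, fun j d hjd => ?_, fun j d hjd => ?_, fun j d hn => ?_⟩
  · cases j
    · exact P.b_ne_zero p
    · exact div_ne_zero (P.a_ne_zero _) (P.bTail_ne_zero _)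
  · cases j
    · exact hq0
    · exact div_ne_zero (P.c_ne_zero _) (P.bTail_ne_zero _)
  · rw [num_div_num]
    rcases j with _ | j <;> rcases d with _ | d
    · exact absurd rfl hjd
    · exact inv (h.a_div_bTail d p)
    · exact h.a_div_bTail j p
    · exact h.a_div_a fun h => hjd (by rw [h])
  · rw [den_div_den]
    rcases j with _ | j <;> rcases d with _ | d
    · exact absurd rfl hjd
    · exact (inv (h.c_div_bTail d (p + 1))).congr_mul hq0 (mul_div_assoc _ _ _)
    · exact h.c_div_q_mul_bTail j (p + 1)
    · exact h.c_div_c fun h => hjd (by rw [h])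
  · rcases j with _ | j <;> rcases d with _ | d
    · exact absurd rfl hn
    · simpa [denPar, numPar, div_div_eq_mul_div, bTail_eq_mul P p] using inv (h.c_div_bTail d p)
    · exact (h.a_div_bTail j (p + 1)).congr_zpow hq0 (-1) (by
        rw [zpow_neg_one]; simp only [numPar, denPar]; ring)
    · exact absurd rfl hn

/-- The total degree is the exponent of `t_p` plus the sum of the other exponents. The latter is a
shift of the parameters, so what remains is a one-variable solution at `0`. -/
theorem coef_succ_blockIdx (p : Fin M) (j : Option (Fin N)) (e : Fin M → ℤ) :
    P.coef (p + 1) (blockIdx p j) e = P.restWt p e *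
      phiC P.q (P.numPar p) (P.denPar p) (shiftPar N p e) j (e p) := by
  have hS : e p + ∑ i ∈ univ.erase p, e i = ∑ i, e i := add_sum_erase _ _ (mem_univ p)
  rcases j with _ | k
  · simp only [blockIdx, coef, coefF₀, phiC, Fintype.prod_option, q_mul_num_div_den,
      q_mul_den_div_den, shiftPar, hS, add_zero]
    rw [← mul_prod_erase univ _ (mem_univ p),
      prod_congr rfl fun i hi => P.wt_succ (ne_of_mem_erase hi) (e i), wt,
      if_pos (Nat.lt_succ_self _), restWt]
    ring
  · simp only [blockIdx, coef, if_pos (Nat.lt_succ_self _), coefG, phiC, Fintype.prod_option,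
      q_mul_num_div_den, q_mul_den_div_den, shiftPar, hS, add_zero, restWt]
    ring

/-- The same with the solutions at `∞`. For the component `0` the coefficients of `𝓕^p` must be
reflected to negative degree, which uses genericity. -/
theorem coef_blockIdx (hq : ‖P.q‖ < 1) (h : P.Generic) (p : Fin M) (j : Option (Fin N))
    (e : Fin M → ℤ) : P.coef p (blockIdx p j) e = P.restWt p e *
      chiC P.q (P.numPar p) (P.denPar p) (shiftPar N p e) j (e p) := by
  have hq0 := P.q_ne_zero
  have hS : e p + ∑ i ∈ univ.erase p, e i = ∑ i, e i := add_sum_erase _ _ (mem_univ p)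
  have hbq : P.denPar p none / P.numPar p none = (P.b p / P.q)⁻¹ := by
    rw [inv_div]; rfl
  have hzp : ((P.b p / P.q)⁻¹) ^ (-e p) = (P.b p / P.q) ^ e p := by
    rw [inv_zpow, zpow_neg, inv_inv]
  have hca : ∀ j, P.denPar p (some j) / P.numPar p (some j) = P.c j / P.a j := fun j => by
    rw [den_div_num]
  rcases j with _ | k
  · have hr : ∀ j, qPoch P.q (P.a j / P.bTail p) (∑ i, e i) /
        qPoch P.q (P.c j / P.bTail p) (∑ i, e i) = qPoch P.q (P.q * P.bTail p / P.c j) (-∑ i, e i) /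
        qPoch P.q (P.q * P.bTail p / P.a j) (-∑ i, e i) * (P.c j / P.a j) ^ (-∑ i, e i) := fun j => by
      have := NotPow.qPoch_neg_div hq0 hq (div_ne_zero (P.a_ne_zero j) (P.bTail_ne_zero p))
        (div_ne_zero (P.c_ne_zero j) (P.bTail_ne_zero p)) (h.a_div_bTail j p) (h.c_div_bTail j p)
        (-∑ i, e i)
      rw [neg_neg, div_div_div_cancel_right₀ (P.bTail_ne_zero p), div_div_eq_mul_div,
        div_div_eq_mul_div] at this
      rw [this, mul_comm]
    simp only [blockIdx, coef, coefF₀, chiC, Fintype.prod_option, hbq, hca, hr, q_mul_num_div_den,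
      q_mul_num_div_num, shiftPar, hS, add_zero, hzp]
    rw [← mul_prod_erase univ _ (mem_univ p), wt, if_neg (lt_irrefl _), restWt]
    ring
  · simp only [blockIdx, coef, if_neg (lt_irrefl _), coefF, chiC, Fintype.prod_option, hbq, hca,
      q_mul_num_div_den, q_mul_num_div_num, shiftPar, hS, add_zero, hzp, restWt]
    ring

theorem sub_single_apply_of_ne {p i : Fin M} (hi : i ≠ p) (m : Fin M → ℤ) (s : ℤ) :
    (m - s • (Pi.single p 1 : Fin M → ℤ)) i = m i := by
  simp [Pi.single_eq_of_ne hi]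

theorem sub_single_apply_self (p : Fin M) (m : Fin M → ℤ) (s : ℤ) :
    (m - s • (Pi.single p 1 : Fin M → ℤ)) p = m p - s := by
  simp

theorem restWt_sub_single (p : Fin M) (m : Fin M → ℤ) (s : ℤ) :
    P.restWt p (m - s • Pi.single p (1 : ℤ)) = P.restWt p m :=
  prod_congr rfl fun i hi => by rw [sub_single_apply_of_ne (ne_of_mem_erase hi)]

theorem shiftPar_sub_single (p : Fin M) (m : Fin M → ℤ) (s : ℤ) :
    shiftPar N p (m - s • Pi.single p (1 : ℤ)) = shiftPar N p m := by
  funext j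
  cases j
  · rfl
  · exact sum_congr rfl fun i hi => by rw [sub_single_apply_of_ne (ne_of_mem_erase hi)]

theorem single_ne_zero (p : Fin M) : (Pi.single p (1 : ℤ) : Fin M → ℤ) ≠ 0 := by
  simp

theorem mon_single (p : Fin M) (τ : Fin M → ℂ) : mon (Pi.single p (1 : ℤ)) τ = Complex.exp (τ p) := by
  rw [mon, sum_eq_single p (fun i _ hi => by simp [Pi.single_eq_of_ne hi]) (by simp)]
  simp

theorem conv_const_mul (x : ℂ) (E C : (Fin M → ℤ) → ℂ) (m : Fin M → ℤ) :
    conv (fun k => x * E k) C m = x * conv E C m := by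
  rw [conv, conv, ← tsum_mul_left]
  exact tsum_congr fun k => mul_assoc _ _ _

theorem ev_const_mul (x : ℂ) (E : (Fin M → ℤ) → ℂ) (τ : Fin M → ℂ) :
    ev (fun k => x * E k) τ = x * ev E τ := by
  rw [ev, ev, ← tsum_mul_left]
  exact tsum_congr fun k => mul_assoc _ _ _

theorem entire_const_mul (x : ℂ) {E : (Fin M → ℤ) → ℂ} (hE : Entire E) :
    Entire fun k => x * E k := fun τ => by
  refine ((hE τ).mul_left ‖x‖).congr fun m => ?_
  rw [mul_assoc, norm_mul x]

/-- Multiplication by a function of `t_p` alone moves only the exponent of `t_p`; the rest weight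
and the shifts stay fixed, and the product reduces to one variable. -/
theorem conv_thetaC_succ (p : Fin M) (x : ℂ) (j : Option (Fin N)) (m : Fin M → ℤ) :
    conv (thetaC P.q (Pi.single p 1) x) (P.coef (p + 1) (blockIdx p j)) m =
      P.restWt p m * ∑' s : ℤ, vth P.q s * x ^ s *
        phiC P.q (P.numPar p) (P.denPar p) (shiftPar N p m) j (m p - s) := by
  rw [thetaC, conv_line (single_ne_zero p), ← tsum_mul_left]
  refine tsum_congr fun s => ?_
  rw [coef_succ_blockIdx, restWt_sub_single, shiftPar_sub_single, sub_single_apply_self]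
  ring

theorem conv_thetaC (hq : ‖P.q‖ < 1) (h : P.Generic) (p : Fin M) (x : ℂ) (j : Option (Fin N))
    (m : Fin M → ℤ) :
    conv (thetaC P.q (Pi.single p 1) x) (P.coef p (blockIdx p j)) m =
      P.restWt p m * ∑' s : ℤ, vth P.q s * x ^ s *
        chiC P.q (P.numPar p) (P.denPar p) (shiftPar N p m) j (m p - s) := by
  rw [thetaC, conv_line (single_ne_zero p), ← tsum_mul_left]
  refine tsum_congr fun s => ?_
  rw [coef_blockIdx hq h, restWt_sub_single, shiftPar_sub_single, sub_single_apply_self]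
  ring

theorem tailPow_eq_mul (p : Fin M) (τ : Fin M → ℂ) :
    P.tailPow p τ = Complex.exp (-P.β p * τ p) * P.tailPow (p + 1) τ := by
  rw [tailPow, tailPow, filter_le_eq_insert, prod_insert (by simp)]

theorem coef_succ_of_ne {p l : Fin M} (hl : l ≠ p) (k : Fin N) :
    P.coef (p + 1) (some (k, l)) = P.coef p (some (k, l)) := by
  have : l.val ≠ p.val := fun h => hl (Fin.ext h)
  simp only [coef, show (l.val < p.val + 1) = (l.val < p.val) by rw [eq_iff_iff]; omega]

theorem pre_succ_of_ne {p l : Fin M} (hl : l ≠ p) (k : Fin N) (τ : Fin M → ℂ) :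
    P.pre (p + 1) τ (some (k, l)) = P.pre p τ (some (k, l)) := by
  have : l.val ≠ p.val := fun h => hl (Fin.ext h)
  simp only [pre, show (l.val < p.val + 1) = (l.val < p.val) by rw [eq_iff_iff]; omega]

theorem exists_blockIdx (p : Fin M) (ι : Idx N M) :
    (∃ j, ι = blockIdx p j) ∨ ∃ k l, l ≠ p ∧ ι = some (k, l) := by
  rcases ι with _ | ⟨k, l⟩
  · exact Or.inl ⟨none, rfl⟩
  · by_cases hl : l = p
    · exact Or.inl ⟨some k, by rw [hl]; rfl⟩
    · exact Or.inr ⟨k, l, hl, rfl⟩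

theorem matBId_of_ne {p l : Fin M} (hl : l ≠ p) (k : Fin N) (x : ℂ) (κ : Idx N M) :
    P.matBId p x (some (k, l)) κ = if κ = some (k, l) then 1 else 0 := by
  rcases κ with _ | ⟨d, l'⟩
  · simp [matBId, hl]
  · simp [matBId, hl, eq_comm (a := d), eq_comm (a := l')]

theorem matAId_of_ne {p l : Fin M} (hl : l ≠ p) (k : Fin N) (x : ℂ) (κ : Idx N M) :
    P.matAId p x (some (k, l)) κ = if κ = some (k, l) then 1 else 0 := by
  rcases κ with _ | ⟨d, l'⟩
  · simp [matAId, hl]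
  · simp [matAId, hl, eq_comm (a := d), eq_comm (a := l')]

theorem matBId_blockIdx_of_ne {p l : Fin M} (hl : l ≠ p) (d : Fin N) (j : Option (Fin N)) (x : ℂ) :
    P.matBId p x (blockIdx p j) (some (d, l)) = 0 := by
  rcases j with _ | k <;> simp [matBId, blockIdx, hl, hl.symm]

theorem matAId_blockIdx_of_ne {p l : Fin M} (hl : l ≠ p) (d : Fin N) (j : Option (Fin N)) (x : ℂ) :
    P.matAId p x (blockIdx p j) (some (d, l)) = 0 := by
  rcases j with _ | k <;> simp [matAId, blockIdx, hl, hl.symm]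

/-- The entries of `B^{p+1,id}` are the constants of the connection formula. -/
theorem matBId_blockIdx (p : Fin M) (τ : Fin M → ℂ) (j d : Option (Fin N))
    (h0 : theta P.q (Complex.exp (τ p)) ≠ 0) :
    P.pre (p + 1) τ (blockIdx p j) * (betaC P.q (P.numPar p) (P.denPar p) j d *
        theta P.q (P.q * P.numPar p d / P.denPar p j * Complex.exp (τ p))) =
      theta P.q (Complex.exp (τ p)) * P.matBId p (τ p) (blockIdx p j) (blockIdx p d) *
        P.pre p τ (blockIdx p d) := by
  rcases j with _ | k <;> rcases d with _ | d
  · simp only [blockIdx, pre, betaC, prod_erase_none, matBId, Matrix.of_apply, den_div_num,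
      q_mul_den_div_den, q_mul_num_div_den, num_div_num, tailPow_eq_mul]
    rw [mul_comm (P.b p) (Complex.exp _), neg_mul, Complex.exp_neg]
    have := Complex.exp_ne_zero (P.β p * τ p)
    simp only [prod_div_distrib, prod_mul_distrib]
    field_simp
  · simp only [blockIdx, pre, betaC, prod_erase_none, prod_erase_some, matBId, Matrix.of_apply,
      den_div_num, q_mul_den_div_den, q_mul_num_div_den, num_div_num, if_true, lt_irrefl, if_false]
    rw [show P.a d / P.bTail (p + 1) * Complex.exp (τ p) =
      Complex.exp (τ p) * P.a d / P.bTail (p + 1) by ring,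
      show (P.α d - P.βTail (p + 1)) * τ p = -((-P.α d + P.βTail (p + 1)) * τ p) by ring,
      Complex.exp_neg]
    have := Complex.exp_ne_zero ((-P.α d + P.βTail (p + 1)) * τ p)
    field_simp
  · simp only [blockIdx, pre, betaC, prod_erase_none, prod_erase_some, matBId, Matrix.of_apply,
      den_div_num, q_mul_den_div_den, q_mul_num_div_den, num_div_num, if_true,
      Nat.lt_succ_self, tailPow_eq_mul]
    rw [show P.q * P.bTail p / P.c k * Complex.exp (τ p) =
      Complex.exp (τ p) * P.q * P.bTail p / P.c k by ring,
      show (1 + P.βTail p - P.γ k) * τ p = (1 + P.βTail (p + 1) - P.γ k) * τ p + P.β p * τ p by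
        rw [βTail_eq_add]; ring,
      Complex.exp_add, neg_mul, Complex.exp_neg]
    have := Complex.exp_ne_zero (P.β p * τ p)
    field_simp
  · simp only [blockIdx, pre, betaC, prod_erase_some, matBId, Matrix.of_apply,
      den_div_num, q_mul_den_div_den, q_mul_num_div_den, num_div_num, if_true, and_self,
      Nat.lt_succ_self, lt_irrefl, if_false]
    rw [show P.q * P.a d / P.c k * Complex.exp (τ p) =
      Complex.exp (τ p) * P.q * P.a d / P.c k by ring,
      show (1 + P.βTail (p + 1) - P.γ k) * τ p = (1 + P.α d - P.γ k) * τ p +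
        (-P.α d + P.βTail (p + 1)) * τ p by ring, Complex.exp_add]
    field_simp

theorem prod_num_div_den (p : Fin M) :
    ∏ j, P.numPar p j / P.denPar p j = P.b p / P.q * P.ac := by
  rw [Fintype.prod_option, ac, ← prod_div_distrib]
  congr 1
  exact prod_congr rfl fun j _ => div_div_div_cancel_right₀ (P.bTail_ne_zero _) _ _

/-- The entries of `A^{p,id}` are the constants of the dual connection formula. -/
theorem matAId_blockIdx (p : Fin M) (τ : Fin M → ℂ) (j d : Option (Fin N))
    (h0 : theta P.q (Complex.exp (τ p) * P.b p * P.ac) ≠ 0) :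
    P.pre p τ (blockIdx p j) * (betaC P.q (fun j => (P.denPar p j)⁻¹) (fun j => (P.numPar p j)⁻¹) j d *
        theta P.q ((∏ j, P.numPar p j / P.denPar p j) * (P.denPar p d / P.numPar p j) *
          Complex.exp (τ p))) =
      theta P.q (Complex.exp (τ p) * P.b p * P.ac) *
        P.matAId p (τ p) (blockIdx p j) (blockIdx p d) * P.pre (p + 1) τ (blockIdx p d) := by
  have hq0 := P.q_ne_zero
  have hb := P.b_ne_zero p
  rw [prod_num_div_den, betaC_dual]
  rcases j with _ | k <;> rcases d with _ | d
  · simp only [blockIdx, pre, prod_erase_none, matAId, Matrix.of_apply, den_div_num,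
      q_mul_num_div_num, q_mul_num_div_den, den_div_den, tailPow_eq_mul]
    rw [show P.b p / P.q * P.ac * (P.q / P.b p) * Complex.exp (τ p) = Complex.exp (τ p) * P.ac by
      field_simp]
    generalize theta P.q (Complex.exp (τ p) * P.b p * P.ac) = D at h0 ⊢
    simp only [prod_div_distrib, prod_mul_distrib]
    field_simp
  · simp only [blockIdx, pre, prod_erase_none, prod_erase_some, matAId, Matrix.of_apply, den_div_num,
      q_mul_num_div_num, q_mul_num_div_den, den_div_den, tailPow_eq_mul, if_true,
      Nat.lt_succ_self]
    rw [show P.b p / P.q * P.ac * (P.c d / P.bTail p) * Complex.exp (τ p) =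
        Complex.exp (τ p) * P.ac * P.c d / (P.q * P.bTail (p + 1)) by
        rw [bTail_eq_mul]; field_simp,
      show (-1 - P.βTail p + P.γ d) * τ p = -P.β p * τ p -
        (1 + P.βTail (p + 1) - P.γ d) * τ p by rw [βTail_eq_add]; ring, Complex.exp_sub]
    generalize theta P.q (Complex.exp (τ p) * P.b p * P.ac) = D at h0 ⊢
    have := Complex.exp_ne_zero ((1 + P.βTail (p + 1) - P.γ d) * τ p)
    field_simp
  · simp only [blockIdx, pre, prod_erase_none, prod_erase_some, matAId, Matrix.of_apply, den_div_num,
      q_mul_num_div_num, q_mul_num_div_den, den_div_den, if_true,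
      lt_irrefl, if_false]
    rw [show P.b p / P.q * P.ac * (P.q * P.bTail (p + 1) / P.a k) * Complex.exp (τ p) =
        Complex.exp (τ p) * P.bTail p * P.ac / P.a k by
        rw [bTail_eq_mul]; field_simp]
    generalize theta P.q (Complex.exp (τ p) * P.b p * P.ac) = D at h0 ⊢
    field_simp
  · simp only [blockIdx, pre, prod_erase_some, matAId, Matrix.of_apply, den_div_num,
      q_mul_num_div_num, q_mul_num_div_den, den_div_den, if_true, and_self,
      Nat.lt_succ_self, lt_irrefl, if_false]
    rw [show P.b p / P.q * P.ac * (P.c d / P.a k) * Complex.exp (τ p) =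
        Complex.exp (τ p) * P.b p * P.ac * P.c d / (P.q * P.a k) by field_simp,
      show (-P.α k + P.βTail (p + 1)) * τ p = (-1 - P.α k + P.γ d) * τ p +
        (1 + P.βTail (p + 1) - P.γ d) * τ p by ring, Complex.exp_add]
    generalize theta P.q (Complex.exp (τ p) * P.b p * P.ac) = D at h0 ⊢
    field_simp

/-- `connection` for each choice of the other exponents. The multiplier is `θ(t_p)`, the denominator
of the entries of `B`; components `(k, l)` with `l ≠ p` have the same coefficients for `p` and `p +
1`. -/
theorem linkB (hq : ‖P.q‖ < 1) (h : P.Generic) (p : Fin M) :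
    Link P.regular (P.coef (p + 1)) (P.pre (p + 1)) (P.coef p) (P.pre p)
      fun τ => P.matBId p (τ p) := by
  have hq0 := P.q_ne_zero
  have hent : ∀ x ≠ 0, Entire (thetaC P.q (Pi.single p 1) x) := fun x hx τ =>
    summableAt_thetaC hq0 hq (single_ne_zero p) hx τ
  have hev : ∀ τ, ∀ x ≠ 0, ev (thetaC P.q (Pi.single p 1) x) τ =
      qInf P.q P.q * theta P.q (x * Complex.exp (τ p)) := fun τ x hx => by
    rw [ev_thetaC hq0 hq (single_ne_zero p) hx, mon_single]
  have hth : ∀ τ ∈ P.regular, theta P.q (Complex.exp (τ p)) ≠ 0 := fun τ hτ =>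
    NotPow.theta_ne_zero hq0 hq fun n => hτ.1 p n
  have hadm := fun m => admissible h p m
  have hx : ∀ j d, P.q * P.numPar p d / P.denPar p j ≠ 0 := fun j d =>
    div_ne_zero (mul_ne_zero hq0 ((hadm 0).A_ne d)) ((hadm 0).C_ne j)
  refine ⟨thetaC P.q (Pi.single p 1) 1, hent 1 one_ne_zero, fun τ hτ => ?_, fun ι => ?_⟩
  · rw [hev τ 1 one_ne_zero, one_mul]
    exact mul_ne_zero (qInf_self_ne_zero hq) (hth τ hτ)
  obtain ⟨j, rfl⟩ | ⟨k, l, hl, rfl⟩ := exists_blockIdx p ι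
  · refine RowLink.of_injective (blockIdx_injective p) (fun d m =>
      betaC P.q (P.numPar p) (P.denPar p) j d *
        thetaC P.q (Pi.single p 1) (P.q * P.numPar p d / P.denPar p j) m)
      (fun d => entire_const_mul _ (hent _ (hx j d))) ?_ (fun τ hτ d => ?_) fun τ κ hκ => ?_
    · funext m
      simp only [conv_const_mul, conv_thetaC hq h]
      rw [conv_thetaC_succ]
      simp only [one_zpow, mul_one]
      rw [connection hq0 hq (hadm m) j (m p), mul_sum]
      exact sum_congr rfl fun d _ => mul_left_comm _ _ _
    · rw [ev_const_mul, hev τ _ (hx j d), hev τ 1 one_ne_zero, one_mul]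
      linear_combination qInf P.q P.q * matBId_blockIdx p τ j d (hth τ hτ)
    · obtain ⟨j', rfl⟩ | ⟨k, l, hl, rfl⟩ := exists_blockIdx p κ
      · exact absurd ⟨j', rfl⟩ hκ
      · exact matBId_blockIdx_of_ne hl k j _
  · refine RowLink.of_eq (hent 1 one_ne_zero) (some (k, l)) (coef_succ_of_ne hl k)
      (pre_succ_of_ne hl k) (fun τ => ?_) fun τ κ hκ => ?_
    · exact (matBId_of_ne hl k _ _).trans (if_pos rfl)
    · exact (matBId_of_ne hl k _ _).trans (if_neg hκ)

/-- `connection_dual` in place of `connection`. Its multiplier has argument `q ∏_j A_j/C_j = b_p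
a_1⋯a_N/c_1⋯c_N` times `t_p`, the argument in the denominators of `A`. -/
theorem linkA (hq : ‖P.q‖ < 1) (h : P.Generic) (p : Fin M) :
    Link P.regular (P.coef p) (P.pre p) (P.coef (p + 1)) (P.pre (p + 1))
      fun τ => P.matAId p (τ p) := by
  have hq0 := P.q_ne_zero
  have hent : ∀ x ≠ 0, Entire (thetaC P.q (Pi.single p 1) x) := fun x hx τ =>
    summableAt_thetaC hq0 hq (single_ne_zero p) hx τ
  have hev : ∀ τ, ∀ x ≠ 0, ev (thetaC P.q (Pi.single p 1) x) τ =
      qInf P.q P.q * theta P.q (x * Complex.exp (τ p)) := fun τ x hx => by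
    rw [ev_thetaC hq0 hq (single_ne_zero p) hx, mon_single]
  have hth : ∀ τ ∈ P.regular, theta P.q (Complex.exp (τ p) * P.b p * P.ac) ≠ 0 := fun τ hτ =>
    NotPow.theta_ne_zero hq0 hq fun n => hτ.2.1 p n
  have hadm := fun m => admissible h p m
  have hE : P.q * ∏ j, P.numPar p j / P.denPar p j = P.b p * P.ac := by
    rw [prod_num_div_den]; field_simp
  have hE0 : P.b p * P.ac ≠ 0 := mul_ne_zero (P.b_ne_zero p) P.ac_ne_zero
  have hev0 : ∀ τ, ev (thetaC P.q (Pi.single p 1) (P.b p * P.ac)) τ =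
      qInf P.q P.q * theta P.q (Complex.exp (τ p) * P.b p * P.ac) := fun τ => by
    rw [hev τ _ hE0]
    congr 2
    ring
  have hx : ∀ j d, (∏ j, P.numPar p j / P.denPar p j) * (P.denPar p d / P.numPar p j) ≠ 0 :=
    fun j d => mul_ne_zero (prod_ne_zero_iff.mpr fun j _ =>
      div_ne_zero ((hadm 0).A_ne j) ((hadm 0).C_ne j))
      (div_ne_zero ((hadm 0).C_ne d) ((hadm 0).A_ne j))
  refine ⟨thetaC P.q (Pi.single p 1) (P.b p * P.ac), hent _ hE0, fun τ hτ => ?_, fun ι => ?_⟩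
  · rw [hev0]
    exact mul_ne_zero (qInf_self_ne_zero hq) (hth τ hτ)
  obtain ⟨j, rfl⟩ | ⟨k, l, hl, rfl⟩ := exists_blockIdx p ι
  · refine RowLink.of_injective (blockIdx_injective p) (fun d m =>
      betaC P.q (fun j => (P.denPar p j)⁻¹) (fun j => (P.numPar p j)⁻¹) j d *
        thetaC P.q (Pi.single p 1)
          ((∏ j, P.numPar p j / P.denPar p j) * (P.denPar p d / P.numPar p j)) m)
      (fun d => entire_const_mul _ (hent _ (hx j d))) ?_ (fun τ hτ d => ?_) fun τ κ hκ => ?_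
    · funext m
      simp only [conv_const_mul, conv_thetaC_succ]
      rw [conv_thetaC hq h, ← hE, connection_dual hq0 hq (hadm m) j (m p), mul_sum]
      exact sum_congr rfl fun d _ => mul_left_comm _ _ _
    · rw [ev_const_mul, hev τ _ (hx j d), hev0]
      linear_combination qInf P.q P.q * matAId_blockIdx p τ j d (hth τ hτ)
    · obtain ⟨j', rfl⟩ | ⟨k, l, hl, rfl⟩ := exists_blockIdx p κ
      · exact absurd ⟨j', rfl⟩ hκ
      · exact matAId_blockIdx_of_ne hl k j _
  · refine RowLink.of_eq (hent _ hE0) (some (k, l)) (coef_succ_of_ne hl k).symm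
      (fun τ => (pre_succ_of_ne hl k τ).symm) (fun τ => ?_) fun τ κ hκ => ?_
    · exact (matAId_of_ne hl k _ _).trans (if_pos rfl)
    · exact (matAId_of_ne hl k _ _).trans (if_neg hκ)

end Params

end QConn

end

noncomputable section

namespace QConn

open Finset Filter Topology

namespace Params

variable {N M : ℕ} (P : Params N M)

/-! ### The link between `u^{M,s_r}` and `u^{M,id}` -/

section Swap

variable (r : Fin (M - 1))

theorem lo_ne_hi : lo r ≠ hi r := fun h => by simpa [lo, hi] using congrArg Fin.val h

theorem s_lo : s r (lo r) = hi r := Equiv.swap_apply_left _ _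

theorem s_hi : s r (hi r) = lo r := Equiv.swap_apply_right _ _

theorem s_of_ne {i : Fin M} (h : i ≠ lo r) (h' : i ≠ hi r) : s r i = i :=
  Equiv.swap_apply_of_ne_of_ne h h'

/-- The positions `r` and `r + 1` lie on the same side of any other position `l`. -/
theorem lt_iff_of_s {l : Fin M} (h : l ≠ lo r) (h' : l ≠ hi r) (i : Fin M) :
    (s r i).val < l.val ↔ i.val < l.val := by
  have h1 : l.val ≠ r.val := fun e => h (Fin.ext e)
  have h2 : l.val ≠ r.val + 1 := fun e => h' (Fin.ext e)
  by_cases hi1 : i = lo r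
  · rw [hi1, s_lo]; simp only [lo, hi]; omega
  by_cases hi2 : i = hi r
  · rw [hi2, s_hi]; simp only [lo, hi]; omega
  · rw [s_of_ne r hi1 hi2]

theorem le_iff_of_s {L : ℕ} (h : L ≠ r.val + 1) (i : Fin M) :
    L ≤ (s r i).val ↔ L ≤ i.val := by
  by_cases hi1 : i = lo r
  · rw [hi1, s_lo]; simp only [lo, hi]; omega
  by_cases hi2 : i = hi r
  · rw [hi2, s_hi]; simp only [lo, hi]; omega
  · rw [s_of_ne r hi1 hi2]

theorem sum_filter_comp_s {A : Type*} [AddCommMonoid A] {L : ℕ} (h : L ≠ r.val + 1) (f : Fin M → A) :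
    ∑ i : Fin M with L ≤ i.val, f (s r i) = ∑ i : Fin M with L ≤ i.val, f i :=
  sum_equiv (s r) (fun i => by simp [le_iff_of_s r h]) fun _ _ => rfl

theorem prod_filter_comp_s {A : Type*} [CommMonoid A] {L : ℕ} (h : L ≠ r.val + 1) (f : Fin M → A) :
    ∏ i : Fin M with L ≤ i.val, f (s r i) = ∏ i : Fin M with L ≤ i.val, f i :=
  prod_equiv (s r) (fun i => by simp [le_iff_of_s r h]) fun _ _ => rfl

theorem bTail_perm_s {L : ℕ} (h : L ≠ r.val + 1) : (P.perm (s r)).bTail L = P.bTail L :=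
  prod_filter_comp_s r h P.b

theorem βTail_perm_s {L : ℕ} (h : L ≠ r.val + 1) : (P.perm (s r)).βTail L = P.βTail L :=
  sum_filter_comp_s r h P.β

theorem tailPow_perm_s {L : ℕ} (h : L ≠ r.val + 1) (τ : Fin M → ℂ) :
    (P.perm (s r)).tailPow L (τ ∘ s r) = P.tailPow L τ :=
  prod_filter_comp_s r h fun i => Complex.exp (-P.β i * τ i)

theorem bTail_lo_succ : P.bTail (lo r + 1) = P.b (hi r) * P.bTail (r + 2) := P.bTail_eq_mul (hi r)

theorem bTail_perm_lo_succ : (P.perm (s r)).bTail (lo r + 1) = P.b (lo r) * P.bTail (r + 2) := by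
  rw [bTail_lo_succ, bTail_perm_s P r (by omega), perm_b, s_hi]

theorem βTail_lo_succ : P.βTail (lo r + 1) = P.β (hi r) + P.βTail (r + 2) := P.βTail_eq_add (hi r)

theorem wt_perm_s {l : Fin M} (h : l ≠ lo r) (h' : l ≠ hi r) (i : Fin M) (e : ℤ) :
    (P.perm (s r)).wt l i e = P.wt l (s r i) e := by
  simp only [wt, perm_b, perm_q, lt_iff_of_s r h h']

theorem sum_comp_s (e : Fin M → ℤ) : ∑ i, (e ∘ s r) i = ∑ i, e i := Equiv.sum_comp (s r) e

theorem prod_erase_comp_s {l : Fin M} (h : l ≠ lo r) (h' : l ≠ hi r) (f : Fin M → ℂ) :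
    ∏ i ∈ univ.erase l, f (s r i) = ∏ i ∈ univ.erase l, f i := by
  refine prod_equiv (s r) (fun i => ?_) fun _ _ => rfl
  rw [mem_erase, mem_erase, ← (s r).injective.ne_iff, s_of_ne r h h']
  simp

theorem coefG_perm_of_ne {l : Fin M} (h : l ≠ lo r) (h' : l ≠ hi r) (k : Fin N) (e : Fin M → ℤ) :
    (P.perm (s r)).coefG k l (e ∘ s r) = P.coefG k l e := by
  have h1 : l.val ≠ r.val := fun e => h (Fin.ext e)
  have h2 : l.val ≠ r.val + 1 := fun e => h' (Fin.ext e)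
  simp only [coefG, perm_q, perm_a, perm_c, sum_comp_s]
  simp only [wt_perm_s P r h h', bTail_perm_s P r h2,
    bTail_perm_s P r (show l.val + 1 ≠ r.val + 1 by omega), Function.comp_apply, s_of_ne r h h',
    prod_erase_comp_s r h h' fun i => P.wt l i (e i)]

/-- At `L = M` all variables play the same role in `𝓕^M` and `b_{≥M+1} = 1`, so the series is
symmetric. This is why the order of the variables is changed at `L = M` only. -/
theorem coefF₀_perm (e : Fin M → ℤ) : (P.perm (s r)).coefF₀ M (e ∘ s r) = P.coefF₀ M e := by
  simp only [coefF₀, perm_q, perm_a, perm_c, sum_comp_s, bTail_of_le _ le_rfl]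
  congr 1
  refine Fintype.prod_equiv (s r) _ _ fun i => ?_
  simp only [wt, perm_b, perm_q, Fin.is_lt, if_true, Function.comp_apply]

/-- The exponents of `t_r` and `t_{r+1}` do not enter this factor. -/
def restSwap (k : Fin N) (e : Fin M → ℤ) : ℂ :=
  (∏ j, qPoch P.q (P.q * P.a j / P.c k) (∑ i, e i) / qPoch P.q (P.q * P.c j / P.c k) (∑ i, e i)) *
    ∏ i ∈ (univ.erase (lo r)).erase (hi r), P.wt r i (e i)

theorem coefG_lo (k : Fin N) (e : Fin M → ℤ) :
    P.coefG k (lo r) e = P.restSwap r k e *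
      (qPoch P.q (P.q * P.bTail r / P.c k) (e (lo r)) /
        qPoch P.q (P.q ^ 2 * P.bTail (lo r + 1) / P.c k) (e (lo r))) *
      (qPoch P.q (P.b (hi r)) (-e (hi r)) / qPoch P.q P.q (-e (hi r)) *
        (P.b (hi r) / P.q) ^ e (hi r)) := by
  have hw : P.wt (lo r) (hi r) (e (hi r)) = qPoch P.q (P.b (hi r)) (-e (hi r)) /
      qPoch P.q P.q (-e (hi r)) * (P.b (hi r) / P.q) ^ e (hi r) := by
    rw [wt, if_neg (by simp [lo, hi])]
  rw [coefG, ← mul_prod_erase _ _ (mem_erase.mpr ⟨(lo_ne_hi r).symm, mem_univ (hi r)⟩), hw,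
    restSwap]
  simp only [lo]
  ring

theorem coefG_hi (k : Fin N) (e : Fin M → ℤ) :
    P.coefG k (hi r) e = P.restSwap r k e *
      (qPoch P.q (P.b (lo r)) (e (lo r)) / qPoch P.q P.q (e (lo r))) *
      (qPoch P.q (P.q * P.bTail (lo r + 1) / P.c k) (e (hi r)) /
        qPoch P.q (P.q ^ 2 * P.bTail (r + 2) / P.c k) (e (hi r))) := by
  have hw : P.wt (hi r) (lo r) (e (lo r)) = qPoch P.q (P.b (lo r)) (e (lo r)) /
      qPoch P.q P.q (e (lo r)) := by
    rw [wt, if_pos (by simp [lo, hi])]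
  have hw' : ∀ i ∈ (univ.erase (lo r)).erase (hi r), P.wt (hi r) i (e i) = P.wt r i (e i) :=
    fun i hi' => by
      have h1 := ne_of_mem_erase hi'
      have h2 := ne_of_mem_erase (mem_of_mem_erase hi')
      have h3 : i.val ≠ r.val := fun e => h2 (Fin.ext e)
      simp only [wt, show (i.val < (hi r).val) = (i.val < r.val) by
        simp only [hi]; rw [eq_iff_iff]; omega]
  rw [coefG, ← mul_prod_erase _ _ (mem_erase.mpr ⟨lo_ne_hi r, mem_univ (lo r)⟩), hw,
    erase_right_comm, prod_congr rfl hw', restSwap]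
  simp only [lo, hi]
  ring

theorem restSwap_perm (k : Fin N) (e : Fin M → ℤ) :
    (P.perm (s r)).restSwap r k (e ∘ s r) = P.restSwap r k e := by
  simp only [restSwap, perm_q, perm_a, perm_c, sum_comp_s]
  congr 1
  refine prod_congr rfl fun i hi' => ?_
  have h1 := ne_of_mem_erase hi'
  have h2 := ne_of_mem_erase (mem_of_mem_erase hi')
  simp only [wt, perm_b, perm_q, Function.comp_apply, s_of_ne r h2 h1]

/-- The direction in which the exponents are shifted. -/
def swapDir : Fin M → ℤ := Pi.single (lo r) 1 - Pi.single (hi r) 1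

theorem swapDir_lo : swapDir r (lo r) = 1 := by
  simp [swapDir, Pi.single_eq_of_ne (lo_ne_hi r)]

theorem swapDir_hi : swapDir r (hi r) = -1 := by
  simp [swapDir, Pi.single_eq_of_ne (lo_ne_hi r).symm]

theorem swapDir_of_ne {i : Fin M} (h : i ≠ lo r) (h' : i ≠ hi r) : swapDir r i = 0 := by
  simp [swapDir, Pi.single_eq_of_ne h, Pi.single_eq_of_ne h']

theorem swapDir_ne_zero : swapDir r ≠ 0 := fun h => by
  have := congrFun h (lo r)
  rw [swapDir_lo] at this
  exact one_ne_zero this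

theorem sum_swapDir : ∑ i, swapDir r i = 0 := by
  simp [swapDir, sum_sub_distrib]

theorem mon_swapDir (τ : Fin M → ℂ) :
    mon (swapDir r) τ = Complex.exp (τ (lo r) - τ (hi r)) := by
  rw [mon]
  congr 1
  simp [swapDir, sub_mul, sum_sub_distrib, Pi.single_apply, apply_ite (fun n : ℤ => (n : ℂ))]

/-- The exponents of `t_r` and `t_{r+1}` enter only through the total degree, which the direction
`swapDir` preserves. -/
theorem restSwap_sub (k : Fin N) (m : Fin M → ℤ) (t : ℤ) :
    P.restSwap r k (m - t • swapDir r) = P.restSwap r k m := by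
  have hs : ∑ i, (m - t • swapDir r) i = ∑ i, m i := by
    simp [sum_sub_distrib, ← mul_sum, sum_swapDir]
  rw [restSwap, restSwap, hs]
  congr 1
  refine prod_congr rfl fun i hi' => ?_
  have h1 := ne_of_mem_erase hi'
  have h2 := ne_of_mem_erase (mem_of_mem_erase hi')
  simp [swapDir_of_ne r h2 h1]

/-- Numerator parameters of the one variable connection problem in `t_r/t_{r+1}`. -/
def swapNum (k : Fin N) : Bool → ℂ
  | false => P.q * P.bTail r / P.c k
  | true => P.b (hi r)

/-- Denominator parameters of the one variable connection problem in `t_r/t_{r+1}`. -/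
def swapDen (k : Fin N) : Bool → ℂ
  | false => P.q ^ 2 * P.bTail (lo r + 1) / P.c k
  | true => P.q

/-- Shifts of the parameters. -/
def swapShift (e : Fin M → ℤ) : Bool → ℤ
  | false => 0
  | true => -(e (lo r) + e (hi r))

theorem bTail_r : P.bTail r = P.b (lo r) * (P.b (hi r) * P.bTail (r + 2)) := by
  rw [← bTail_lo_succ]
  exact P.bTail_eq_mul (lo r)

end Swap

variable {P}

/-- The ratio of the two numerator parameters involves `c_k/(b_r b_{r+2}⋯b_M)`, a tail product only
in the exchanged order; hence the genericity of `P.perm (s r)`. -/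
theorem swap_admissible (h : P.Generic) (r : Fin (M - 1)) (h' : (P.perm (s r)).Generic) (k : Fin N)
    (e : Fin M → ℤ) : Admissible P.q (P.swapNum r k) (P.swapDen r k) (swapShift r e) := by
  have hq0 := P.q_ne_zero
  have hc := P.c_ne_zero k
  have hb := P.b_ne_zero (lo r)
  have hb' := P.b_ne_zero (hi r)
  have ht := P.bTail_ne_zero (r + 2)
  have n1 : NotPow P.q (P.c k / (P.b (lo r) * P.bTail (r + 2))) := by
    have := h'.c_div_bTail k (lo r + 1)
    rwa [bTail_perm_lo_succ] at this
  have n2 : NotPow P.q (P.c k / (P.b (hi r) * P.bTail (r + 2))) := by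
    have := h.c_div_bTail k (lo r + 1)
    rwa [bTail_lo_succ] at this
  have n3 : NotPow P.q (P.c k / (P.b (lo r) * (P.b (hi r) * P.bTail (r + 2)))) := by
    have := h.c_div_bTail k r
    rwa [bTail_r] at this
  have n4 : NotPow P.q (P.c k / P.bTail (r + 2)) := h.c_div_bTail k (r + 2)
  refine ⟨fun j => ?_, fun j => ?_, fun j d hjd => ?_, fun j d hjd => ?_, fun j d hn => ?_⟩
  · cases j
    · exact div_ne_zero (mul_ne_zero hq0 (P.bTail_ne_zero _)) hc
    · exact hb'
  · cases j
    · exact div_ne_zero (mul_ne_zero (pow_ne_zero 2 hq0) (P.bTail_ne_zero _)) hc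
    · exact hq0
  · rcases j <;> rcases d <;> simp only [swapNum, bTail_r]
    · exact absurd rfl hjd
    · exact n1.congr_inv hq0 1 (by field_simp)
    · exact n1.congr_zpow hq0 (-1) (by field_simp)
    · exact absurd rfl hjd
  · rcases j <;> rcases d <;> simp only [swapDen, bTail_lo_succ]
    · exact absurd rfl hjd
    · exact n2.congr_inv hq0 1 (by field_simp)
    · exact n2.congr_zpow hq0 (-1) (by field_simp)
    · exact absurd rfl hjd
  · rcases j <;> rcases d <;> simp only [swapNum, swapDen, bTail_r, bTail_lo_succ]
    · exact absurd rfl hn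
    · exact n3.congr_inv hq0 0 (by field_simp)
    · exact n4.congr_zpow hq0 (-2) (by rw [zpow_neg]; field_simp)
    · exact absurd rfl hn

/-- The components of `u^{M,id}` which belong to the solutions at `0`. -/
def phiPos (r : Fin (M - 1)) : Bool → Fin M
  | false => hi r
  | true => lo r

/-- The components of `u^{M,s_r}` which belong to the solutions at `∞`. -/
def chiPos (r : Fin (M - 1)) : Bool → Fin M
  | false => lo r
  | true => hi r

/-- With the other exponents and the sum of the exponents of `t_r`, `t_{r+1}` fixed, the components
at positions `r` and `r + 1` of `u^{M,id}` are the two solutions at `t_r/t_{r+1} = 0` of an equation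
of order 2. The power of `b_{r+1}/q` rescales the variable. -/
theorem swap_coefG (hq : ‖P.q‖ < 1) (h : P.Generic) (r : Fin (M - 1)) (k : Fin N) (j : Bool)
    (e : Fin M → ℤ) : P.coefG k (phiPos r j) e =
      P.restSwap r k e * (P.b (hi r) / P.q) ^ e (hi r) *
        phiC P.q (P.swapNum r k) (P.swapDen r k) (swapShift r e) j (e (lo r)) := by
  have hq0 := P.q_ne_zero
  have hc := P.c_ne_zero k
  have hb := P.b_ne_zero (lo r)
  have hb' := P.b_ne_zero (hi r)
  have ht := P.bTail_ne_zero (r + 2)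
  have hz : (P.b (hi r) / P.q) ^ e (hi r) ≠ 0 := zpow_ne_zero _ (div_ne_zero hb' hq0)
  have hs : e (lo r) + -(e (lo r) + e (hi r)) = -e (hi r) := by ring
  cases j
  · have hx : NotPow P.q (P.c k / (P.q * P.bTail (r + 2))) := h.c_div_q_mul_bTail k (r + 2)
    have hy : NotPow P.q (P.c k / P.bTail (lo r + 1)) := h.c_div_bTail k _
    have hr := NotPow.qPoch_neg_div hq0 hq (div_ne_zero hc (mul_ne_zero hq0 ht))
      (div_ne_zero hc (P.bTail_ne_zero _)) hx hy (e (hi r))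
    rw [show P.c k / P.bTail (lo r + 1) / (P.c k / (P.q * P.bTail (r + 2))) =
        (P.b (hi r) / P.q)⁻¹ by rw [bTail_lo_succ]; field_simp, div_div_eq_mul_div,
      div_div_eq_mul_div, inv_zpow] at hr
    simp only [phiPos, phiC, Fintype.prod_bool, swapShift, hs, add_zero, coefG_hi]
    simp only [swapNum, swapDen]
    rw [show P.q * P.b (hi r) / (P.q ^ 2 * P.bTail (lo r + 1) / P.c k) =
        P.c k / (P.q * P.bTail (r + 2)) by rw [bTail_lo_succ]; field_simp,
      show P.q * P.q / (P.q ^ 2 * P.bTail (lo r + 1) / P.c k) = P.c k / P.bTail (lo r + 1) by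
        rw [bTail_lo_succ]; field_simp, hr,
      show P.q * (P.q * P.bTail r / P.c k) / (P.q ^ 2 * P.bTail (lo r + 1) / P.c k) = P.b (lo r) by
        rw [bTail_r, bTail_lo_succ]; field_simp,
      show P.q * (P.q ^ 2 * P.bTail (lo r + 1) / P.c k) / (P.q ^ 2 * P.bTail (lo r + 1) / P.c k) =
        P.q by rw [bTail_lo_succ]; field_simp,
      show P.q * (P.q * P.bTail (r + 2)) / P.c k = P.q ^ 2 * P.bTail (r + 2) / P.c k by ring]
    field_simp
  · simp only [phiPos, phiC, Fintype.prod_bool, swapShift, hs, add_zero, coefG_lo]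
    simp only [swapNum, swapDen]
    rw [mul_div_cancel_left₀ _ hq0, mul_div_cancel_left₀ _ hq0, mul_div_cancel_left₀ _ hq0,
      mul_div_cancel_left₀ _ hq0]
    ring

/-- The exchanged order corresponds to `t_{r+1}/t_r` small, that is, to the solutions at `∞` of the
same equation, with the same prefactors. -/
theorem swap_coefG_perm (hq : ‖P.q‖ < 1) (h : P.Generic) (r : Fin (M - 1))
    (h' : (P.perm (s r)).Generic) (k : Fin N) (j : Bool) (e : Fin M → ℤ) :
    (P.perm (s r)).coefG k (chiPos r j) (e ∘ s r) =
      P.restSwap r k e * (P.b (hi r) / P.q) ^ e (hi r) *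
        chiC P.q (P.swapNum r k) (P.swapDen r k) (swapShift r e) j (e (lo r)) := by
  have hq0 := P.q_ne_zero
  have hc := P.c_ne_zero k
  have hb := P.b_ne_zero (lo r)
  have hb' := P.b_ne_zero (hi r)
  have ht := P.bTail_ne_zero (r + 2)
  have hz : (P.b (hi r) / P.q) ^ e (hi r) ≠ 0 := zpow_ne_zero _ (div_ne_zero hb' hq0)
  have hs : -(e (lo r) + -(e (lo r) + e (hi r))) = e (hi r) := by ring
  have q1 : P.swapDen r k true / P.swapNum r k true = (P.b (hi r) / P.q)⁻¹ := by
    rw [inv_div]; rfl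
  have q2 : P.swapDen r k false / P.swapNum r k false = (P.b (lo r) / P.q)⁻¹ := by
    simp only [swapNum, swapDen, bTail_r, bTail_lo_succ]
    field_simp
  have hzp : ((P.b (lo r) / P.q)⁻¹) ^ (-e (lo r)) = (P.b (lo r) / P.q) ^ e (lo r) := by
    rw [inv_zpow, zpow_neg, inv_inv]
  have d1 : P.q * P.swapNum r k false / P.swapDen r k false = P.b (lo r) := by
    simp only [swapNum, swapDen, bTail_r, bTail_lo_succ]
    field_simp
  have d2 : P.q * P.swapNum r k false / P.swapNum r k false = P.q := by
    simp only [swapNum, bTail_r]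
    field_simp
  have d3 : P.q * P.swapNum r k false / P.swapDen r k true = P.q * P.bTail r / P.c k :=
    mul_div_cancel_left₀ _ hq0
  have d4 : P.q * P.swapNum r k false / P.swapNum r k true =
      P.q ^ 2 * (P.b (lo r) * P.bTail (r + 2)) / P.c k := by
    simp only [swapNum, bTail_r]
    field_simp
  have d5 : P.q * P.swapNum r k true / P.swapDen r k false = P.c k / (P.q * P.bTail (r + 2)) := by
    simp only [swapNum, swapDen, bTail_lo_succ]
    field_simp
  have d6 : P.q * P.swapNum r k true / P.swapNum r k false =
      P.c k / (P.b (lo r) * P.bTail (r + 2)) := by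
    simp only [swapNum, bTail_r]
    field_simp
  have d7 : P.q * P.swapNum r k true / P.swapDen r k true = P.b (hi r) :=
    mul_div_cancel_left₀ _ hq0
  have d8 : P.q * P.swapNum r k true / P.swapNum r k true = P.q := mul_div_cancel_right₀ _ hb'
  cases j
  · simp only [chiPos, chiC, Fintype.prod_bool, q1, q2, d1, d2, d3, d4, swapShift, hs, add_zero,
      coefG_lo, hzp, restSwap_perm, perm_q, perm_c, perm_b, bTail_perm_lo_succ, Function.comp_apply,
      s_lo, s_hi, bTail_perm_s P r (show r.val ≠ r.val + 1 by omega), inv_zpow]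
    field_simp
  · have hr := NotPow.qPoch_neg_div hq0 hq (div_ne_zero hc (mul_ne_zero hq0 ht))
      (div_ne_zero hc (mul_ne_zero hb ht)) (h.c_div_q_mul_bTail k (r + 2))
      (by rw [← bTail_perm_lo_succ]; exact h'.c_div_bTail k _) (e (lo r))
    rw [show P.c k / (P.b (lo r) * P.bTail (r + 2)) / (P.c k / (P.q * P.bTail (r + 2))) =
        (P.b (lo r) / P.q)⁻¹ by field_simp, div_div_eq_mul_div,
      div_div_eq_mul_div, inv_zpow, show P.q * (P.q * P.bTail (r + 2)) / P.c k =
        P.q ^ 2 * P.bTail (r + 2) / P.c k by ring] at hr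
    have hz' : (P.b (lo r) / P.q) ^ e (lo r) ≠ 0 := zpow_ne_zero _ (div_ne_zero hb hq0)
    simp only [chiPos, chiC, Fintype.prod_bool, q1, q2, d5, d6, d7, d8, swapShift, hs, add_zero,
      coefG_hi, hzp, restSwap_perm, perm_q, perm_c, perm_b, bTail_perm_lo_succ, Function.comp_apply,
      s_lo, s_hi, bTail_perm_s P r (show r.val + 2 ≠ r.val + 1 by omega), inv_zpow, hr]
    field_simp

theorem swapShift_sub (r : Fin (M - 1)) (m : Fin M → ℤ) (t : ℤ) :
    swapShift r (m - t • swapDir r) = swapShift r m := by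
  funext j
  cases j
  · rfl
  · simp only [swapShift, Pi.sub_apply, Pi.smul_apply, swapDir_lo, swapDir_hi, smul_eq_mul]
    ring

/-- A step along `swapDir` lowers the exponent of `t_r` and raises that of `t_{r+1}`; the resulting
power of `y` is absorbed into the argument of theta. -/
theorem conv_thetaC_swap_aux {q x y : ℂ} (hy : y ≠ 0) (r : Fin (M - 1)) {C : (Fin M → ℤ) → ℂ}
    {Q : (Fin M → ℤ) → ℂ} {f : (Bool → ℤ) → ℤ → ℂ}
    (hQ : ∀ (m : Fin M → ℤ) (t : ℤ), Q (m - t • swapDir r) = Q m)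
    (hC : ∀ e, C e = Q e * y ^ e (hi r) * f (swapShift r e) (e (lo r))) (m : Fin M → ℤ) :
    conv (thetaC q (swapDir r) x) C m =
      Q m * y ^ m (hi r) * ∑' t : ℤ, vth q t * (x * y) ^ t * f (swapShift r m) (m (lo r) - t) := by
  rw [thetaC, conv_line (swapDir_ne_zero r), ← tsum_mul_left]
  refine tsum_congr fun t => ?_
  rw [hC, hQ, swapShift_sub]
  simp only [Pi.sub_apply, Pi.smul_apply, swapDir_lo, swapDir_hi, smul_eq_mul, mul_one, mul_neg,
    sub_neg_eq_add]
  rw [zpow_add₀ hy, mul_zpow]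
  ring

theorem exists_pos (r : Fin (M - 1)) (ι : Idx N M) :
    (∃ k j, ι = some (k, chiPos r j)) ∨ ι = none ∨
      ∃ k l, l ≠ lo r ∧ l ≠ hi r ∧ ι = some (k, l) := by
  rcases ι with _ | ⟨k, l⟩
  · exact Or.inr (Or.inl rfl)
  · by_cases h1 : l = lo r
    · exact Or.inl ⟨k, false, by rw [h1]; rfl⟩
    by_cases h2 : l = hi r
    · exact Or.inl ⟨k, true, by rw [h2]; rfl⟩
    · exact Or.inr (Or.inr ⟨k, l, h1, h2, rfl⟩)

theorem phiPos_injective (r : Fin (M - 1)) (k : Fin N) :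
    Function.Injective fun d => (some (k, phiPos r d) : Idx N M) := by
  have := lo_ne_hi r
  rintro (_ | _) (_ | _) h
  · rfl
  · exact absurd (congrArg Prod.snd (Option.some_injective _ h)) this.symm
  · exact absurd (congrArg Prod.snd (Option.some_injective _ h)) this
  · rfl

theorem betaC_bool (q : ℂ) (A C : Bool → ℂ) (k d : Bool) :
    betaC q (fun j => (C j)⁻¹) (fun j => (A j)⁻¹) k d =
      qInf q (C d / A !k) / qInf q (q * A k / A !k) *
        (qInf q (q * A k / C !d) / qInf q (C d / C !d)) := by
  have he : ∀ k : Bool, (univ.erase k : Finset Bool) = {!k} := by decide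
  rw [betaC_dual, he, he, prod_singleton, prod_singleton]

theorem pre_lo (r : Fin (M - 1)) (k : Fin N) (τ : Fin M → ℂ) :
    P.pre M τ (some (k, lo r)) = Complex.exp ((1 + (P.β (hi r) + P.βTail (r + 2)) - P.γ k) * τ (lo r)
      - P.β (hi r) * τ (hi r)) * P.tailPow (r + 2) τ := by
  have : P.tailPow (lo r + 1) τ = _ := tailPow_eq_mul (hi r) τ
  rw [pre, if_pos (Fin.is_lt _), βTail_lo_succ, this, ← mul_assoc, ← Complex.exp_add]
  simp only [hi]
  congr 2
  ring

theorem pre_hi (r : Fin (M - 1)) (k : Fin N) (τ : Fin M → ℂ) :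
    P.pre M τ (some (k, hi r)) = Complex.exp ((1 + P.βTail (r + 2) - P.γ k) * τ (hi r)) *
      P.tailPow (r + 2) τ := by
  rw [pre, if_pos (Fin.is_lt _)]
  rfl

theorem matSId_of_ne {r : Fin (M - 1)} {l : Fin M} (h : l ≠ lo r) (h' : l ≠ hi r) (k : Fin N) (x : ℂ)
    (κ : Idx N M) : P.matSId r x (some (k, l)) κ = if κ = some (k, l) then 1 else 0 := by
  rcases κ with _ | ⟨d, l'⟩
  · simp [matSId]
  · by_cases hk : k = d
    · subst hk
      simp [matSId, h, h', eq_comm (a := l')]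
    · simp [matSId, hk, Ne.symm hk]

theorem matSId_none (r : Fin (M - 1)) (x : ℂ) (κ : Idx N M) :
    P.matSId r x none κ = if κ = none then 1 else 0 := by
  rcases κ with _ | ⟨d, l'⟩ <;> simp [matSId]

theorem matSId_eq_zero (r : Fin (M - 1)) (x : ℂ) (k : Fin N) (j : Bool) {κ : Idx N M}
    (hκ : κ ∉ Set.range fun d => (some (k, phiPos r d) : Idx N M)) :
    P.matSId r x (some (k, chiPos r j)) κ = 0 := by
  rcases κ with _ | ⟨d, l'⟩
  · simp [matSId]
  · by_cases hk : k = d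
    · subst hk
      have h1 : l' ≠ lo r := fun h => hκ ⟨true, by rw [h]; rfl⟩
      have h2 : l' ≠ hi r := fun h => hκ ⟨false, by rw [h]; rfl⟩
      cases j <;> simp [matSId, h1, h2, chiPos, h1.symm, h2.symm]
    · simp [matSId, hk]

theorem mul_theta_exp_aux {D κ κ' θ θ' X Y Z T : ℂ} (hD : D ≠ 0) (hθ : θ = θ') (hκ : κ = κ')
    (h : X = Y + Z) : Complex.exp X * T * (κ * θ) =
      D * (κ' * (θ' / D) * Complex.exp Y) * (Complex.exp Z * T) := by
  rw [hθ, hκ, h, Complex.exp_add]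
  field_simp

/-- The entries of `S_{s_r}^{M,id}` are the constants of the dual connection formula. -/
theorem matSId_pos (r : Fin (M - 1)) (τ : Fin M → ℂ) (k : Fin N) (j d : Bool)
    (h0 : theta P.q (Complex.exp (τ (lo r) - τ (hi r)) * P.b (lo r)) ≠ 0) :
    (P.perm (s r)).pre M (τ ∘ s r) (some (k, chiPos r j)) *
      (betaC P.q (fun j => (P.swapDen r k j)⁻¹) (fun j => (P.swapNum r k j)⁻¹) j d *
        theta P.q (P.b (lo r) / P.q * (P.swapDen r k d / P.swapNum r k j) *
          Complex.exp (τ (lo r) - τ (hi r)))) =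
      theta P.q (Complex.exp (τ (lo r) - τ (hi r)) * P.b (lo r)) *
        P.matSId r (τ (lo r) - τ (hi r)) (some (k, chiPos r j)) (some (k, phiPos r d)) *
        P.pre M τ (some (k, phiPos r d)) := by
  have hq0 := P.q_ne_zero
  have hc := P.c_ne_zero k
  have hb := P.b_ne_zero (lo r)
  have hb' := P.b_ne_zero (hi r)
  have ht := P.bTail_ne_zero (r + 2)
  have hlh := lo_ne_hi r
  have hB1 : P.bTail (r + 1) = P.b (hi r) * P.bTail (r + 2) := P.bTail_lo_succ r
  have hβ0 : P.βTail r = P.β (lo r) + (P.β (hi r) + P.βTail (r + 2)) := by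
    rw [← βTail_lo_succ]; exact P.βTail_eq_add (lo r)
  have hT : (P.perm (s r)).tailPow (r + 2) (τ ∘ s r) = P.tailPow (r + 2) τ :=
    tailPow_perm_s P r (by omega) τ
  have hγ : (P.perm (s r)).γ k = P.γ k := rfl
  have hβ1 : (P.perm (s r)).β (hi r) = P.β (lo r) := congrArg P.β (s_hi r)
  have hβ2 : (P.perm (s r)).βTail (r + 2) = P.βTail (r + 2) := βTail_perm_s P r (by omega)
  rw [betaC_bool]
  generalize hD : theta P.q (Complex.exp (τ (lo r) - τ (hi r)) * P.b (lo r)) = D at h0 ⊢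
  rcases j with _ | _ <;> rcases d with _ | _ <;>
    simp only [chiPos, phiPos, pre_lo, pre_hi, hT, hγ, hβ1, hβ2, Function.comp_apply, s_lo, s_hi,
      swapNum, swapDen, Bool.not_false, Bool.not_true, matSId, Matrix.of_apply, if_true, and_true,
      hlh, hlh.symm, if_false, and_false, hD, bTail_r, bTail_lo_succ, hB1, hβ0]
  all_goals
    refine mul_theta_exp_aux h0 (congrArg _ (by field_simp)) ?_ (by ring)
    rw [div_mul_div_comm]
    refine congrArg₂ (· / ·) (congrArg₂ (· * ·) (congrArg _ ?_) (congrArg _ ?_))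
      (congrArg₂ (· * ·) (congrArg _ ?_) (congrArg _ ?_)) <;> field_simp

/-- `connection_dual` with two parameters, for each `k`. The multiplier is `θ(b_r t_r/t_{r+1})`:
after rescaling by `b_{r+1}/q` its argument is the required `q ∏_j A_j/C_j`. The component `0` and
those at other positions are symmetric in the two variables. -/
theorem linkS (hq : ‖P.q‖ < 1) (h : P.Generic) (r : Fin (M - 1)) (h' : (P.perm (s r)).Generic) :
    Link P.regular (fun ι => pull (s r) ((P.perm (s r)).coef M ι))
      (fun τ => (P.perm (s r)).pre M (τ ∘ s r)) (P.coef M) (P.pre M)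
      fun τ => P.matSId r (τ (lo r) - τ (hi r)) := by
  have hq0 := P.q_ne_zero
  have hb := P.b_ne_zero (lo r)
  have hb' := P.b_ne_zero (hi r)
  have hy : P.b (hi r) / P.q ≠ 0 := div_ne_zero hb' hq0
  have hv := swapDir_ne_zero r
  have hent : ∀ x ≠ 0, Entire (thetaC P.q (swapDir r) x) := fun x hx τ =>
    summableAt_thetaC hq0 hq hv hx τ
  have hev : ∀ τ, ∀ x ≠ 0, ev (thetaC P.q (swapDir r) x) τ =
      qInf P.q P.q * theta P.q (x * Complex.exp (τ (lo r) - τ (hi r))) := fun τ x hx => by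
    rw [ev_thetaC hq0 hq hv hx, mon_swapDir]
  have hth : ∀ τ ∈ P.regular,
      theta P.q (Complex.exp (τ (lo r) - τ (hi r)) * P.b (lo r)) ≠ 0 := fun τ hτ =>
    NotPow.theta_ne_zero hq0 hq fun n hn => hτ.2.2 (lo r) (hi r) (lo_ne_hi r) n (by
      rw [← hn, Complex.exp_sub]; ring)
  have hcoef : ∀ k l, P.coef M (some (k, l)) = P.coefG k l := fun k l => by
    rw [coef, if_pos (Fin.is_lt l)]
  have hcoef' : ∀ k l, (P.perm (s r)).coef M (some (k, l)) = (P.perm (s r)).coefG k l :=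
    fun k l => by rw [coef, if_pos (Fin.is_lt l)]
  refine ⟨thetaC P.q (swapDir r) (P.b (lo r)), hent _ hb, fun τ hτ => ?_, fun ι => ?_⟩
  · rw [hev τ _ hb, mul_comm (P.b _)]
    exact mul_ne_zero (qInf_self_ne_zero hq) (hth τ hτ)
  obtain ⟨k, j, rfl⟩ | rfl | ⟨k, l, h1, h2, rfl⟩ := exists_pos r ι
  · have hadm := fun m => swap_admissible h r h' k m
    have hx : ∀ d, P.b (lo r) / P.q * (P.swapDen r k d / P.swapNum r k j) ≠ 0 := fun d =>
      mul_ne_zero (div_ne_zero hb hq0) (div_ne_zero ((hadm 0).C_ne d) ((hadm 0).A_ne j))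
    have hprod : ∏ j, P.swapNum r k j / P.swapDen r k j =
        P.b (lo r) / P.q * (P.b (hi r) / P.q) := by
      have := P.c_ne_zero k
      have := P.bTail_ne_zero (r + 2)
      rw [Fintype.prod_bool]
      simp only [swapNum, swapDen, bTail_r, bTail_lo_succ]
      field_simp
    refine RowLink.of_injective (phiPos_injective r k) (fun d m =>
      betaC P.q (fun j => (P.swapDen r k j)⁻¹) (fun j => (P.swapNum r k j)⁻¹) j d *
        thetaC P.q (swapDir r) (P.b (lo r) / P.q * (P.swapDen r k d / P.swapNum r k j)) m)
      (fun d => entire_const_mul _ (hent _ (hx d))) ?_ (fun τ hτ d => ?_) fun τ κ hκ => ?_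
    · funext m
      have c1 := conv_thetaC_swap_aux (q := P.q) (x := P.b (lo r)) hy r
        (C := pull (s r) ((P.perm (s r)).coefG k (chiPos r j))) (restSwap_sub P r k)
        (f := fun n e => chiC P.q (P.swapNum r k) (P.swapDen r k) n j e)
        (fun e => swap_coefG_perm hq h r h' k j e) m
      have c2 := fun d => conv_thetaC_swap_aux (q := P.q)
        (x := P.b (lo r) / P.q * (P.swapDen r k d / P.swapNum r k j)) hy r
        (C := P.coefG k (phiPos r d)) (restSwap_sub P r k)
        (f := fun n e => phiC P.q (P.swapNum r k) (P.swapDen r k) n d e)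
        (fun e => swap_coefG hq h r k d e) m
      have c3 := connection_dual hq0 hq (hadm m) j (m (lo r))
      simp only [conv_const_mul, hcoef, hcoef', c2]
      rw [c1, show P.b (lo r) * (P.b (hi r) / P.q) = P.q * ∏ j, P.swapNum r k j / P.swapDen r k j by
        rw [hprod]; field_simp, c3, mul_sum, hprod]
      refine sum_congr rfl fun d _ => ?_
      rw [mul_left_comm, show P.b (lo r) / P.q * (P.b (hi r) / P.q) *
        (P.swapDen r k d / P.swapNum r k j) = P.b (lo r) / P.q *
          (P.swapDen r k d / P.swapNum r k j) * (P.b (hi r) / P.q) by ring]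
    · rw [ev_const_mul, hev τ _ (hx d), hev τ _ hb, mul_comm (P.b (lo r)) (Complex.exp _)]
      linear_combination qInf P.q P.q * matSId_pos r τ k j d (hth τ hτ)
    · exact matSId_eq_zero r _ k j hκ
  · refine RowLink.of_eq (hent _ hb) none (funext fun m => coefF₀_perm P r m) (fun τ => ?_)
      (fun τ => ?_) fun τ κ hκ => ?_
    · simp only [pre, tailPow]
      rw [filter_eq_empty_iff.mpr fun {i} _ => not_le.mpr i.isLt, prod_empty, prod_empty]
    · exact (matSId_none r _ _).trans (if_pos rfl)
    · exact (matSId_none r _ _).trans (if_neg hκ)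
  · refine RowLink.of_eq (hent _ hb) (some (k, l)) (funext fun m => ?_) (fun τ => ?_)
      (fun τ => ?_) fun τ κ hκ => ?_
    · refine Eq.trans (congrFun (hcoef' k l) (m ∘ s r)) ?_
      rw [hcoef]
      exact coefG_perm_of_ne P r h1 h2 k m
    · have e1 : l.val + 1 ≠ r.val + 1 := fun e => h1 (Fin.ext (by simpa [lo] using e))
      simp only [pre, if_pos (Fin.is_lt l)]
      rw [tailPow_perm_s P r e1, βTail_perm_s P r e1, Function.comp_apply, s_of_ne r h1 h2]
      rfl
    · exact (matSId_of_ne h1 h2 k _ _).trans (if_pos rfl)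
    · exact (matSId_of_ne h1 h2 k _ _).trans (if_neg hκ)

end Params

end QConn

end

noncomputable section

namespace QConn

open Finset Filter Topology

namespace Params

variable {N M : ℕ} (P : Params N M)

/-! ### The vectors `u^{L,σ}` as Laurent series -/

/-- The coefficients of the series in `u^{L,σ}`. -/
def permCoef (L : ℕ) (σ : Equiv.Perm (Fin M)) (ι : Idx N M) : (Fin M → ℤ) → ℂ :=
  pull σ ((P.perm σ).coef L ι)

/-- The powers in front of the series in `u^{L,σ}`. -/
def permPre (L : ℕ) (σ : Equiv.Perm (Fin M)) (τ : Fin M → ℂ) : Idx N M → ℂ :=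
  (P.perm σ).pre L (τ ∘ σ)

variable {P}

theorem u_eq (hq : ‖P.q‖ < 1) (hgen : ∀ σ : Equiv.Perm (Fin M), (P.perm σ).Generic) (L : ℕ)
    (σ : Equiv.Perm (Fin M)) (τ : Fin M → ℂ) (ι : Idx N M) :
    P.u L σ τ ι = P.permPre L σ τ ι * ev (P.permCoef L σ ι) τ := by
  rw [permCoef, ev_pull]
  exact uId_eq (P := P.perm σ) hq (hgen σ) L (τ ∘ σ) ι

theorem converges (hq : ‖P.q‖ < 1) (hgen : ∀ σ : Equiv.Perm (Fin M), (P.perm σ).Generic) {L : ℕ}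
    {σ : Equiv.Perm (Fin M)} {τ : Fin M → ℂ} (hτ : τ ∈ P.region L σ) : P.Converges L σ τ :=
  convergesId (P := P.perm σ) (τ := τ ∘ σ) hq (hgen σ) hτ

theorem summableAt_permCoef (hq : ‖P.q‖ < 1) (hgen : ∀ σ : Equiv.Perm (Fin M), (P.perm σ).Generic)
    {L : ℕ} {σ : Equiv.Perm (Fin M)} {τ : Fin M → ℂ} (hτ : τ ∈ P.region L σ) (ι : Idx N M) :
    SummableAt (P.permCoef L σ ι) τ :=
  summableAt_pull.mpr ((convergesId_iff (P := P.perm σ) hq (hgen σ) L (τ ∘ σ)).mp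
    (converges hq hgen hτ) ι)

theorem comp_mem_regular (σ : Equiv.Perm (Fin M)) {τ : Fin M → ℂ} (hτ : τ ∈ P.regular) :
    τ ∘ σ ∈ (P.perm σ).regular :=
  ⟨fun i => hτ.1 (σ i), fun i => hτ.2.1 (σ i), fun i j hij => hτ.2.2 (σ i) (σ j)
    (σ.injective.ne hij)⟩

theorem linkA_perm (hq : ‖P.q‖ < 1) (hgen : ∀ σ : Equiv.Perm (Fin M), (P.perm σ).Generic)
    (σ : Equiv.Perm (Fin M)) (p : Fin M) : Link P.regular (P.permCoef p σ) (P.permPre p σ)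
      (P.permCoef (p + 1) σ) (P.permPre (p + 1) σ) (P.matA p σ) :=
  ((linkA (P := P.perm σ) hq (hgen σ) p).pull σ).mono fun _ => comp_mem_regular σ

theorem linkB_perm (hq : ‖P.q‖ < 1) (hgen : ∀ σ : Equiv.Perm (Fin M), (P.perm σ).Generic)
    (σ : Equiv.Perm (Fin M)) (p : Fin M) : Link P.regular (P.permCoef (p + 1) σ)
      (P.permPre (p + 1) σ) (P.permCoef p σ) (P.permPre p σ) (P.matB p σ) :=
  ((linkB (P := P.perm σ) hq (hgen σ) p).pull σ).mono fun _ => comp_mem_regular σ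

/-- Relabelling by `σ`: permuting the parameters by `σ` and then by `s r` is, by definition,
permuting them by `σ * s r`, and similarly for the pulled back coefficients. -/
theorem linkS_perm (hq : ‖P.q‖ < 1) (hgen : ∀ σ : Equiv.Perm (Fin M), (P.perm σ).Generic)
    (σ : Equiv.Perm (Fin M)) (r : Fin (M - 1)) : Link P.regular (P.permCoef M (σ * s r))
      (P.permPre M (σ * s r)) (P.permCoef M σ) (P.permPre M σ) (P.matS r σ) :=
  ((linkS (P := P.perm σ) hq (hgen σ) r (hgen (σ * s r))).pull σ).mono fun _ => comp_mem_regular σ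

/-! ### The regions of convergence -/

theorem isOpen_region (L : ℕ) (σ : Equiv.Perm (Fin M)) : IsOpen (P.region L σ) := by
  have hd : ∀ i (τ : Fin M → ℂ), P.b i * Complex.exp (τ i) ≠ 0 := fun i τ =>
    mul_ne_zero (P.b_ne_zero i) (Complex.exp_ne_zero _)
  have hc : ∀ i (τ : Fin M → ℂ), ContinuousAt (fun τ : Fin M → ℂ => Complex.exp (τ i)) τ :=
    fun i τ => (Complex.continuous_exp.comp (continuous_apply i)).continuousAt
  refine isOpen_iff_eventually.mpr fun τ hτ =>
    (eventually_all.mpr fun i => eventually_imp_distrib_left.mpr fun h => ?_).and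
    ((eventually_all.mpr fun i => eventually_imp_distrib_left.mpr fun h => ?_).and
    (eventually_all.mpr fun i => eventually_all.mpr fun j => eventually_imp_distrib_left.mpr fun h =>
      ?_))
  · exact ContinuousAt.eventually_lt (hc _ τ).norm continuousAt_const (hτ.1 i h)
  · exact ContinuousAt.eventually_lt (ContinuousAt.norm (continuousAt_const.mul (ContinuousAt.div
      continuousAt_const (continuousAt_const.mul (hc _ τ)) (hd (σ i) τ)))) continuousAt_const (hτ.2.1 i h)
  · exact ContinuousAt.eventually_lt (ContinuousAt.norm (ContinuousAt.div (continuousAt_const.mul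
      (hc _ τ)) (continuousAt_const.mul (hc _ τ)) (hd (σ j) τ))) continuousAt_const (hτ.2.2 i j h)

theorem eventually_norm_mul_exp_lt_one (C x : ℂ) {w : ℝ} (hw : w < 0) :
    ∀ᶠ s : ℝ in atTop, ‖C * Complex.exp (x + s * w)‖ < 1 := by
  have h : Tendsto (fun s : ℝ => ‖C‖ * Real.exp (x.re + s * w)) atTop (𝓝 (‖C‖ * 0)) :=
    (Real.tendsto_exp_atBot.comp (tendsto_atBot_add_const_left _ _
      (tendsto_id.atTop_mul_const_of_neg hw))).const_mul _
  rw [mul_zero] at h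
  filter_upwards [h.eventually_lt_const zero_lt_one] with s hs
  rw [norm_mul, Complex.norm_exp]
  simpa using hs

/-- Along the direction `w` one eventually gets into `D^{L,σ}`. -/
theorem eventually_mem_region {L : ℕ} {σ : Equiv.Perm (Fin M)} {w : Fin M → ℝ}
    (h₁ : ∀ i : Fin M, i.val < L → w (σ i) < 0) (h₂ : ∀ i : Fin M, L ≤ i.val → 0 < w (σ i))
    (h₃ : ∀ i j : Fin M, i < j → w (σ i) < w (σ j)) (x : Fin M → ℂ) :
    ∀ᶠ s : ℝ in atTop, (fun i => x i + s * w i) ∈ P.region L σ := by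
  refine ((eventually_all.mpr fun i => ?_).and ((eventually_all.mpr fun i => ?_).and
    (eventually_all.mpr fun i => eventually_all.mpr fun j => ?_)))
  · by_cases h : i.val < L
    · filter_upwards [eventually_norm_mul_exp_lt_one 1 (x (σ i)) (h₁ i h)] with s hs _
      simpa using hs
    · exact Eventually.of_forall fun s hs => absurd hs h
  · by_cases h : L ≤ i.val
    · filter_upwards [eventually_norm_mul_exp_lt_one ((∏ j, P.c j / P.a j) * (P.q / P.b (σ i)))
        (-x (σ i)) (neg_lt_zero.mpr (h₂ i h))] with s hs _
      convert hs using 2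
      rw [show -x (σ i) + s * ((-w (σ i) : ℝ) : ℂ) = -(x (σ i) + s * w (σ i)) by push_cast; ring,
        Complex.exp_neg]
      field_simp
    · exact Eventually.of_forall fun s hs => absurd hs h
  · by_cases h : i < j
    · filter_upwards [eventually_norm_mul_exp_lt_one (P.q / P.b (σ j)) (x (σ i) - x (σ j))
        (sub_neg.mpr (h₃ i j h))] with s hs _
      convert hs using 2
      rw [show x (σ i) - x (σ j) + s * ((w (σ i) - w (σ j) : ℝ) : ℂ) =
        x (σ i) + s * w (σ i) - (x (σ j) + s * w (σ j)) by push_cast; ring, Complex.exp_sub]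
      field_simp
    · exact Eventually.of_forall fun s hs => absurd hs h

/-- A direction leading into `D^{L,σ}`. -/
def dir (L : ℕ) (σ : Equiv.Perm (Fin M)) (i : Fin M) : ℝ := (σ.symm i).val - L + 1 / 2

/-- In the order given by `σ` the components of `dir` increase by `1` and change sign between
positions `L` and `L + 1`; the summand `1/2` keeps them away from `0`. -/
theorem eventually_mem_region_dir (L : ℕ) (σ : Equiv.Perm (Fin M)) (x : Fin M → ℂ) :
    ∀ᶠ s : ℝ in atTop, (fun i => x i + s * dir L σ i) ∈ P.region L σ := by
  refine eventually_mem_region (fun i hi => ?_) (fun i hi => ?_) (fun i j hij => ?_) x <;>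
    simp only [dir, Equiv.symm_apply_apply]
  · have : (i.val : ℝ) + 1 ≤ L := by exact_mod_cast hi
    linarith
  · have : (L : ℝ) ≤ i.val := by exact_mod_cast hi
    linarith
  · have : (i.val : ℝ) < j.val := by exact_mod_cast hij
    linarith

/-- Reversing the direction reverses the order of the variables and exchanges small with large, so
one arrives in the region of `M - L` and `σ * Fin.revPerm`. -/
theorem eventually_mem_region_neg_dir {L : ℕ} (hL : L ≤ M) (σ : Equiv.Perm (Fin M))
    (x : Fin M → ℂ) :
    ∀ᶠ s : ℝ in atTop, (fun i => x i + s * (-dir L σ i : ℝ)) ∈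
      P.region (M - L) (σ * Fin.revPerm) := by
  refine eventually_mem_region (w := fun i => -dir L σ i) (fun i hi => ?_) (fun i hi => ?_)
    (fun i j hij => ?_) x <;>
    simp only [dir, Equiv.Perm.mul_apply, Equiv.symm_apply_apply, Fin.revPerm_apply, Fin.val_rev]
  · have : (L : ℝ) ≤ (M - (i.val + 1) : ℕ) := by exact_mod_cast (by omega)
    linarith
  · have : ((M - (i.val + 1) : ℕ) : ℝ) + 1 ≤ L := by exact_mod_cast (by omega)
    linarith
  · have : ((M - (j.val + 1) : ℕ) : ℝ) < (M - (i.val + 1) : ℕ) := by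
      have : i.val < j.val := hij
      exact_mod_cast (by omega)
    linarith

theorem region_nonempty (L : ℕ) (σ : Equiv.Perm (Fin M)) : (P.region L σ).Nonempty :=
  let ⟨_, h⟩ := (eventually_mem_region_dir L σ 0).exists
  ⟨_, h⟩

theorem exists_summableAt_permCoef (hq : ‖P.q‖ < 1)
    (hgen : ∀ σ : Equiv.Perm (Fin M), (P.perm σ).Generic) (L : ℕ) (σ : Equiv.Perm (Fin M)) :
    ∃ τ, ∀ ι, SummableAt (P.permCoef L σ ι) τ :=
  (region_nonempty L σ).imp fun _ h ι => summableAt_permCoef hq hgen h ι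

/-! ### Chains of links -/

/-- Adjacent transpositions generate the symmetric group as a monoid. -/
theorem exists_wordPerm (σ σ' : Equiv.Perm (Fin M)) : ∃ w, σ' = wordPerm σ w := by
  obtain _ | n := M
  · exact ⟨[], Subsingleton.elim _ _⟩
  suffices H : ∀ g ∈ Submonoid.closure
      (Set.range fun i : Fin n => Equiv.swap i.castSucc i.succ), ∃ w, σ * g = wordPerm σ w by
    obtain ⟨w, hw⟩ := H (σ⁻¹ * σ') (by
      rw [Equiv.Perm.mclosure_swap_castSucc_succ]; exact Submonoid.mem_top _)
    exact ⟨w, by rw [← hw, mul_inv_cancel_left]⟩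
  intro g hg
  induction hg using Submonoid.closure_induction_right with
  | one => exact ⟨[], mul_one σ⟩
  | mul_right x hx y hy ih =>
    obtain ⟨w, hw⟩ := ih
    obtain ⟨r, rfl⟩ := hy
    exact ⟨(r : Fin (n + 1 - 1)) :: w, by rw [wordPerm, ← hw, mul_assoc]; rfl⟩

/-- Starting from the series of `(L', σ')`, which converge on their own region, the property is
carried up to `L = M` by `linkB`, through the permutations by `linkS`, and down to `(L, σ)` by
`linkA`. -/
theorem reach (hq : ‖P.q‖ < 1) (hgen : ∀ σ : Equiv.Perm (Fin M), (P.perm σ).Generic) {L L' : ℕ}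
    (hL : L ≤ M) (hL' : L' ≤ M) (σ σ' : Equiv.Perm (Fin M)) :
    Reach P.regular (P.permCoef L σ) (P.region L' σ') := by
  have hs := exists_summableAt_permCoef hq hgen
  have h₁ : ∀ n, L' + n ≤ M → Reach P.regular (P.permCoef (L' + n) σ') (P.region L' σ') := by
    intro n
    induction n with
    | zero => exact fun _ => Reach.refl fun ι τ hτ => summableAt_permCoef hq hgen hτ ι
    | succ n ih =>
      intro hn
      exact (linkB_perm hq hgen σ' ⟨L' + n, by omega⟩).reach (ih (by omega)) (hs _ _) (hs _ _)
  have h₂ : ∀ w, Reach P.regular (P.permCoef M (wordPerm σ' w)) (P.region L' σ') := by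
    intro w
    induction w with
    | nil =>
      have := h₁ (M - L') (by omega)
      rwa [Nat.add_sub_cancel' hL'] at this
    | cons r w ih => exact (linkS_perm hq hgen (wordPerm σ' w) r).reach ih (hs _ _) (hs _ _)
  obtain ⟨w, rfl⟩ := exists_wordPerm σ' σ
  induction hL using Nat.decreasingInduction with
  | self => exact h₂ w
  | of_succ k hk ih => exact (linkA_perm hq hgen (wordPerm σ' w) ⟨k, hk⟩).reach ih (hs _ _) (hs _ _)

/-- After multiplication by a factor without zeros at regular points, the series in `u^{L,σ}`
converge everywhere. -/
theorem reach_univ (hq : ‖P.q‖ < 1) (hgen : ∀ σ : Equiv.Perm (Fin M), (P.perm σ).Generic) {L : ℕ}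
    (hL : L ≤ M) (σ : Equiv.Perm (Fin M)) :
    ∃ E, Entire E ∧ (∀ τ ∈ P.regular, ev E τ ≠ 0) ∧
      ∀ ι, Entire (conv E (P.permCoef L σ ι)) := by
  -- The target is the region opposite to `D^{L,σ}`.
  obtain ⟨E, hE, h0, h⟩ := reach hq hgen hL (Nat.sub_le M L) σ (σ * Fin.revPerm)
  refine ⟨E, hE, h0, fun ι τ => ?_⟩
  -- For large `s` the points `τ + s dir` and `τ - s dir` lie in the two opposite regions, and `τ`
  -- is their midpoint.
  obtain ⟨s, hs, hs'⟩ := ((eventually_mem_region_dir (P := P) L σ τ).and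
    (eventually_mem_region_neg_dir hL σ τ)).exists
  refine SummableAt.midpoint ((hE _).conv (summableAt_permCoef hq hgen hs ι)) (h ι _ hs') ?_
  funext i
  simp
  ring

/-! ### Analytic continuation -/

theorem analyticAt_pre (L : ℕ) (ι : Idx N M) (τ : Fin M → ℂ) :
    AnalyticAt ℂ (fun τ => P.pre L τ ι) τ := by
  have hp : ∀ i, AnalyticAt ℂ (fun τ : Fin M → ℂ => τ i) τ := fun i =>
    (ContinuousLinearMap.proj (R := ℂ) (φ := fun _ : Fin M => ℂ) i).analyticAt τ
  have ht : ∀ L, AnalyticAt ℂ (fun τ => P.tailPow L τ) τ := fun L =>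
    Finset.analyticAt_fun_prod _ fun i _ => (analyticAt_const.mul (hp i)).cexp
  rcases ι with _ | ⟨k, l⟩
  · exact ht L
  · simp only [pre]
    split_ifs
    · exact (analyticAt_const.mul (hp l)).cexp.mul (ht _)
    · exact (analyticAt_const.mul (hp l)).cexp.mul (ht _)

theorem analyticAt_permPre (L : ℕ) (σ : Equiv.Perm (Fin M)) (ι : Idx N M) (τ : Fin M → ℂ) :
    AnalyticAt ℂ (fun τ => P.permPre L σ τ ι) τ := by
  have h : AnalyticAt ℂ (fun τ : Fin M → ℂ => τ ∘ σ) τ := analyticAt_pi_iff.mpr fun i =>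
    (ContinuousLinearMap.proj (R := ℂ) (φ := fun _ : Fin M => ℂ) (σ i)).analyticAt τ
  exact AnalyticAt.fun_comp (g := fun τ => (P.perm σ).pre L τ ι)
    (analyticAt_pre (P := P.perm σ) L ι (τ ∘ σ)) h

theorem Entire.analyticAt {C : (Fin M → ℤ) → ℂ} (h : Entire C) (τ : Fin M → ℂ) :
    AnalyticAt ℂ (ev C) τ :=
  analyticOnNhd_ev isOpen_univ (fun τ _ => h τ) τ (Set.mem_univ τ)

theorem u_eq_quotient (hq : ‖P.q‖ < 1) (hgen : ∀ σ : Equiv.Perm (Fin M), (P.perm σ).Generic)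
    {L : ℕ} {σ : Equiv.Perm (Fin M)} {E : (Fin M → ℤ) → ℂ} (hE : Entire E) {τ : Fin M → ℂ}
    (hτ : τ ∈ P.region L σ) (h0 : ev E τ ≠ 0) (ι : Idx N M) :
    P.u L σ τ ι = P.permPre L σ τ ι * (ev (conv E (P.permCoef L σ ι)) τ / ev E τ) := by
  rw [u_eq hq hgen, ev_conv (hE τ) (summableAt_permCoef hq hgen hτ ι), mul_div_cancel_left₀ _ h0]

/-- The continuation of `u^{L,σ}` is given by a quotient of everywhere convergent series. -/
theorem exists_continuation (hq : ‖P.q‖ < 1)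
    (hgen : ∀ σ : Equiv.Perm (Fin M), (P.perm σ).Generic) {L : ℕ} (σ : Equiv.Perm (Fin M))
    {E : (Fin M → ℤ) → ℂ} (hE : Entire E) (h0 : ∀ τ ∈ P.regular, ev E τ ≠ 0)
    (h : ∀ ι, Entire (conv E (P.permCoef L σ ι))) :
    ∃ V, P.IsContinuation L σ V ∧ ∀ τ ∈ P.regular, ∀ ι,
      V τ ι = P.permPre L σ τ ι * (ev (conv E (P.permCoef L σ ι)) τ / ev E τ) := by
  classical
  -- On the region the series itself is used, because `E` may vanish there outside the regular
  -- points; elsewhere the quotient. The two expressions agree on the region wherever `E` does not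
  -- vanish, so the function is analytic.
  refine ⟨fun τ ι => if τ ∈ P.region L σ then P.u L σ τ ι else
    P.permPre L σ τ ι * (ev (conv E (P.permCoef L σ ι)) τ / ev E τ), ⟨fun τ hτ => ?_, fun τ hτ => ?_⟩,
    fun τ hτ ι => ?_⟩
  · refine analyticAt_pi_iff.mpr fun ι => ?_
    by_cases hr : τ ∈ P.region L σ
    · refine AnalyticAt.congr (f := fun τ => P.permPre L σ τ ι * ev (P.permCoef L σ ι) τ)
        ((analyticAt_permPre L σ ι τ).mul (analyticOnNhd_ev (isOpen_region L σ)
          (fun τ hτ => summableAt_permCoef hq hgen hτ ι) τ hr)) ?_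
      filter_upwards [(isOpen_region L σ).mem_nhds hr] with τ' hτ'
      rw [if_pos hτ', u_eq hq hgen]
    · have hEτ := h0 τ (hτ.resolve_left hr)
      refine AnalyticAt.congr ((analyticAt_permPre (P := P) L σ ι τ).mul
        ((Entire.analyticAt (h ι) τ).div (Entire.analyticAt hE τ) hEτ)) ?_
      filter_upwards [(Entire.analyticAt hE τ).continuousAt.eventually_ne hEτ] with τ' hτ'
      split_ifs with hr'
      · exact (u_eq_quotient hq hgen hE hr' hτ' ι).symm
      · rfl
  · funext ι
    exact if_pos hτ
  · dsimp only
    split_ifs with hr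
    · exact u_eq_quotient hq hgen hE hr (h0 τ hτ) ι
    · rfl

/-! ### Uniqueness of the continuation -/

/-- For `d ≠ 0` two solutions differ by an integral multiple of `2πi/d`; for `d = 0` the equation
does not involve `z`, and the hypothesis says that it fails. -/
theorem countable_setOf_exp_eq {x d B C : ℂ} (hC : C ≠ 0)
    (h : d ≠ 0 ∨ Complex.exp x * B ≠ C) : {z : ℂ | Complex.exp (x + z * d) * B = C}.Countable := by
  rcases eq_or_ne d 0 with rfl | hd
  · convert Set.countable_empty
    ext z
    simpa using h
  rcases Set.eq_empty_or_nonempty {z : ℂ | Complex.exp (x + z * d) * B = C} with he | ⟨w, hw⟩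
  · rw [he]
    exact Set.countable_empty
  refine (Set.countable_range fun n : ℤ => w + n * (2 * Real.pi * Complex.I) / d).mono fun z hz => ?_
  have hB : B ≠ 0 := by
    rintro rfl
    exact hC (by simpa using hz.symm)
  obtain ⟨n, hn⟩ := Complex.exp_eq_exp_iff_exists_int.mp
    (mul_right_cancel₀ hB ((hz : _ = C).trans (hw : _ = C).symm))
  refine ⟨n, ?_⟩
  field_simp
  linear_combination -hn

/-- The points which are not regular are a countable subset of a line, unless they fill it. -/
theorem countable_line_inter_compl_regular {x d : Fin M → ℂ}
    (h : x ∈ P.regular ∨ (∀ i, d i ≠ 0) ∧ Function.Injective d) :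
    {z : ℂ | (fun i => x i + z * d i) ∉ P.regular}.Countable := by
  have hq : ∀ n : ℤ, P.q ^ n ≠ 0 := fun n => zpow_ne_zero n P.q_ne_zero
  have c₁ : ∀ (i : Fin M) (n : ℤ), {z : ℂ | Complex.exp (x i + z * d i) * 1 = P.q ^ n}.Countable :=
    fun i n => countable_setOf_exp_eq (hq n)
      (h.symm.imp (fun h => h.1 i) fun h => by rw [mul_one]; exact h.1 i n)
  have c₂ : ∀ (i : Fin M) (n : ℤ),
      {z : ℂ | Complex.exp (x i + z * d i) * (P.b i * P.ac) = P.q ^ n}.Countable :=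
    fun i n => countable_setOf_exp_eq (hq n)
      (h.symm.imp (fun h => h.1 i) fun h => by rw [← mul_assoc]; exact h.2.1 i n)
  have c₃ : ∀ (i j : Fin M) (n : ℤ), {z : ℂ | i ≠ j ∧
      Complex.exp (x i - x j + z * (d i - d j)) * P.b i = P.q ^ n}.Countable := fun i j n => by
    by_cases hij : i = j
    · simp [hij]
    refine (countable_setOf_exp_eq (x := x i - x j) (d := d i - d j) (B := P.b i) (hq n)
      (h.symm.imp (fun h => sub_ne_zero.mpr (h.2.ne hij)) fun h => ?_)).mono fun z hz => hz.2
    rw [Complex.exp_sub, div_mul_eq_mul_div]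
    exact h.2.2 i j hij n
  refine ((Set.countable_iUnion fun i => Set.countable_iUnion (c₁ i)).union
    ((Set.countable_iUnion fun i => Set.countable_iUnion (c₂ i)).union
      (Set.countable_iUnion fun i => Set.countable_iUnion fun j =>
        Set.countable_iUnion (c₃ i j)))).mono fun z hz => ?_
  contrapose! hz
  simp only [Set.mem_union, Set.mem_iUnion, Set.mem_ofPred_eq, not_or, not_exists] at hz
  simp only [Set.mem_ofPred_eq, not_not]
  refine ⟨fun i n hn => hz.1 i n (by rw [mul_one]; exact hn),
    fun i n hn => hz.2.1 i n (by rw [← mul_assoc]; exact hn),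
    fun i j hij n hn => hz.2.2 i j n ⟨hij, ?_⟩⟩
  rw [← hn, show x i - x j + z * (d i - d j) = x i + z * d i - (x j + z * d j) by ring,
    Complex.exp_sub]
  ring

/-- The direction `(1, 2, …, M)` has nonzero and distinct entries, so on a line in this direction
each forbidden equation has countably many solutions; the region, being open, meets their
complement. -/
theorem exists_mem_region_regular (L : ℕ) (σ : Equiv.Perm (Fin M)) :
    (P.region L σ ∩ P.regular).Nonempty := by
  obtain ⟨x, hx⟩ := region_nonempty (P := P) L σ
  have hc := countable_line_inter_compl_regular (P := P) (x := x)
    (d := fun i => ((i.val + 1 : ℕ) : ℂ))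
    (Or.inr ⟨fun i => Nat.cast_ne_zero.mpr (Nat.succ_ne_zero _), fun i j hij => by
      simpa [Fin.ext_iff] using hij⟩)
  have ho : IsOpen {z : ℂ | (fun i => x i + z * ((i.val + 1 : ℕ) : ℂ)) ∈ P.region L σ} :=
    (isOpen_region L σ).preimage (by fun_prop)
  obtain ⟨z, hz, hz'⟩ := (hc.dense_compl ℂ).inter_open_nonempty _ ho ⟨0, by simpa using hx⟩
  exact ⟨_, hz, not_not.mp hz'⟩

/-- Join `τ` by a complex line to a regular point inside the region. Only countably many points of
the line are not regular, and the complement of a countable set in `ℂ` is connected, so the identity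
theorem in one variable applies. -/
theorem IsContinuation.unique {L : ℕ} {σ : Equiv.Perm (Fin M)} {V V' : (Fin M → ℂ) → Idx N M → ℂ}
    (hV : P.IsContinuation L σ V) (hV' : P.IsContinuation L σ V') {τ : Fin M → ℂ}
    (hτ : τ ∈ P.regular) : V τ = V' τ := by
  obtain ⟨x, hx, hx'⟩ := exists_mem_region_regular (P := P) L σ
  let f : ℂ → Fin M → ℂ := fun z i => x i + z * (τ i - x i)
  have hf : ∀ z, AnalyticAt ℂ f z := fun z => analyticAt_pi_iff.mpr fun i =>
    analyticAt_const.add (analyticAt_id.mul analyticAt_const)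
  have hf0 : f 0 = x := by simp [f]
  have hf1 : f 1 = τ := by simp [f]
  have hc : {z | f z ∉ P.regular}.Countable :=
    countable_line_inter_compl_regular (d := fun i => τ i - x i) (Or.inl hx')
  have hconn : IsPreconnected {z | f z ∉ P.regular}ᶜ :=
    (hc.isPathConnected_compl_of_one_lt_rank (by simp)).isConnected.isPreconnected
  have ha : ∀ W : (Fin M → ℂ) → Idx N M → ℂ, P.IsContinuation L σ W →
      AnalyticOnNhd ℂ (W ∘ f) {z | f z ∉ P.regular}ᶜ := fun W hW z hz =>
    (hW.1 (f z) (Or.inr (not_not.mp hz))).comp (hf z)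
  have he : V ∘ f =ᶠ[𝓝 0] V' ∘ f := by
    filter_upwards [(hf 0).continuousAt.preimage_mem_nhds
      ((isOpen_region L σ).mem_nhds (by rw [hf0]; exact hx))] with z hz
    exact (hV.2 hz).trans (hV'.2 hz).symm
  have := (ha V hV).eqOn_of_preconnected_of_eventuallyEq (ha V' hV') hconn
    (z₀ := 0) (not_not.mpr (by rw [hf0]; exact hx')) he
    (show (1 : ℂ) ∈ {z | f z ∉ P.regular}ᶜ from not_not.mpr (by rw [hf1]; exact hτ))
  simpa only [Function.comp_apply, hf1] using this

/-! ### The connection formula -/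

/-- By uniqueness both continuations may be replaced by the quotients of entire series, for which
the claim is `Link.relation`. -/
theorem Link.continuation (hq : ‖P.q‖ < 1) (hgen : ∀ σ : Equiv.Perm (Fin M), (P.perm σ).Generic)
    {L L' : ℕ} (hL : L ≤ M) (hL' : L' ≤ M) {σ σ' : Equiv.Perm (Fin M)}
    {X : (Fin M → ℂ) → Matrix (Idx N M) (Idx N M) ℂ}
    (h : Link P.regular (P.permCoef L σ) (P.permPre L σ) (P.permCoef L' σ') (P.permPre L' σ') X)
    {V V' : (Fin M → ℂ) → Idx N M → ℂ} (hV : P.IsContinuation L σ V)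
    (hV' : P.IsContinuation L' σ' V') {τ : Fin M → ℂ} (hτ : τ ∈ P.regular) :
    V τ = (X τ).mulVec (V' τ) := by
  obtain ⟨E, hE, h0, hC⟩ := reach_univ hq hgen hL σ
  obtain ⟨E', hE', h0', hC'⟩ := reach_univ hq hgen hL' σ'
  obtain ⟨W, hW, hWe⟩ := exists_continuation hq hgen σ hE h0 hC
  obtain ⟨W', hW', hWe'⟩ := exists_continuation hq hgen σ' hE' h0' hC'
  rw [hV.unique hW hτ, hV'.unique hW' hτ]
  funext ι
  rw [hWe τ hτ, Matrix.mulVec, dotProduct]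
  simp only [hWe' τ hτ]
  exact h.relation (exists_summableAt_permCoef hq hgen L σ)
    (exists_summableAt_permCoef hq hgen L' σ') hE hE' hτ (h0 τ hτ) (h0' τ hτ) hC hC' ι

theorem continuation_exists (hq : ‖P.q‖ < 1) (hgen : ∀ σ : Equiv.Perm (Fin M), (P.perm σ).Generic)
    {L : ℕ} (hL : L ≤ M) (σ : Equiv.Perm (Fin M)) : ∃ V, P.IsContinuation L σ V := by
  obtain ⟨E, hE, h0, hC⟩ := reach_univ hq hgen hL σ
  obtain ⟨W, hW, -⟩ := exists_continuation hq hgen σ hE h0 hC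
  exact ⟨W, hW⟩

theorem filter_finRange_eq_drop (L : ℕ) :
    (List.finRange M).filter (fun p => L ≤ p.val) = (List.finRange M).drop L := by
  conv_lhs => rw [← List.take_append_drop L (List.finRange M), List.filter_append]
  rw [List.filter_eq_nil_iff.mpr, List.filter_eq_self.mpr, List.nil_append]
  · intro p hp
    obtain ⟨i, hi, rfl⟩ := List.mem_drop_iff_getElem.mp hp
    simp
  · intro p hp
    obtain ⟨i, hi, rfl⟩ := List.mem_take_iff_getElem.mp hp
    simp at hi ⊢
    omega

theorem filter_finRange_eq_cons {L : ℕ} (hL : L < M) :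
    (List.finRange M).filter (fun p => L ≤ p.val) =
      ⟨L, hL⟩ :: (List.finRange M).filter (fun p => L + 1 ≤ p.val) := by
  rw [filter_finRange_eq_drop, filter_finRange_eq_drop,
    List.drop_eq_getElem_cons (by rwa [List.length_finRange])]
  simp

theorem filter_finRange_eq_nil : (List.finRange M).filter (fun p => M ≤ p.val) = [] := by
  rw [filter_finRange_eq_drop, List.drop_eq_nil_of_le (by rw [List.length_finRange])]

theorem continuation_eq_prodA (hq : ‖P.q‖ < 1)
    (hgen : ∀ σ : Equiv.Perm (Fin M), (P.perm σ).Generic) {L : ℕ} (hL : L ≤ M)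
    (σ : Equiv.Perm (Fin M)) {V V' : (Fin M → ℂ) → Idx N M → ℂ} (hV : P.IsContinuation L σ V)
    (hV' : P.IsContinuation M σ V') {τ : Fin M → ℂ} (hτ : τ ∈ P.regular) :
    V τ = (P.prodA L σ τ).mulVec (V' τ) := by
  induction hL using Nat.decreasingInduction generalizing V with
  | self =>
    rw [prodA, filter_finRange_eq_nil, List.map_nil, List.prod_nil, Matrix.one_mulVec]
    exact hV.unique hV' hτ
  | of_succ k hk ih =>
    obtain ⟨W, hW⟩ := continuation_exists hq hgen (Nat.succ_le_of_lt hk) σ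
    rw [prodA, filter_finRange_eq_cons hk, List.map_cons, List.prod_cons, ← Matrix.mulVec_mulVec]
    exact (Link.continuation hq hgen hk.le (Nat.succ_le_of_lt hk) (linkA_perm hq hgen σ ⟨k, hk⟩)
      hV hW hτ).trans (congrArg _ (ih hW))

theorem continuation_eq_prodB (hq : ‖P.q‖ < 1)
    (hgen : ∀ σ : Equiv.Perm (Fin M), (P.perm σ).Generic) {L : ℕ} (hL : L ≤ M)
    (σ : Equiv.Perm (Fin M)) {V V' : (Fin M → ℂ) → Idx N M → ℂ} (hV : P.IsContinuation M σ V)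
    (hV' : P.IsContinuation L σ V') {τ : Fin M → ℂ} (hτ : τ ∈ P.regular) :
    V τ = (P.prodB L σ τ).mulVec (V' τ) := by
  induction hL using Nat.decreasingInduction generalizing V' with
  | self =>
    rw [prodB, filter_finRange_eq_nil, List.reverse_nil, List.map_nil, List.prod_nil,
      Matrix.one_mulVec]
    exact hV.unique hV' hτ
  | of_succ k hk ih =>
    obtain ⟨W, hW⟩ := continuation_exists hq hgen (Nat.succ_le_of_lt hk) σ
    rw [prodB, filter_finRange_eq_cons hk, List.reverse_cons, List.map_append, List.prod_append,
      List.map_singleton, List.prod_singleton, ← Matrix.mulVec_mulVec]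
    exact (ih hW).trans (congrArg _ (Link.continuation hq hgen (Nat.succ_le_of_lt hk) hk.le
      (linkB_perm hq hgen σ ⟨k, hk⟩) hW hV' hτ))

theorem continuation_eq_prodS (hq : ‖P.q‖ < 1)
    (hgen : ∀ σ : Equiv.Perm (Fin M), (P.perm σ).Generic) (σ : Equiv.Perm (Fin M))
    (w : List (Fin (M - 1))) {V V' : (Fin M → ℂ) → Idx N M → ℂ}
    (hV : P.IsContinuation M (wordPerm σ w) V) (hV' : P.IsContinuation M σ V') {τ : Fin M → ℂ}
    (hτ : τ ∈ P.regular) : V τ = (P.prodS σ τ w).mulVec (V' τ) := by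
  induction w generalizing V with
  | nil =>
    rw [prodS, Matrix.one_mulVec]
    exact hV.unique hV' hτ
  | cons r w ih =>
    obtain ⟨W, hW⟩ := continuation_exists hq hgen le_rfl (wordPerm σ w)
    rw [prodS, ← Matrix.mulVec_mulVec]
    exact (Link.continuation hq hgen le_rfl le_rfl (linkS_perm hq hgen (wordPerm σ w) r)
      hV hW hτ).trans (congrArg _ (ih hW))

/-- The continuations of `u^{M,σ}` and of `u^{M,σ'}`, with `σ'` the permutation of the word, serve
as intermediate vectors between the three products. -/
theorem connection_formula (hq : ‖P.q‖ < 1)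
    (hgen : ∀ σ : Equiv.Perm (Fin M), (P.perm σ).Generic) {L₁ L₂ : ℕ} (hL₁ : L₁ ≤ M)
    (hL₂ : L₂ ≤ M) (σ : Equiv.Perm (Fin M)) (w : List (Fin (M - 1)))
    {V₁ V₂ : (Fin M → ℂ) → Idx N M → ℂ} (hV₁ : P.IsContinuation L₁ σ V₁)
    (hV₂ : P.IsContinuation L₂ (wordPerm σ w) V₂) {τ : Fin M → ℂ} (hτ : τ ∈ P.regular) :
    V₂ τ = (P.prodA L₂ (wordPerm σ w) τ * P.prodS σ τ w * P.prodB L₁ σ τ).mulVec (V₁ τ) := by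
  obtain ⟨W, hW⟩ := continuation_exists hq hgen le_rfl σ
  obtain ⟨W', hW'⟩ := continuation_exists hq hgen le_rfl (wordPerm σ w)
  rw [← Matrix.mulVec_mulVec, ← Matrix.mulVec_mulVec,
    ← continuation_eq_prodB hq hgen hL₁ σ hW hV₁ hτ,
    ← continuation_eq_prodS hq hgen σ w hW' hW hτ]
  exact continuation_eq_prodA hq hgen hL₂ _ hV₂ hW' hτ

end Params

end QConn

end

noncomputable section

namespace QConn

open Finset Filter Topology

namespace Params

variable {N M : ℕ} (P : Params N M)

/-! ### Pseudo-constants -/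

theorem qPow_add (z w : ℂ) : P.qPow (z + w) = P.qPow z * P.qPow w := by
  rw [qPow, mul_add, Complex.exp_add]; rfl

theorem qPow_sub (z w : ℂ) : P.qPow (z - w) = P.qPow z / P.qPow w := by
  rw [qPow, mul_sub, Complex.exp_sub]; rfl

theorem qPow_neg (z : ℂ) : P.qPow (-z) = (P.qPow z)⁻¹ := by
  rw [qPow, mul_neg, Complex.exp_neg]; rfl

theorem qPow_one : P.qPow 1 = P.q := by rw [qPow, mul_one, q]

theorem qPow_βTail (L : ℕ) : P.qPow (P.βTail L) = P.bTail L := by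
  rw [qPow, βTail, mul_sum, Complex.exp_sum]; rfl

theorem qPow_α (j : Fin N) : P.qPow (P.α j) = P.a j := rfl

theorem qPow_β (i : Fin M) : P.qPow (P.β i) = P.b i := rfl

theorem qPow_γ (j : Fin N) : P.qPow (P.γ j) = P.c j := rfl

theorem exp_add_logq (x : ℂ) : Complex.exp (x + P.logq) = Complex.exp x * P.q := Complex.exp_add _ _

variable {P}

/-- The theta quotient acquires the factor `v/u` and the exponential the factor `q^e = u/v`. The
single condition `he` thus expresses the pseudo-constancy of a matrix entry. -/
theorem theta_quotient_periodic (hq : ‖P.q‖ < 1) (K : ℂ) {u v u' v' e : ℂ} (x : ℂ) (hu : u ≠ 0)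
    (hv : v ≠ 0) (hu' : u' = u * P.q) (hv' : v' = v * P.q) (he : P.qPow e * v = u) :
    K * (theta P.q u' / theta P.q v') * Complex.exp (e * (x + P.logq)) =
      K * (theta P.q u / theta P.q v) * Complex.exp (e * x) := by
  have hE : Complex.exp (e * (x + P.logq)) = Complex.exp (e * x) * (u / v) := by
    rw [mul_add, Complex.exp_add, mul_comm e P.logq, ← he, mul_div_cancel_right₀ _ hv]
    rfl
  rw [hu', hv', hE, theta_mul_q P.q_ne_zero hq hu, theta_mul_q P.q_ne_zero hq hv]
  field_simp

theorem matAId_add_logq (hq : ‖P.q‖ < 1) (p : Fin M) (x : ℂ) :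
    P.matAId p (x + P.logq) = P.matAId p x := by
  have hq0 := P.q_ne_zero
  have ha := P.a_ne_zero
  have hc := P.c_ne_zero
  have hb := P.b_ne_zero p
  have ht := P.bTail_ne_zero (p + 1)
  have hac := P.ac_ne_zero
  have hx := Complex.exp_ne_zero x
  ext i j
  rcases i with _ | ⟨k, l⟩ <;> rcases j with _ | ⟨d, l'⟩ <;>
    simp only [matAId, Matrix.of_apply] <;> (try split_ifs) <;> try rfl
  all_goals
    refine theta_quotient_periodic hq _ x ?_ ?_ ?_ ?_ ?_
    · simp [*, P.bTail_ne_zero]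
    · simp [*]
    · rw [exp_add_logq]; ring
    · rw [exp_add_logq]; ring
    · simp only [qPow_add, qPow_sub, qPow_neg, qPow_one, qPow_βTail, qPow_α, qPow_β, qPow_γ,
        bTail_eq_mul]
      field_simp

theorem matBId_add_logq (hq : ‖P.q‖ < 1) (p : Fin M) (x : ℂ) :
    P.matBId p (x + P.logq) = P.matBId p x := by
  have hq0 := P.q_ne_zero
  have ha := P.a_ne_zero
  have hc := P.c_ne_zero
  have hb := P.b_ne_zero p
  have ht := P.bTail_ne_zero (p + 1)
  have hx := Complex.exp_ne_zero x
  ext i j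
  rcases i with _ | ⟨k, l⟩ <;> rcases j with _ | ⟨d, l'⟩ <;>
    simp only [matBId, Matrix.of_apply] <;> (try split_ifs) <;> try rfl
  all_goals
    refine theta_quotient_periodic hq _ x ?_ ?_ ?_ ?_ ?_
    · simp [*, P.bTail_ne_zero]
    · exact hx
    · rw [exp_add_logq]; ring
    · rw [exp_add_logq]
    · simp only [qPow_add, qPow_sub, qPow_one, qPow_βTail, qPow_α, qPow_β, qPow_γ,
        bTail_eq_mul]
      field_simp

theorem matSId_add_logq (hq : ‖P.q‖ < 1) (r : Fin (M - 1)) (x : ℂ) :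
    P.matSId r (x + P.logq) = P.matSId r x := by
  have hq0 := P.q_ne_zero
  have hc := P.c_ne_zero
  have hb := P.b_ne_zero (lo r)
  have hb' := P.b_ne_zero (hi r)
  have ht := P.bTail_ne_zero (r + 2)
  have hx := Complex.exp_ne_zero x
  have hB1 : P.bTail (r + 1) = P.b (hi r) * P.bTail (r + 2) := P.bTail_lo_succ r
  ext i j
  rcases i with _ | ⟨k, l⟩ <;> rcases j with _ | ⟨d, l'⟩ <;>
    simp only [matSId, Matrix.of_apply] <;> (try split_ifs) <;> try rfl
  all_goals
    refine theta_quotient_periodic hq _ x ?_ ?_ ?_ ?_ ?_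
    · simp [*]
    · exact mul_ne_zero hx hb
    · simp only [exp_add_logq]; try ring
    · rw [exp_add_logq]; ring
    · simp only [qPow_add, qPow_sub, qPow_neg, qPow_one, qPow_βTail, qPow_β, qPow_γ,
        bTail_r, hB1]
      field_simp

theorem shift_apply (j : Fin M) (τ : Fin M → ℂ) (i : Fin M) :
    P.shift j τ i = if i = j then τ i + P.logq else τ i := by
  rw [shift, Function.update_apply]
  split_ifs with h
  · rw [h]
  · rfl

theorem isPseudoConstant_matA (hq : ‖P.q‖ < 1) (p : Fin M) (σ : Equiv.Perm (Fin M))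
    (i j : Idx N M) : P.IsPseudoConstant fun τ => P.matA p σ τ i j := by
  intro k τ
  simp only [matA, shift_apply]
  split_ifs
  · exact congrFun (congrFun (matAId_add_logq (P := P.perm σ) hq p _) i) j
  · rfl

theorem isPseudoConstant_matB (hq : ‖P.q‖ < 1) (p : Fin M) (σ : Equiv.Perm (Fin M))
    (i j : Idx N M) : P.IsPseudoConstant fun τ => P.matB p σ τ i j := by
  intro k τ
  simp only [matB, shift_apply]
  split_ifs
  · exact congrFun (congrFun (matBId_add_logq (P := P.perm σ) hq p _) i) j
  · rfl

theorem isPseudoConstant_matS (hq : ‖P.q‖ < 1) (r : Fin (M - 1)) (σ : Equiv.Perm (Fin M))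
    (i j : Idx N M) : P.IsPseudoConstant fun τ => P.matS r σ τ i j := by
  intro k τ
  have h := fun x => congrFun (congrFun (matSId_add_logq (P := P.perm σ) hq r x) i) j
  simp only [matS, shift_apply]
  split_ifs with h1 h2
  · exact absurd (σ.injective (h1.trans h2.symm)) (lo_ne_hi r)
  · rw [add_sub_right_comm]
    exact h _
  -- Shifting the variable at position `r + 1` divides `t_r/t_{r+1}` by `q`, so the periodicity is
  -- applied at the shifted point, in the opposite direction.
  · rw [← h (τ (σ (lo r)) - (τ (σ (hi r)) + P.logq))]
    congr 1
    rw [show (P.perm σ).logq = P.logq from rfl]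
    ring
  · rfl

end Params

end QConn

end

theorem theorem1 {N M : ℕ} (P : QConn.Params N M) (hq : ‖P.q‖ < 1)
    (hgen : ∀ σ : Equiv.Perm (Fin M), (P.perm σ).Generic) :
    (∀ L ≤ M, ∀ σ : Equiv.Perm (Fin M),
      (∀ τ ∈ P.region L σ, P.Converges L σ τ) ∧ ∃ V, P.IsContinuation L σ V) ∧
    (∀ L₁ ≤ M, ∀ L₂ ≤ M, ∀ (σ₁ σ₂ : Equiv.Perm (Fin M)) (w : List (Fin (M - 1))),
      σ₂ = QConn.Params.wordPerm σ₁ w →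
      ∀ V₁ V₂ : (Fin M → ℂ) → QConn.Idx N M → ℂ,
        P.IsContinuation L₁ σ₁ V₁ → P.IsContinuation L₂ σ₂ V₂ →
        ∀ τ ∈ P.regular,
          V₂ τ = (P.prodA L₂ σ₂ τ * P.prodS σ₁ τ w * P.prodB L₁ σ₁ τ).mulVec (V₁ τ)) ∧
    (∀ (σ : Equiv.Perm (Fin M)) (i j : QConn.Idx N M),
      (∀ p : Fin M, P.IsPseudoConstant (fun τ => P.matA p σ τ i j) ∧
        P.IsPseudoConstant (fun τ => P.matB p σ τ i j)) ∧
      (∀ r : Fin (M - 1), P.IsPseudoConstant (fun τ => P.matS r σ τ i j))) := by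
  refine ⟨fun L hL σ => ⟨fun τ hτ => QConn.Params.converges hq hgen hτ,
    QConn.Params.continuation_exists hq hgen hL σ⟩, ?_, fun σ i j =>
    ⟨fun p => ⟨QConn.Params.isPseudoConstant_matA hq p σ i j,
      QConn.Params.isPseudoConstant_matB hq p σ i j⟩,
      fun r => QConn.Params.isPseudoConstant_matS hq r σ i j⟩⟩
  rintro L₁ hL₁ L₂ hL₂ σ₁ _ w rfl V₁ V₂ hV₁ hV₂ τ hτ
  exact QConn.Params.connection_formula hq hgen hL₁ hL₂ σ₁ w hV₁ hV₂ hτ
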